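/- **Lemma 14.1.** There exist subsets $C\subset M^1\subset M\subset\mathbb{C}^3$ with the following properties. (i) $M$ is a connected embedded $\mathcal{C}^\infty$-smooth submanifold of $\mathbb{C}^3$ of real dimension $4$, generic ($T_pM+J\,T_pM=T_p\mathbb{C}^3$ for all $p\in M$) of CR dimension $1$ ($T^c_pM:=T_pM\cap J\,T_pM$ has complex dimension $1$), and diffeomorphic to the open ball of $\mathbb{R}^4$. (ii) $M^1$ is a connected embedded $\mathcal{C}^\infty$-smooth submanifold of real dimension $3$, contained in $M$, maximally real ($T_pM^1\oplus J\,T_pM^1=T_p\mathbb{C}^3$ for all $p\in M^1$), and diffeomorphic to the open ball of $\mathbb{R}^3$. (iii) $C$ is compact, smoothly diffeomorphic to the two-dimensional torus $S^1\times S^1$, and everywhere transversal to the characteristic foliation $\mathcal{F}^c_{M^1}$ of $M^1$, whose leaves are the integral curves of the line field $TM^1\cap T^cM|_{M^1}$: $T_pC+(T_pM^1\cap T^c_pM)=T_pM^1$ for all $p\in C$. For every $0<\alpha<1$ the following condition $\mathcal{F}^c_{M^1}\{C\}$ fails: for every nonempty closed $C'\subset C$ there are a simple $\mathcal{C}^{2,\alpha}$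 curve $\gamma:[-1,1]\to M^1$ contained in a single leaf, with $\gamma(-1),\gamma(1)\notin C'$ and $\gamma(0)\in C'$, a two-dimensional submanifold $R\subset M^1$ through $\gamma(0)$ transversal to the foliation, and an open neighbourhood $V\supset R$ of $\gamma[-1,1]$ in $M^1$, such that each leaf of $\mathcal{F}^c_{M^1}|_V$ meets $R$ in exactly one point and $\gamma(0)$ lies on the boundary, relative to $R$, of the image of $C'\cap V$ under the projection $V\to R$ along the leaves. (iv) At every point $p\in M$ the Lie brackets of length at most $4$ of smooth local sections of $T^cM$ span $T_pM$ (type $4$ in the sense of Bloom and Graham). Moreover $M$ is globally minimal: any two points of $M$ are joined by a piecewise smooth curve in $M$ with nonzero velocities in $T^cM$. (v) $C$ is neither CR- nor $\mathcal{W}$-removable, and it is not $L^{\mathsf p}$-removable for any $1\le{\mathsf p}<2$ (in particular it is not $L^{\mathsf p}$-removable for all ${\mathsf p}\in[1,\infty]$). Here a local wedge of edge $M'$ at $p\in M'$ is a set $\{q+c:\ q\in M'\cap U,\ c\in\Gamma\}\cap\Delta(p,\delta)$, with $U$ an open neighbourhood of $p$, $\Gamma$ a nonempty open infinite cone in a real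 linear complement of $T_pM'$ and $\Delta(p,\delta)$ a polydisc; a wedgelike domain attached to $M'$ is a nonempty connected open subset of $\mathbb{C}^3$ containing a local wedge of edge $M'$ at every point of $M'$. A locally integrable function $f$ on an open subset $S$ of $M$ is CR if $\int_S f\,\bar\partial g\wedge dz_1\wedge dz_2\wedge dz_3=0$ for all smooth compactly supported $g$ on $S$. The set $C$ is *CR-removable* if there is a wedgelike domain $\mathcal{W}$ attached to $M$ such that every continuous CR function $f$ on $M\setminus C$ extends to a function continuous on $\mathcal{W}\cup(M\setminus C)$ and holomorphic in $\mathcal{W}$; *$\mathcal{W}$-removable* if for every wedgelike domain $\mathcal{W}_1$ attached to $M\setminus C$ there are a wedgelike domain $\mathcal{W}_2$ attached to $M$ and a wedgelike domain $\mathcal{W}_3\subset\mathcal{W}_1\cap\mathcal{W}_2$ attached to $M\setminus C$ such that every $f\in\mathcal{O}(\mathcal{W}_1)$ coincides on $\mathcal{W}_3$ with some $F\in\mathcal{O}(\mathcal{W}_2)$; *$L^{\mathsf p}$-removable* if every $f\in L^{\mathsf p}_{loc}(M)$ which is CR on $M\setminus C$ is CR on $M$. -/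

import Mathlib

open Set Filter Topology MeasureTheory
open scoped ContDiff Manifold ENNReal NNReal

noncomputable section

/-- Complex three-space. The norm is the sup norm, so metric balls are polydiscs. -/
abbrev C3 : Type := Fin 3 → ℂ

/-- Real Euclidean space of dimension `d`. -/
abbrev RR (d : ℕ) : Type := EuclideanSpace ℝ (Fin d)

/-! ### Embedded submanifolds -/

/-- `Φ : V → S` is a local parametrization of class `C^k` of the `d`-dimensional embedded
submanifold `S`: a `C^k` immersion of an open subset `V` of `ℝ^d` which is a homeomorphism onto a
relatively open subset of `S`. -/
structure IsLocalParam (k : WithTop ℕ∞) (d : ℕ) (S : Set C3) (Φ : RR d → C3)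
    (V : Set (RR d)) : Prop where
  isOpen : IsOpen V
  contDiffOn : ContDiffOn ℝ k Φ V
  immersion : ∀ t ∈ V, Function.Injective (fderiv ℝ Φ t)
  isEmbedding : IsEmbedding (fun t : V => Φ t)
  image_eq : ∃ O : Set C3, IsOpen O ∧ Φ '' V = S ∩ O

/-- Connected embedded submanifolds of `ℂ³` of class `C^k` and real dimension `d`. -/
def IsSubmanifold (k : WithTop ℕ∞) (d : ℕ) (S : Set C3) : Prop :=
  IsConnected S ∧ ∀ p ∈ S, ∃ (Φ : RR d → C3) (V : Set (RR d)),
    IsLocalParam k d S Φ V ∧ p ∈ Φ '' V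

/-- `S` is smoothly diffeomorphic to the open unit ball of `ℝ^d`. -/
def IsDiffeoToBall (d : ℕ) (S : Set C3) : Prop :=
  ∃ Φ : RR d → C3, IsLocalParam ∞ d S Φ (Metric.ball 0 1) ∧ Φ '' Metric.ball 0 1 = S

/-- `S` is smoothly diffeomorphic to the two-dimensional torus: it is the image of an injective
smooth immersion (by compactness, an embedding) of the product of two circles. -/
def IsDiffeoToTorus (S : Set C3) : Prop :=
  ∃ Ψ : Circle × Circle → C3,
    ContMDiff ((𝓡 1).prod (𝓡 1)) 𝓘(ℝ, C3) ∞ Ψ ∧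
    Function.Injective Ψ ∧
    (∀ t, Function.Injective (mfderiv ((𝓡 1).prod (𝓡 1)) 𝓘(ℝ, C3) Ψ t)) ∧
    range Ψ = S

/-- The tangent space `T_p S`, spanned by the velocities at `p` of curves in `S`. -/
def tangentAt (S : Set C3) (p : C3) : Submodule ℝ C3 :=
  Submodule.span ℝ {v | ∃ γ : ℝ → C3, γ 0 = p ∧ (∀ᶠ s in 𝓝 0, γ s ∈ S) ∧ HasDerivAt γ v 0}

/-! ### CR geometry -/

/-- The complex structure of `ℂ³`, as a real linear map. -/
def J : C3 →ₗ[ℝ] C3 := Complex.I • LinearMap.id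

/-- The complex tangent space `T_p^c M = T_p M ∩ J T_p M`. -/
def complexTangentAt (M : Set C3) (p : C3) : Submodule ℝ C3 :=
  tangentAt M p ⊓ (tangentAt M p).map J

/-- `T_p M + J T_p M = T_p ℂ³` at every point. -/
def IsGeneric (M : Set C3) : Prop :=
  ∀ p ∈ M, tangentAt M p ⊔ (tangentAt M p).map J = ⊤

/-- The complex tangent spaces have complex dimension `m`, that is, real dimension `2 m`. -/
def HasCRDim (m : ℕ) (M : Set C3) : Prop :=
  ∀ p ∈ M, Module.finrank ℝ (complexTangentAt M p) = 2 * m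

/-- `T_p M ⊕ J T_p M = T_p ℂ³` at every point. -/
def IsMaximallyReal (M : Set C3) : Prop :=
  ∀ p ∈ M, IsCompl (tangentAt M p) ((tangentAt M p).map J)

/-- `IsCRBracket M U k X`: on the open set `U` the vector field `X` is an iterated Lie bracket of
length `k` of smooth vector fields which are sections of `T^c M` along `M ∩ U`. -/
inductive IsCRBracket (M U : Set C3) : ℕ → (C3 → C3) → Prop
  | base (X : C3 → C3) : ContDiffOn ℝ ∞ X U → (∀ q ∈ M ∩ U, X q ∈ complexTangentAt M q) →
      IsCRBracket M U 1 X
  | bracket (j k : ℕ) (X Y : C3 → C3) : IsCRBracket M U j X → IsCRBracket M U k Y →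
      IsCRBracket M U (j + k) (VectorField.lieBracket ℝ X Y)

/-- The Lie brackets of `T^c M` up to length `m` generate `T_p M`. -/
def IsOfTypeAt (m : ℕ) (M : Set C3) (p : C3) : Prop :=
  Submodule.span ℝ {v | ∃ (U : Set C3) (k : ℕ) (X : C3 → C3),
    IsOpen U ∧ p ∈ U ∧ k ≤ m ∧ IsCRBracket M U k X ∧ X p = v} = tangentAt M p

/-- `p` and `q` are joined by a smooth curve in `M` whose velocity is complex tangent and
nonzero. -/
def IsCRArc (M : Set C3) (p q : C3) : Prop :=
  ∃ γ : ℝ → C3, ContDiffOn ℝ ∞ γ (Icc 0 1) ∧ γ 0 = p ∧ γ 1 = q ∧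
    ∀ s ∈ Icc (0 : ℝ) 1, γ s ∈ M ∧
      derivWithin γ (Icc 0 1) s ∈ complexTangentAt M (γ s) ∧ derivWithin γ (Icc 0 1) s ≠ 0

/-- `M` consists of a single CR orbit: any two of its points are joined by a piecewise smooth
complex tangent curve. -/
def IsGloballyMinimal (M : Set C3) : Prop :=
  ∀ p ∈ M, ∀ q ∈ M, Relation.ReflTransGen (IsCRArc M) p q

/-! ### The characteristic foliation -/

/-- The characteristic line `T_p M¹ ∩ T_p^c M`. -/
def charDir (M M1 : Set C3) (p : C3) : Submodule ℝ C3 :=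
  tangentAt M1 p ⊓ complexTangentAt M p

/-- The leaf through `p` of the restriction of the characteristic foliation of `M¹` to the
relatively open subset `V` of `M¹`. -/
def charLeaf (M M1 V : Set C3) (p : C3) : Set C3 :=
  {q | ∃ σ : ℝ → C3, ContDiffOn ℝ 1 σ (Icc 0 1) ∧ σ 0 = p ∧ σ 1 = q ∧
    ∀ s ∈ Icc (0 : ℝ) 1, σ s ∈ V ∧ derivWithin σ (Icc 0 1) s ∈ charDir M M1 (σ s)}

/-- A submanifold `S ⊂ M¹` is transversal to the characteristic foliation of `M¹`. -/
def IsCharTransversal (M M1 S : Set C3) : Prop :=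
  ∀ p ∈ S, tangentAt S p ⊔ charDir M M1 p = tangentAt M1 p

/-- The image of `A ∩ V` under the projection of `V` onto the transversal `R` along the leaves of
the characteristic foliation restricted to `V`. -/
def charProj (M M1 V R A : Set C3) : Set C3 :=
  {q ∈ R | ∃ z ∈ A ∩ V, q ∈ charLeaf M M1 V z}

/-- Curves `[-1, 1] → ℂ³` of class `C^{2,α}`. -/
def IsC2Holder (α : ℝ≥0) (γ : ℝ → C3) : Prop :=
  ContDiffOn ℝ 2 γ (Icc (-1) 1) ∧
    ∃ K : ℝ≥0, HolderOnWith K α (iteratedDerivWithin 2 γ (Icc (-1) 1)) (Icc (-1) 1)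

/-- The nontransversality condition `F^c_{M¹}{C}`: for every nonempty closed `C' ⊂ C` there are a
simple `C^{2,α}` curve `γ : [-1, 1] → M¹` in a single leaf with `γ (-1), γ 1 ∉ C'` and
`γ 0 ∈ C'`, a two-dimensional transversal `R` through `γ 0` and a neighbourhood `V` of
`γ [-1, 1]` in `M¹`, each of whose leaves meets `R` in exactly one point, such that `γ 0` lies on
the boundary in `R` of the projection of `C' ∩ V` along the leaves. -/
def NontransversalityCondition (α : ℝ≥0) (M M1 C : Set C3) : Prop :=
  ∀ C' : Set C3, C'.Nonempty → (∃ Z, IsClosed Z ∧ C' = C ∩ Z) →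
    ∃ γ : ℝ → C3, IsC2Holder α γ ∧ InjOn γ (Icc (-1) 1) ∧
      (∀ s ∈ Icc (-1 : ℝ) 1, γ s ∈ charLeaf M M1 M1 (γ 0)) ∧
      γ (-1) ∉ C' ∧ γ 0 ∈ C' ∧ γ 1 ∉ C' ∧
      ∃ R V : Set C3, IsSubmanifold 1 2 R ∧ γ 0 ∈ R ∧ R ⊆ V ∧ IsCharTransversal M M1 R ∧
        (∃ O, IsOpen O ∧ V = M1 ∩ O) ∧ γ '' Icc (-1) 1 ⊆ V ∧
        (∀ z ∈ V, ∃! q, q ∈ R ∧ q ∈ charLeaf M M1 V z) ∧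
        γ 0 ∈ closure (charProj M M1 V R C') ∩ closure (R \ charProj M M1 V R C')

/-! ### CR functions in the sense of distributions -/

/-- The value at `t` of the pull-back by `Φ` of the four-form
`dg ∧ dz₁ ∧ dz₂ ∧ dz₃ = ∂̄(g dz₁ ∧ dz₂ ∧ dz₃)`, on the standard basis of `ℝ⁴`, where `G` is the
pull-back of `g`. -/
def dbarForm (Φ : RR 4 → C3) (G : RR 4 → ℂ) (t : RR 4) : ℂ :=
  Matrix.det (Matrix.of
    ![fun j : Fin 4 => fderiv ℝ G t (EuclideanSpace.single j 1),
      fun j : Fin 4 => fderiv ℝ Φ t (EuclideanSpace.single j 1) 0,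
      fun j : Fin 4 => fderiv ℝ Φ t (EuclideanSpace.single j 1) 1,
      fun j : Fin 4 => fderiv ℝ Φ t (EuclideanSpace.single j 1) 2])

/-- `f ∈ L^p_loc(S)` for a four-dimensional smooth submanifold `S`. -/
def IsLpLoc (p : ℝ≥0∞) (S : Set C3) (f : C3 → ℂ) : Prop :=
  ∀ (Φ : RR 4 → C3) (V : Set (RR 4)), IsLocalParam ∞ 4 S Φ V →
    ∀ K ⊆ V, IsCompact K → MemLp (fun t => f (Φ t)) p (volume.restrict K)

/-- `f` is a locally integrable function on the four-dimensional submanifold `S` of CR dimension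
one which is CR in the distributional sense: `∫_S f ∂̄ψ = 0` for all smooth compactly supported
`(3,0)`-forms `ψ = g dz₁ ∧ dz₂ ∧ dz₃` on `S`; by a partition of unity it is enough to let `g` be
supported in a coordinate patch. -/
def IsDistCR (S : Set C3) (f : C3 → ℂ) : Prop :=
  IsLpLoc 1 S f ∧
  ∀ (Φ : RR 4 → C3) (V : Set (RR 4)), IsLocalParam ∞ 4 S Φ V →
    ∀ G : RR 4 → ℂ, ContDiff ℝ ∞ G → HasCompactSupport G → tsupport G ⊆ V →
      ∫ t in V, f (Φ t) * dbarForm Φ G t = 0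

/-! ### Wedges -/

/-- `W` is a local wedge of edge `M` at `p`: the set of all `q + c` in a polydisc centred at `p`,
with `q ∈ M` near `p` and `c` in a nonempty open infinite cone of the normal space `T_p ℂ³ / T_p M`,
realized as a linear complement `N` of `T_p M`. -/
def IsLocalWedge (M : Set C3) (p : C3) (W : Set C3) : Prop :=
  ∃ (N : Submodule ℝ C3) (O Γ U : Set C3) (δ : ℝ),
    IsCompl (tangentAt M p) N ∧
    IsOpen O ∧ Γ = O ∩ N ∧ Γ.Nonempty ∧ (∀ c ∈ Γ, ∀ r : ℝ, 0 < r → r • c ∈ Γ) ∧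
    IsOpen U ∧ p ∈ U ∧ 0 < δ ∧
    W = {z | ∃ q ∈ M ∩ U, ∃ c ∈ Γ, z = q + c} ∩ Metric.ball p δ

/-- A (nonempty) wedgelike domain attached to `M`. -/
def IsWedgelikeDomain (M W : Set C3) : Prop :=
  IsOpen W ∧ IsConnected W ∧ ∀ p ∈ M, ∃ W' ⊆ W, IsLocalWedge M p W'

/-! ### Removability -/

/-- There is a wedgelike domain attached to `M` to which every continuous CR function on `M \ C`
extends holomorphically (with continuous boundary values on `M \ C`). -/
def IsCRRemovable (M C : Set C3) : Prop :=
  ∃ W, IsWedgelikeDomain M W ∧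
    ∀ f : C3 → ℂ, ContinuousOn f (M \ C) → IsDistCR (M \ C) f →
      ∃ F : C3 → ℂ, DifferentiableOn ℂ F W ∧ ContinuousOn F (W ∪ (M \ C)) ∧ EqOn F f (M \ C)

/-- For every wedgelike domain `W₁` attached to `M \ C` there are a wedgelike domain `W₂` attached
to `M` and a wedgelike domain `W₃ ⊂ W₁ ∩ W₂` attached to `M \ C` such that every holomorphic
function on `W₁` coincides on `W₃` with a holomorphic function on `W₂`. -/
def IsWRemovable (M C : Set C3) : Prop :=
  ∀ W₁, IsWedgelikeDomain (M \ C) W₁ →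
    ∃ W₂ W₃, IsWedgelikeDomain M W₂ ∧ IsWedgelikeDomain (M \ C) W₃ ∧ W₃ ⊆ W₁ ∩ W₂ ∧
      ∀ f : C3 → ℂ, DifferentiableOn ℂ f W₁ →
        ∃ F : C3 → ℂ, DifferentiableOn ℂ F W₂ ∧ EqOn F f W₃

/-- Every `f ∈ L^p_loc(M)` which is CR on `M \ C` is CR on `M`. -/
def IsLpRemovable (p : ℝ≥0∞) (M C : Set C3) : Prop :=
  ∀ f : C3 → ℂ, IsLpLoc p M f → IsDistCR (M \ C) f → IsDistCR M f

end

/-! The torus C is the zero set of a polynomial ρ in the real unit ball M¹ of ℝ³ ⊂ ℂ³, and ρ extends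
to an entire function h. The manifold M ⊃ M¹ is arranged so that h vanishes on M exactly along C.
The function 1/h then defeats every notion of removability.

M consists of the points x + i(sX(x) + s²Y(x) + s³Z(x)) with s small. At s = 0 its complex tangent
line is spanned over ℂ by X, so the characteristic leaves of M¹ are the integral curves of X.
Everything geometric follows from dρ(X) > 0 on ρ = 0. C is transversal to the leaves. The
s-derivative of Im h at C equals dρ(X), so a thin M has no zeros of h off the real slice. Also dh
does not vanish on T^cM along C. The foliation condition fails already for C' = C: near a point of C
every leaf crosses C, so the projection of C along the leaves covers a neighbourhood of γ(0) in R.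

X must moreover have no zero on the whole ball. This is possible because the Gauss map of a torus
has degree zero. Explicitly, with f = 4(x² + y²) - 1, the direction of X is the inverse
stereographic image of 2(f + i)(x + iy)/N(z), where N > 0. The factor f + i twists the horizontal
part so that it survives at f = 0, where the normal is vertical. Y and Z are the two coordinate
derivatives of the inverse stereographic map up to positive factors, hence orthogonal to X and to
each other.

T^cM has coordinate sections α and β, with β corresponding to i times α. At s = 0 one finds [β,α] =
2Y and [β,[β,α]] = 6Z plus a term in X alone. `CRFrame.ofOrthogonal` rescales Z so that these are
independent modulo β together with X. Independence persists for small s. It gives the type condition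
with brackets of length at most 3. By `eventually_equiv_of_span_lieBracket` it also makes CR orbits
open, so connectedness leaves only one.

For nonremovability, 1/h is CR on M \ C as the restriction of a holomorphic function. On M, 0 is a
regular value of h, so C has codimension two and 1/h lies in L^p_loc for p < 2. In a chart where h
is y₀ + iy₁, testing against Gaussians shows that 1/h is not CR across C
(`exists_integral_inv_mul_dbarForm_ne_zero`). If 1/h had a holomorphic extension F to a wedgelike
domain attached to M, then Fh = 1 there by uniqueness. But every local wedge at a point of C
contains a zero of h (`IsLocalWedge.exists_zero`). -/

/-! ### Local flows -/

section Flow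

variable {E : Type*} [NormedAddCommGroup E] [NormedSpace ℝ E] [CompleteSpace E]

/-- A `C¹` vector field has a local flow that is Lipschitz in the initial point and stays in a
prescribed neighbourhood. -/
theorem exists_lipschitz_flow {F : E → E} {q : E} (hF : ContDiffAt ℝ 1 F q) {N : Set E}
    (hN : N ∈ 𝓝 q) :
    ∃ r > (0 : ℝ), ∃ ε > (0 : ℝ), ∃ (α : E → ℝ → E) (L : ℝ≥0),
      (∀ x ∈ Metric.ball q r, α x 0 = x ∧ ∀ t ∈ Ioo (-ε) ε, α x t ∈ N ∧
        HasDerivAt (α x) (F (α x t)) t) ∧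
      ∀ t ∈ Ioo (-ε) ε, LipschitzOnWith L (α · t) (Metric.ball q r) := by
  obtain ⟨ε, hε, a, r, L, K, hr, hpl⟩ := IsPicardLindelof.of_contDiffAt_one hF
  obtain ⟨α, hα, L', hL'⟩ :=
    (hpl 0).exists_forall_mem_closedBall_eq_hasDerivWithinAt_lipschitzOnWith
  simp only [zero_sub, zero_add] at hα hL'
  obtain ⟨ρ, hρ, hρN⟩ := Metric.mem_nhds_iff.1 hN
  have hq : q ∈ Metric.closedBall q r := Metric.mem_closedBall_self r.2
  have hc : ContinuousAt (α q) 0 :=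
    (((hα q hq).2 0 ⟨by linarith, hε.le⟩).hasDerivAt
      (Icc_mem_nhds (by linarith) hε)).continuousAt
  have hc' := hc (Metric.ball_mem_nhds _ (half_pos hρ))
  rw [(hα q hq).1] at hc'
  obtain ⟨ε', hε', hsub⟩ := Metric.mem_nhds_iff.1 hc'
  refine ⟨min r (ρ / 2 / (L' + 1)), by positivity, min ε ε', lt_min hε hε', α, L', ?_, ?_⟩
  · intro x hx
    have hxr : x ∈ Metric.closedBall q r :=
      Metric.ball_subset_closedBall (Metric.ball_subset_ball (min_le_left _ _) hx)
    refine ⟨(hα x hxr).1, fun t ht => ?_⟩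
    have ht1 : t ∈ Ioo (-ε) ε :=
      ⟨by linarith [ht.1, min_le_left ε ε'], lt_of_lt_of_le ht.2 (min_le_left _ _)⟩
    have ht2 : t ∈ Metric.ball (0 : ℝ) ε' := by
      rw [Metric.mem_ball, Real.dist_eq, sub_zero, abs_lt]
      exact ⟨by linarith [ht.1, min_le_right ε ε'], lt_of_lt_of_le ht.2 (min_le_right _ _)⟩
    refine ⟨hρN ?_, ((hα x hxr).2 t (Ioo_subset_Icc_self ht1)).hasDerivAt
      (Icc_mem_nhds ht1.1 ht1.2)⟩
    have h1 : dist (α x t) (α q t) ≤ L' * dist x q :=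
      (hL' t (Ioo_subset_Icc_self ht1)).dist_le_mul x hxr q hq
    have h2 : dist (α q t) q < ρ / 2 := hsub ht2
    have h3 : dist x q < ρ / 2 / (L' + 1) := lt_of_lt_of_le hx (min_le_right _ _)
    have h4 : (L' : ℝ) * dist x q ≤ ρ / 2 := by
      rw [lt_div_iff₀ (by positivity)] at h3
      nlinarith [dist_nonneg (x := x) (y := q)]
    exact lt_of_le_of_lt (dist_triangle _ (α q t) _) (by linarith)
  · intro t ht
    have ht1 : t ∈ Ioo (-ε) ε :=
      ⟨by linarith [ht.1, min_le_left ε ε'], lt_of_lt_of_le ht.2 (min_le_left _ _)⟩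
    refine (hL' t (Ioo_subset_Icc_self ht1)).mono ?_
    exact (Metric.ball_subset_ball (min_le_left _ _)).trans Metric.ball_subset_closedBall

/-- A function with derivative bounded in terms of itself stays small: Grönwall with zero initial
value. -/
theorem norm_le_mul_exp_of_norm_deriv_le {F : Type*} [NormedAddCommGroup F] [NormedSpace ℝ F]
    {d d' : ℝ → F} {K η τ : ℝ} (hK : 1 ≤ K) (hη : 0 ≤ η) (hτ : 0 ≤ τ)
    (hd : ∀ t ∈ Icc 0 τ, HasDerivAt d (d' t) t) (h0 : d 0 = 0)
    (hb : ∀ t ∈ Icc 0 τ, ‖d' t‖ ≤ K * ‖d t‖ + η) : ‖d τ‖ ≤ η * Real.exp (K * τ) := by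
  have h := norm_le_gronwallBound_of_norm_deriv_right_le (f := d) (f' := d') (δ := 0) (K := K)
    (ε := η) (a := 0) (b := τ) (fun t ht => (hd t ht).continuousAt.continuousWithinAt)
    (fun t ht => (hd t (Ico_subset_Icc_self ht)).hasDerivWithinAt) (by simp [h0])
    (fun t ht => hb t (Ico_subset_Icc_self ht)) τ ⟨hτ, le_rfl⟩
  -- The closed form divides by K; K ≥ 1 rules out the degenerate case and allows η / K to be
  -- replaced by η.
  rw [gronwallBound_of_K_ne_0 (by linarith)] at h
  simp only [zero_mul, zero_add, sub_zero] at h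
  refine h.trans ?_
  have h1 : η / K ≤ η := div_le_self hη hK
  have h2 : (0 : ℝ) ≤ Real.exp (K * τ) - 1 := by
    have := Real.add_one_le_exp (K * τ)
    nlinarith
  calc η / K * (Real.exp (K * τ) - 1) ≤ η * (Real.exp (K * τ) - 1) := by gcongr
    _ ≤ η * Real.exp (K * τ) := by nlinarith

/-- The flow of a vector field is strictly differentiable in the initial point, with derivative
given by a solution of the linearized equation. -/
theorem hasStrictFDerivAt_flow {B : E → E} {N : Set E} (hNc : Convex ℝ N) (hNo : IsOpen N)
    (hB : DifferentiableOn ℝ B N) {K K' : ℝ≥0} (hK : ∀ x ∈ N, ‖fderiv ℝ B x‖ ≤ K)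
    (hK' : LipschitzOnWith K' (fderiv ℝ B) N) {φ : E → ℝ → E} {L : ℝ≥0} {S : Set E} {ε τ : ℝ}
    (hτ : τ ∈ Ico 0 ε)
    (h0 : ∀ y ∈ S, φ y 0 = y) (hφN : ∀ y ∈ S, ∀ t ∈ Ioo (-ε) ε, φ y t ∈ N)
    (hφ : ∀ y ∈ S, ∀ t ∈ Ioo (-ε) ε, HasDerivAt (φ y) (B (φ y t)) t)
    (hL : ∀ t ∈ Ioo (-ε) ε, LipschitzOnWith L (φ · t) S) {y₀ : E} (hy₀ : S ∈ 𝓝 y₀)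
    {V : ℝ → E →L[ℝ] E} (hV0 : V 0 = ContinuousLinearMap.id ℝ E)
    (hV : ∀ t ∈ Ioo (-ε) ε, HasDerivAt V ((fderiv ℝ B (φ y₀ t)).comp (V t)) t) :
    HasStrictFDerivAt (fun y => φ y τ) (V τ) y₀ := by
  rw [hasStrictFDerivAt_iff_isLittleO, Asymptotics.isLittleO_iff]
  intro c hc
  -- On a ball of radius c / k about y₀, Grönwall yields an error at most K' L² e^((K+1)τ) (c / k)
  -- ‖y - y'‖, which this k brings below c ‖y - y'‖. The added 1 keeps k positive.
  set k : ℝ := K' * L * L * Real.exp ((K + 1) * τ) + 1 with hk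
  have hkpos : 0 < k := by positivity
  have hS : y₀ ∈ S := mem_of_mem_nhds hy₀
  have hnear : ∀ᶠ y in 𝓝 y₀, y ∈ S ∧ dist y y₀ < c / k :=
    Eventually.and hy₀ (Metric.ball_mem_nhds _ (div_pos hc hkpos))
  rw [nhds_prod_eq]
  filter_upwards [hnear.prod_mk hnear] with p hp
  obtain ⟨⟨hyS, hyd⟩, hyS', hyd'⟩ := hp
  set y := p.1
  set y' := p.2
  have hI : ∀ t ∈ Icc 0 τ, t ∈ Ioo (-ε) ε := fun t ht =>
    ⟨by linarith [ht.1, hτ.1, hτ.2], lt_of_le_of_lt ht.2 hτ.2⟩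
  -- The deviation of φ y - φ y' from the linearized flow satisfies the linearized equation up to
  -- the Taylor remainder of B, which the Lipschitz bound on DB makes small. The rate is K + 1
  -- rather than K because the Grönwall lemma asks for a rate of at least 1.
  have key := norm_le_mul_exp_of_norm_deriv_le (K := K + 1) (η := K' * L * L * (c / k) * ‖y - y'‖)
    (d := fun t => φ y t - φ y' t - V t (y - y'))
    (d' := fun t => B (φ y t) - B (φ y' t) - fderiv ℝ B (φ y₀ t) (V t (y - y')))
    (by simp) (by positivity) hτ.1 ?_ (by simp [h0 y hyS, h0 y' hyS', hV0]) ?_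
  · refine key.trans ?_
    have : K' * L * L * Real.exp ((K + 1) * τ) * (c / k) ≤ c := by
      rw [mul_div_assoc', div_le_iff₀ hkpos, hk]; nlinarith
    calc _ = K' * L * L * Real.exp ((K + 1) * τ) * (c / k) * ‖y - y'‖ := by ring
      _ ≤ c * ‖y - y'‖ := by gcongr
  · intro t ht
    have := ((hφ y hyS t (hI t ht)).fun_sub (hφ y' hyS' t (hI t ht))).fun_sub
      ((hV t (hI t ht)).clm_apply (hasDerivAt_const t (y - y')))
    simpa using this
  · intro t ht
    set w := φ y t
    set w' := φ y' t
    set w₀ := φ y₀ t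
    have hw₀N : w₀ ∈ N := hφN _ hS t (hI t ht)
    have hLt := hL t (hI t ht)
    have e1 : ‖w - w'‖ ≤ L * ‖y - y'‖ := by
      simpa [dist_eq_norm] using hLt.dist_le_mul y hyS y' hyS'
    have hb1 : dist w w₀ ≤ L * (c / k) := (hLt.dist_le_mul y hyS y₀ hS).trans (by gcongr)
    have hb2 : dist w' w₀ ≤ L * (c / k) := (hLt.dist_le_mul y' hyS' y₀ hS).trans (by gcongr)
    have hconv : Convex ℝ (N ∩ Metric.closedBall w₀ (L * (c / k))) :=
      hNc.inter (convex_closedBall _ _)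
    have hmv : ‖B w - B w' - fderiv ℝ B w₀ (w - w')‖ ≤ K' * (L * (c / k)) * ‖w - w'‖ := by
      refine hconv.norm_image_sub_le_of_norm_fderiv_le' (𝕜 := ℝ) (f := B) ?_ ?_
        ⟨hφN _ hyS' t (hI t ht), hb2⟩ ⟨hφN _ hyS t (hI t ht), hb1⟩
      · intro x hx
        exact hB.differentiableAt (hNo.mem_nhds hx.1)
      · intro x hx
        have := hK'.dist_le_mul x hx.1 w₀ hw₀N
        rw [dist_eq_norm] at this
        refine this.trans ?_
        gcongr
        exact hx.2
    have hsplit : B w - B w' - fderiv ℝ B w₀ (V t (y - y')) =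
        fderiv ℝ B w₀ (w - w' - V t (y - y')) + (B w - B w' - fderiv ℝ B w₀ (w - w')) := by
      simp only [map_sub]; abel
    rw [hsplit]
    refine (norm_add_le _ _).trans ?_
    have f1 : ‖fderiv ℝ B w₀ (w - w' - V t (y - y'))‖ ≤ (K + 1) * ‖w - w' - V t (y - y')‖ := by
      refine (ContinuousLinearMap.le_opNorm _ _).trans ?_
      gcongr
      linarith [hK w₀ hw₀N]
    have f2 : ‖B w - B w' - fderiv ℝ B w₀ (w - w')‖ ≤ K' * L * L * (c / k) * ‖y - y'‖ := by
      refine hmv.trans ?_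
      calc _ ≤ K' * (L * (c / k)) * (L * ‖y - y'‖) := by gcongr
        _ = _ := by ring
    exact add_le_add f1 f2

/-- The flow of a vector field is jointly strictly differentiable at time zero. -/
theorem hasStrictFDerivAt_flow_zero {A : E → E} {φ : E → ℝ → E} {L : ℝ≥0} {S N : Set E} {ε : ℝ}
    (hε : 0 < ε) {K : ℝ≥0} (hA : LipschitzOnWith K A N)
    (h0 : ∀ y ∈ S, φ y 0 = y) (hφN : ∀ y ∈ S, ∀ t ∈ Ioo (-ε) ε, φ y t ∈ N)
    (hφ : ∀ y ∈ S, ∀ t ∈ Ioo (-ε) ε, HasDerivAt (φ y) (A (φ y t)) t)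
    (hL : ∀ t ∈ Ioo (-ε) ε, LipschitzOnWith L (φ · t) S) {y₀ : E} (hy₀ : S ∈ 𝓝 y₀) :
    HasStrictFDerivAt (fun p : E × ℝ => φ p.1 p.2)
      ((ContinuousLinearMap.fst ℝ E ℝ) +
        (ContinuousLinearMap.snd ℝ E ℝ).smulRight (A y₀)) (y₀, 0) := by
  rw [hasStrictFDerivAt_iff_isLittleO, Asymptotics.isLittleO_iff]
  intro c hc
  have hS : y₀ ∈ S := mem_of_mem_nhds hy₀
  have h0I : (0 : ℝ) ∈ Ioo (-ε) ε := ⟨by linarith, hε⟩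
  have hcont : ContinuousAt (φ y₀) 0 := (hφ y₀ hS 0 h0I).continuousAt
  set k : ℝ := K * L + K + 1
  have hk : 0 < k := by positivity
  set c' : ℝ := c / (3 * k)
  have hc' : 0 < c' := by positivity
  have hcc : 3 * k * c' = c := by simp only [c']; field_simp
  have e0 : ∀ᶠ t in 𝓝 (0 : ℝ), dist (φ y₀ t) y₀ < c' ∧ t ∈ Ioo (-ε) ε ∧ |t| < c' := by
    have := hcont (Metric.ball_mem_nhds _ hc')
    rw [h0 y₀ hS] at this
    refine Eventually.and this (Eventually.and (Ioo_mem_nhds h0I.1 h0I.2) ?_)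
    filter_upwards [Metric.ball_mem_nhds (0 : ℝ) hc'] with t ht
    simpa using ht
  obtain ⟨η, hη, hball⟩ := Metric.eventually_nhds_iff_ball.1 e0
  have hnear : ∀ᶠ p in 𝓝 (y₀, (0 : ℝ)), (p.1 ∈ S ∧ dist p.1 y₀ < c') ∧
      p.2 ∈ Metric.ball (0 : ℝ) η := by
    rw [nhds_prod_eq]
    have h1 : ∀ᶠ y in 𝓝 y₀, y ∈ S ∧ dist y y₀ < c' :=
      Eventually.and hy₀ (Metric.ball_mem_nhds _ hc')
    have h2 : ∀ᶠ t in 𝓝 (0 : ℝ), t ∈ Metric.ball (0 : ℝ) η := Metric.ball_mem_nhds _ hη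
    exact h1.prod_mk h2
  rw [nhds_prod_eq]
  filter_upwards [hnear.prod_mk hnear] with p hp
  obtain ⟨⟨⟨hyS, hyd⟩, ht⟩, ⟨hyS', hyd'⟩, ht'⟩ := hp
  obtain ⟨⟨y, t⟩, y', t'⟩ := p
  simp only at *
  have hdist : ‖y - y'‖ ≤ ‖((y, t) : E × ℝ) - (y', t')‖ := by simp [Prod.norm_def]
  have hdist' : |t - t'| ≤ ‖((y, t) : E × ℝ) - (y', t')‖ := by simp [Prod.norm_def]
  have hLip : ∀ u ∈ Metric.ball (0 : ℝ) η, ‖A (φ y u) - A (φ y' u)‖ ≤ K * L * ‖y - y'‖ := by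
    intro u hu
    have hu2 := (hball u hu).2.1
    rw [← dist_eq_norm, ← dist_eq_norm]
    calc _ ≤ K * dist (φ y u) (φ y' u) :=
          hA.dist_le_mul _ (hφN y hyS u hu2) _ (hφN y' hyS' u hu2)
      _ ≤ K * (L * dist y y') := by
          gcongr
          exact (hL u hu2).dist_le_mul y hyS y' hyS'
      _ = _ := by ring
  have hconv : Convex ℝ (Metric.ball (0 : ℝ) η) := convex_ball _ _
  have z0 : (0 : ℝ) ∈ Metric.ball (0 : ℝ) η := Metric.mem_ball_self hη
  have g1 : ‖(φ y t - φ y' t) - (φ y 0 - φ y' 0)‖ ≤ (K * L * ‖y - y'‖) * ‖t - 0‖ :=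
    hconv.norm_image_sub_le_of_norm_hasDerivWithin_le (f := fun u => φ y u - φ y' u)
      (f' := fun u => A (φ y u) - A (φ y' u))
      (fun u hu => ((hφ y hyS u (hball u hu).2.1).sub
        (hφ y' hyS' u (hball u hu).2.1)).hasDerivWithinAt) hLip z0 ht
  have g2 : ‖(φ y' t - t • A y₀) - (φ y' t' - t' • A y₀)‖ ≤ (K * ((L + 1) * c')) * ‖t - t'‖ := by
    refine hconv.norm_image_sub_le_of_norm_hasDerivWithin_le (f := fun u => φ y' u - u • A y₀)
      (f' := fun u => A (φ y' u) - A y₀) (fun u hu => ?_) (fun u hu => ?_) ht' ht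
    · have := (hφ y' hyS' u (hball u hu).2.1).fun_sub ((hasDerivAt_id u).smul_const (A y₀))
      simpa using this.hasDerivWithinAt
    · have hu2 := (hball u hu).2.1
      have hy0N : y₀ ∈ N := by simpa [h0 y₀ hS] using hφN y₀ hS 0 h0I
      rw [← dist_eq_norm]
      refine (hA.dist_le_mul _ (hφN y' hyS' u hu2) _ hy0N).trans ?_
      gcongr
      have t1 := (hL u hu2).dist_le_mul y' hyS' y₀ hS
      have t2 := (hball u hu).1
      have t3 : (L : ℝ) * dist y' y₀ ≤ L * c' := by gcongr
      linarith [dist_triangle (φ y' u) (φ y₀ u) y₀]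
  -- The increment is separated into a change of initial point at the fixed time t and a change of
  -- time along the trajectory of y'. Each part has a small derivative in time.
  have hsplit : φ y t - φ y' t' - ((ContinuousLinearMap.fst ℝ E ℝ +
      (ContinuousLinearMap.snd ℝ E ℝ).smulRight (A y₀)) ((y, t) - (y', t'))) =
      ((φ y t - φ y' t) - (φ y 0 - φ y' 0)) +
        ((φ y' t - t • A y₀) - (φ y' t' - t' • A y₀)) := by
    rw [h0 y hyS, h0 y' hyS']
    simp [sub_smul]
    abel
  rw [hsplit]
  refine (norm_add_le _ _).trans ?_
  set D := ‖((y, t) : E × ℝ) - (y', t')‖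
  have hD : 0 ≤ D := norm_nonneg _
  have b1 : (K * L * ‖y - y'‖) * ‖t - 0‖ ≤ K * L * D * c' := by
    rw [sub_zero]
    gcongr
    exact (hball t ht).2.2.le
  have b2 : (K * ((L + 1) * c')) * ‖t - t'‖ ≤ (K * ((L + 1) * c')) * D := by
    gcongr
    exact hdist'
  have b3 : K * L * D * c' + (K * ((L + 1) * c')) * D ≤ 3 * k * c' * D := by
    have hKL : (0 : ℝ) ≤ K * L := by positivity
    have : 3 * k * c' * D - (K * L * D * c' + (K * ((L + 1) * c')) * D) =
      (K * L + 2 * K + 3) * c' * D := by simp only [k]; ring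
    have : 0 ≤ (K * L + 2 * K + 3) * c' * D := by positivity
    linarith
  rw [hcc] at b3
  linarith

end Flow

/-! ### Accessibility -/

theorem HasDerivAt.fst_comp {E F : Type*} [NormedAddCommGroup E]
    [NormedSpace ℝ E] [NormedAddCommGroup F] [NormedSpace ℝ F] {γ : ℝ → E × F}
    {γ' : E × F} {t : ℝ} (h : HasDerivAt γ γ' t) : HasDerivAt (fun t => (γ t).1) γ'.1 t :=
  (ContinuousLinearMap.fst ℝ E F).hasFDerivAt.comp_hasDerivAt t h

theorem HasDerivAt.snd_comp {E F : Type*} [NormedAddCommGroup E]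
    [NormedSpace ℝ E] [NormedAddCommGroup F] [NormedSpace ℝ F] {γ : ℝ → E × F}
    {γ' : E × F} {t : ℝ} (h : HasDerivAt γ γ' t) : HasDerivAt (fun t => (γ t).2) γ'.2 t :=
  (ContinuousLinearMap.snd ℝ E F).hasFDerivAt.comp_hasDerivAt t h

section Accessibility

variable {E : Type*} [NormedAddCommGroup E] [NormedSpace ℝ E] [FiniteDimensional ℝ E]

theorem exists_flow_hasStrictFDerivAt_zero {A : E → E} {q : E} (hA : ContDiffAt ℝ 1 A q)
    {N : Set E} (hN : N ∈ 𝓝 q) :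
    ∃ r > (0 : ℝ), ∃ ε > (0 : ℝ), ∃ φ : E → ℝ → E, ∀ y ∈ Metric.ball q r, φ y 0 = y ∧
      (∀ t ∈ Ioo (-ε) ε, φ y t ∈ N ∧ HasDerivAt (φ y) (A (φ y t)) t) ∧
      HasStrictFDerivAt (fun p : E × ℝ => φ p.1 p.2) ((ContinuousLinearMap.fst ℝ E ℝ) +
        (ContinuousLinearMap.snd ℝ E ℝ).smulRight (A y)) (y, 0) := by
  have : CompleteSpace E := FiniteDimensional.complete ℝ E
  obtain ⟨K, s, hs, hK⟩ := hA.exists_lipschitzOnWith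
  obtain ⟨r, hr, ε, hε, φ, L, hφ, hL⟩ := exists_lipschitz_flow hA (inter_mem hN hs)
  refine ⟨r, hr, ε, hε, φ, fun y hy => ⟨(hφ y hy).1,
    fun t ht => ⟨((hφ y hy).2 t ht).1.1, ((hφ y hy).2 t ht).2⟩, ?_⟩⟩
  exact hasStrictFDerivAt_flow_zero hε hK (fun y hy => (hφ y hy).1)
    (fun y hy t ht => ((hφ y hy).2 t ht).1.2) (fun y hy t ht => ((hφ y hy).2 t ht).2) hL
    (Metric.isOpen_ball.mem_nhds hy)

/-- A local flow together with its derivative `V` in the initial point and the inverse `W` of this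
derivative. -/
theorem exists_flow_hasStrictFDerivAt {B : E → E} {q : E} (hB : ContDiffAt ℝ ∞ B q)
    {N : Set E} (hN : N ∈ 𝓝 q) :
    ∃ r > (0 : ℝ), ∃ ε > (0 : ℝ), ∃ (φ : E → ℝ → E) (V W : E → ℝ → E →L[ℝ] E),
      ∀ y ∈ Metric.ball q r, φ y 0 = y ∧ W y 0 = ContinuousLinearMap.id ℝ E ∧
      (∀ t ∈ Ioo (-ε) ε, φ y t ∈ N ∧ HasDerivAt (φ y) (B (φ y t)) t ∧
        HasDerivAt (W y) (-(W y t).comp (fderiv ℝ B (φ y t))) t ∧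
        (W y t).comp (V y t) = ContinuousLinearMap.id ℝ E) ∧
      ∀ t ∈ Ico 0 ε, HasStrictFDerivAt (fun y => φ y t) (V y t) y := by
  have : CompleteSpace E := FiniteDimensional.complete ℝ E
  have hB1 : ∀ᶠ x in 𝓝 q, ContDiffAt ℝ 2 B x :=
    (hB.of_le (by norm_cast)).eventually (by simp)
  have hDB : ContDiffAt ℝ 1 (fderiv ℝ B) q := hB.fderiv_right (m := 1) (by norm_cast)
  obtain ⟨K', s, hs, hK'⟩ := hDB.exists_lipschitzOnWith
  have hbd : ∀ᶠ x in 𝓝 q, ‖fderiv ℝ B x‖ ≤ ‖fderiv ℝ B q‖ + 1 := by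
    have := hDB.continuousAt.norm.eventually (gt_mem_nhds (lt_add_one ‖fderiv ℝ B q‖))
    exact this.mono fun x hx => hx.le
  obtain ⟨ρ, hρ, hρs⟩ := Metric.eventually_nhds_iff_ball.1
    (hB1.and (Eventually.and hs (hbd.and hN)))
  -- The flow, its linearized equation and the equation of the inverse linearization form one
  -- autonomous system, so a single application of local existence gives all three on a common time
  -- interval.
  let G : E × ((E →L[ℝ] E) × (E →L[ℝ] E)) → E × ((E →L[ℝ] E) × (E →L[ℝ] E)) := fun z =>
    (B z.1, (fderiv ℝ B z.1).comp z.2.1, -(z.2.2).comp (fderiv ℝ B z.1))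
  let i : E → E × ((E →L[ℝ] E) × (E →L[ℝ] E)) := fun y =>
    (y, ContinuousLinearMap.id ℝ E, ContinuousLinearMap.id ℝ E)
  have hG : ContDiffAt ℝ 1 G (i q) := by
    have e1 : ContDiffAt ℝ 1 (fun z : E × ((E →L[ℝ] E) × (E →L[ℝ] E)) => fderiv ℝ B z.1) (i q) :=
      hDB.comp (i q) contDiffAt_fst
    refine ((hB.of_le (by norm_cast)).comp (i q) contDiffAt_fst).prodMk
      ((e1.clm_comp (contDiffAt_fst.comp _ contDiffAt_snd)).prodMk
        ((contDiffAt_snd.comp _ contDiffAt_snd).clm_comp e1).neg)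
  have hNN : {z : E × ((E →L[ℝ] E) × (E →L[ℝ] E)) | z.1 ∈ Metric.ball q ρ} ∈ 𝓝 (i q) :=
    continuousAt_fst.preimage_mem_nhds (Metric.ball_mem_nhds _ hρ)
  obtain ⟨r, hr, ε, hε, Θ, L, hΘ, hL⟩ := exists_lipschitz_flow hG hNN
  have hi : ∀ y ∈ Metric.ball q r, i y ∈ Metric.ball (i q) r := by
    intro y hy
    simpa [i, Prod.dist_eq, hr] using hy
  have hφ : ∀ y ∈ Metric.ball q r, ∀ t ∈ Ioo (-ε) ε,
      HasDerivAt (fun t => (Θ (i y) t).1) (B (Θ (i y) t).1) t := fun y hy t ht =>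
    HasDerivAt.fst_comp ((hΘ _ (hi y hy)).2 t ht).2
  have hVW : ∀ y ∈ Metric.ball q r, ∀ t ∈ Ioo (-ε) ε,
      HasDerivAt (fun t => (Θ (i y) t).2)
        ((fderiv ℝ B (Θ (i y) t).1).comp (Θ (i y) t).2.1,
          -((Θ (i y) t).2.2).comp (fderiv ℝ B (Θ (i y) t).1)) t := fun y hy t ht =>
    HasDerivAt.snd_comp ((hΘ _ (hi y hy)).2 t ht).2
  have hV : ∀ y ∈ Metric.ball q r, ∀ t ∈ Ioo (-ε) ε,
      HasDerivAt (fun t => (Θ (i y) t).2.1)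
        ((fderiv ℝ B (Θ (i y) t).1).comp (Θ (i y) t).2.1) t := fun y hy t ht =>
    HasDerivAt.fst_comp (hVW y hy t ht)
  have hW : ∀ y ∈ Metric.ball q r, ∀ t ∈ Ioo (-ε) ε,
      HasDerivAt (fun t => (Θ (i y) t).2.2)
        (-((Θ (i y) t).2.2).comp (fderiv ℝ B (Θ (i y) t).1)) t := fun y hy t ht =>
    HasDerivAt.snd_comp (hVW y hy t ht)
  have h0 : ∀ y ∈ Metric.ball q r, Θ (i y) 0 = i y := fun y hy => (hΘ _ (hi y hy)).1
  have hI0 : (0 : ℝ) ∈ Ioo (-ε) ε := ⟨by linarith, hε⟩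
  refine ⟨r, hr, ε, hε, fun y t => (Θ (i y) t).1, fun y t => (Θ (i y) t).2.1,
    fun y t => (Θ (i y) t).2.2, fun y hy => ⟨by simp [h0 y hy, i], by simp [h0 y hy, i],
    fun t ht => ⟨(hρs _ ((hΘ _ (hi y hy)).2 t ht).1).2.2.2, hφ y hy t ht, hW y hy t ht, ?_⟩, ?_⟩⟩
  -- The product W V has zero derivative and is the identity at time 0.
  · have hconst : ‖(Θ (i y) t).2.2.comp (Θ (i y) t).2.1 -
        (Θ (i y) 0).2.2.comp (Θ (i y) 0).2.1‖ ≤ 0 * ‖t - 0‖ := by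
      refine (convex_Ioo (-ε) ε).norm_image_sub_le_of_norm_hasDerivWithin_le
        (f := fun t => (Θ (i y) t).2.2.comp (Θ (i y) t).2.1) (f' := fun _ => 0)
        (fun u hu => ?_) (by simp) hI0 ht
      have := ((hW y hy u hu).clm_comp (hV y hy u hu)).hasDerivWithinAt (s := Ioo (-ε) ε)
      convert this using 1
      ext x
      simp
    rw [zero_mul] at hconst
    have := sub_eq_zero.1 (norm_le_zero_iff.1 hconst)
    rw [this, h0 y hy]
    rfl
  · intro t ht
    refine hasStrictFDerivAt_flow (convex_ball q ρ) Metric.isOpen_ball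
      (fun x hx => ((hρs x hx).1.differentiableAt (by simp)).differentiableWithinAt)
      (K := ‖fderiv ℝ B q‖₊ + 1)
      (fun x hx => (hρs x hx).2.2.1) (hK'.mono fun x hx => (hρs x hx).2.1) (L := L) ht
      (φ := fun y t => (Θ (i y) t).1) (S := Metric.ball q r)
      (fun y hy => by simp [h0 y hy, i]) (fun y hy t ht => ((hΘ _ (hi y hy)).2 t ht).1) hφ ?_
      (Metric.isOpen_ball.mem_nhds hy) (by simp [h0 y hy, i]) (hV y hy)
    intro t ht
    refine LipschitzOnWith.of_dist_le_mul fun x hx y hy => ?_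
    have h1 := (hL t ht).dist_le_mul _ (hi x hx) _ (hi y hy)
    have h2 : dist (i x) (i y) = dist x y := by simp [i, Prod.dist_eq]
    rw [h2] at h1
    refine le_trans ?_ h1
    rw [Prod.dist_eq]
    exact le_max_left _ _

/-- Difference quotients stay in the subspace, which is closed because the ambient space is
finite-dimensional. -/
theorem Submodule.hasDerivAt_mem {R : Submodule ℝ E} {g : ℝ → E} {g' : E} {τ : ℝ}
    (hg : HasDerivAt g g' τ) (h : ∀ᶠ t in 𝓝 τ, g t ∈ R) : g' ∈ R := by
  have hc : IsClosed (R : Set E) := R.closed_of_finiteDimensional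
  refine hc.mem_of_tendsto (hasDerivAt_iff_tendsto_slope.1 hg) ?_
  filter_upwards [h.filter_mono nhdsWithin_le_nhds] with t ht
  rw [slope_def_module]
  exact R.smul_mem _ (R.sub_mem ht h.self_of_nhds)

/-- Pulling back vector fields along the flow of `B` converts Lie brackets with `B` into
derivatives. -/
theorem hasDerivAt_flow_pullback {A B : E → E} {φ : ℝ → E} {W : ℝ → E →L[ℝ] E} {t : ℝ}
    (hA : DifferentiableAt ℝ A (φ t)) (hφ : HasDerivAt φ (B (φ t)) t)
    (hW : HasDerivAt W (-(W t).comp (fderiv ℝ B (φ t))) t) :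
    HasDerivAt (fun t => W t (A (φ t))) (W t (VectorField.lieBracket ℝ B A (φ t))) t := by
  have := hW.clm_apply (hA.hasFDerivAt.comp_hasDerivAt t hφ)
  refine this.congr_deriv ?_
  change -(W t) (fderiv ℝ B (φ t) (A (φ t))) + _ = _
  rw [VectorField.lieBracket, map_sub]
  abel

/-- **Accessibility**: if `A`, `B`, `[B, A]`, `[B, [B, A]]` span, then every equivalence relation
that identifies the end points of integral curves of `A` and `B` has open classes. -/
theorem eventually_equiv_of_span_lieBracket {U : Set E} (hU : IsOpen U) {A B : E → E}
    (hA : ContDiffOn ℝ ∞ A U) (hB : ContDiffOn ℝ ∞ B U) (hB0 : ∀ x ∈ U, B x ≠ 0)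
    (hspan : ∀ x ∈ U, Submodule.span ℝ {A x, B x, VectorField.lieBracket ℝ B A x,
      VectorField.lieBracket ℝ B (VectorField.lieBracket ℝ B A) x} = ⊤)
    {r : E → E → Prop} (hr : Equivalence r)
    (hrA : ∀ (γ : ℝ → E) (a b : ℝ), a < b →
      (∀ t ∈ Icc a b, γ t ∈ U ∧ HasDerivAt γ (A (γ t)) t) → r (γ a) (γ b))
    (hrB : ∀ (γ : ℝ → E) (a b : ℝ), a < b →
      (∀ t ∈ Icc a b, γ t ∈ U ∧ HasDerivAt γ (B (γ t)) t) → r (γ a) (γ b))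
    {q : E} (hq : q ∈ U) : ∀ᶠ y in 𝓝 q, r q y := by
  have hflow : ∀ {F : E → E} {φ : ℝ → E} {ε : ℝ}, (∀ (γ : ℝ → E) (a b : ℝ), a < b →
      (∀ t ∈ Icc a b, γ t ∈ U ∧ HasDerivAt γ (F (γ t)) t) → r (γ a) (γ b)) →
      (∀ t ∈ Ioo (-ε) ε, φ t ∈ U ∧ HasDerivAt φ (F (φ t)) t) →
      ∀ t ∈ Ioo (-ε) ε, r (φ 0) (φ t) := by
    intro F φ ε hF hφ t ht
    have hε : 0 < ε := by linarith [ht.1, ht.2]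
    rcases lt_trichotomy 0 t with h | h | h
    · exact hF φ 0 t h fun u hu => hφ u ⟨by linarith [hu.1], by linarith [hu.2, ht.2]⟩
    · rw [← h]; exact hr.refl _
    · exact hr.symm (hF φ t 0 h fun u hu => hφ u ⟨by linarith [hu.1, ht.1], by linarith [hu.2]⟩)
  have hUq : ∀ {x}, x ∈ U → U ∈ 𝓝 x := fun hx => hU.mem_nhds hx
  -- Induction on dimension: Q is a k-parameter immersed family of points equivalent to q, with B
  -- tangent to it at Q 0. The map H carries all points near q along the same flows to equivalent
  -- points, with H q = Q 0; it serves to come back at the end. The freedom in N keeps Q 0 close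
  -- enough to q for the next flows to be defined.
  have key : ∀ k : ℕ, 1 ≤ k → k ≤ Module.finrank ℝ E → ∀ N ∈ 𝓝 q,
      ∃ (Q : (Fin k → ℝ) → E) (L : (Fin k → ℝ) →L[ℝ] E) (H : E → E),
        HasStrictFDerivAt Q L 0 ∧ Function.Injective L ∧ B (Q 0) ∈ LinearMap.range L.toLinearMap ∧
        (∀ᶠ t in 𝓝 0, r q (Q t)) ∧ H q = Q 0 ∧ ContinuousAt H q ∧
        (∀ᶠ y in 𝓝 q, r y (H y)) ∧ Q 0 ∈ N := by
    intro k hk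
    induction k, hk using Nat.le_induction with
    | base =>
      intro _ N hN
      obtain ⟨s, hs, ε, hε, φ, hφ⟩ := exists_flow_hasStrictFDerivAt_zero
        ((hB.contDiffAt (hUq hq)).of_le (by norm_cast)) (hUq hq)
      obtain ⟨h0, h1, h2⟩ := hφ q (Metric.mem_ball_self hs)
      refine ⟨fun t => φ q (t 0), (ContinuousLinearMap.proj 0).smulRight (B q), id, ?_, ?_, ?_,
        ?_, ?_, continuousAt_id, ?_, ?_⟩
      · have hi : HasStrictFDerivAt (fun t : Fin 1 → ℝ => (q, t 0))
            ((0 : (Fin 1 → ℝ) →L[ℝ] E).prod (ContinuousLinearMap.proj 0)) 0 :=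
          (hasStrictFDerivAt_const q 0).prodMk
            ((ContinuousLinearMap.proj (R := ℝ) (φ := fun _ : Fin 1 => ℝ) 0).hasStrictFDerivAt)
        have := HasStrictFDerivAt.comp (g := fun p : E × ℝ => φ p.1 p.2) 0 (by simpa using h2) hi
        refine this.congr_fderiv ?_
        refine ContinuousLinearMap.ext fun t => ?_
        simp
      · intro t t' h
        have h' : (t 0) • B q = (t' 0) • B q := h
        have : t 0 = t' 0 := by
          have := sub_eq_zero.2 h'
          rw [← sub_smul, smul_eq_zero] at this
          exact sub_eq_zero.1 (this.resolve_right (hB0 q hq))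
        ext i
        rw [Subsingleton.elim i 0, this]
      · refine ⟨fun _ => 1, ?_⟩
        simp [h0]
      · have hc : Tendsto (fun t : Fin 1 → ℝ => t 0) (𝓝 0) (𝓝 0) :=
          (continuous_apply 0).tendsto' _ _ rfl
        filter_upwards [hc (Ioo_mem_nhds (neg_lt_zero.2 hε) hε)] with t ht
        have := hflow hrB h1 _ ht
        rwa [h0] at this
      · simp [h0]
      · exact Eventually.of_forall fun y => hr.refl _
      · simpa [h0] using mem_of_mem_nhds hN
    | succ k hk ih =>
      intro hkE N hN
      obtain ⟨s, hs, ε, hε, φA, hφA⟩ := exists_flow_hasStrictFDerivAt_zero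
        ((hA.contDiffAt (hUq hq)).of_le (by norm_cast)) (hUq hq)
      obtain ⟨s', hs', ε', hε', φ, V, W, hφ⟩ := exists_flow_hasStrictFDerivAt
        (hB.contDiffAt (hUq hq)) (inter_mem (hUq hq) (inter_mem hN (Metric.ball_mem_nhds q hs)))
      obtain ⟨Q, L, H, hQ, hLi, hBL, hrQ, hHq, hHc, hrH, hQN⟩ :=
        ih (by omega) _ (Metric.ball_mem_nhds q hs')
      set y := Q 0
      obtain ⟨hφ0, hW0, hφt, hφs⟩ := hφ y hQN
      set R := LinearMap.range L.toLinearMap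
      have hVW : ∀ t ∈ Ioo (-ε') ε', ∀ x, V y t (W y t x) = x := by
        intro t ht x
        have h1 : (W y t).toLinearMap * (V y t).toLinearMap = 1 := by
          ext x
          exact DFunLike.congr_fun (hφt t ht).2.2.2 x
        exact DFunLike.congr_fun (mul_eq_one_comm.1 h1) x
      have hWV : ∀ t ∈ Ioo (-ε') ε', ∀ x, W y t (V y t x) = x := fun t ht x =>
        DFunLike.congr_fun (hφt t ht).2.2.2 x
      have hI0 : (0 : ℝ) ∈ Ioo (-ε') ε' := ⟨by linarith, hε'⟩
      have hWB : ∀ t ∈ Ioo (-ε') ε', W y t (B (φ y t)) = B y := by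
        intro t ht
        have hconst : ‖W y t (B (φ y t)) - W y 0 (B (φ y 0))‖ ≤ 0 * ‖t - 0‖ := by
          refine (convex_Ioo (-ε') ε').norm_image_sub_le_of_norm_hasDerivWithin_le
            (f := fun t => W y t (B (φ y t))) (f' := fun _ => 0) (fun u hu => ?_) (by simp) hI0 ht
          obtain ⟨hm, hd, hw, -⟩ := hφt u hu
          have := hasDerivAt_flow_pullback
            ((hB.contDiffAt (hUq hm.1)).differentiableAt (by simp)) hd hw
          simpa using this.hasDerivWithinAt
        rw [zero_mul] at hconst
        have := sub_eq_zero.1 (norm_le_zero_iff.1 hconst)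
        rw [this, hW0, hφ0]
        rfl
      -- If A pulled back along the flow of B stayed in the tangent space R, differentiating twice
      -- would put [B,A] and [B,[B,A]] in R as well. B itself is in R, since its flow preserves it.
      -- By the spanning hypothesis R would be everything, although k is less than the dimension.
      obtain ⟨τ, hτ, hτR⟩ : ∃ τ ∈ Ioo 0 ε', W y τ (A (φ y τ)) ∉ R := by
        by_contra! hcon
        have hIoo : ∀ t ∈ Ioo 0 ε', t ∈ Ioo (-ε') ε' := fun t ht => ⟨by linarith [ht.1], ht.2⟩
        have c1 : ∀ t ∈ Ioo 0 ε', W y t (VectorField.lieBracket ℝ B A (φ y t)) ∈ R := by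
          intro t ht
          obtain ⟨hm, hd, hw, -⟩ := hφt t (hIoo t ht)
          refine Submodule.hasDerivAt_mem (hasDerivAt_flow_pullback
            ((hA.contDiffAt (hUq hm.1)).differentiableAt (by simp)) hd hw) ?_
          filter_upwards [Ioo_mem_nhds ht.1 ht.2] with u hu using hcon u hu
        have hbr : ∀ x ∈ U, DifferentiableAt ℝ (VectorField.lieBracket ℝ B A) x := fun x hx =>
          (ContDiffAt.lieBracket_vectorField (m := 1) (hB.contDiffAt (hUq hx))
            (hA.contDiffAt (hUq hx)) (by norm_cast)).differentiableAt (by simp)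
        have c2 : ∀ t ∈ Ioo 0 ε', W y t (VectorField.lieBracket ℝ B
            (VectorField.lieBracket ℝ B A) (φ y t)) ∈ R := by
          intro t ht
          obtain ⟨hm, hd, hw, -⟩ := hφt t (hIoo t ht)
          refine Submodule.hasDerivAt_mem (hasDerivAt_flow_pullback (hbr _ hm.1) hd hw) ?_
          filter_upwards [Ioo_mem_nhds ht.1 ht.2] with u hu using c1 u hu
        have hh : ε' / 2 ∈ Ioo 0 ε' := ⟨by linarith, by linarith⟩
        have hle : Submodule.span ℝ {A (φ y (ε' / 2)), B (φ y (ε' / 2)),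
            VectorField.lieBracket ℝ B A (φ y (ε' / 2)),
            VectorField.lieBracket ℝ B (VectorField.lieBracket ℝ B A) (φ y (ε' / 2))} ≤
            R.comap (W y (ε' / 2)).toLinearMap := by
          rw [Submodule.span_le]
          rintro x (rfl | rfl | rfl | rfl)
          · exact hcon _ hh
          · change W y _ _ ∈ R
            rw [hWB _ (hIoo _ hh)]
            exact hBL
          · exact c1 _ hh
          · exact c2 _ hh
        rw [hspan _ (hφt _ (hIoo _ hh)).1.1] at hle
        have hRtop : R = ⊤ := by
          rw [eq_top_iff]
          intro x _
          have := hle (Submodule.mem_top (x := V y (ε' / 2) x))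
          rw [Submodule.mem_comap] at this
          change W y _ (V y _ x) ∈ R at this
          rwa [hWV _ (hIoo _ hh)] at this
        have hfr : Module.finrank ℝ R = k := by
          rw [LinearMap.finrank_range_of_inj hLi]
          simp
        rw [hRtop, finrank_top] at hfr
        omega
      have hτI : τ ∈ Ioo (-ε') ε' := ⟨by linarith [hτ.1], hτ.2⟩
      obtain ⟨⟨hzU, hzN, hzA⟩, -⟩ := hφt τ hτI
      obtain ⟨hA0, hAt, hAs⟩ := hφA (φ y τ) hzA
      have hBs := hφs τ ⟨hτ.1.le, hτ.2⟩
      let tl : (Fin (k + 1) → ℝ) →L[ℝ] (Fin k → ℝ) :=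
        ContinuousLinearMap.pi fun i => ContinuousLinearMap.proj i.succ
      have htl0 : tl 0 = 0 := map_zero tl
      have hBQ : HasStrictFDerivAt (fun t : Fin (k + 1) → ℝ => φ (Q (tl t)) τ)
          (((V y τ).comp L).comp tl) 0 := by
        have h1 : HasStrictFDerivAt (fun t : Fin (k + 1) → ℝ => Q (tl t)) (L.comp tl) 0 :=
          HasStrictFDerivAt.comp (g := Q) 0 (by rwa [htl0]) tl.hasStrictFDerivAt
        exact HasStrictFDerivAt.comp (g := fun y => φ y τ) 0 (by rwa [htl0]) h1
      have hpair : HasStrictFDerivAt (fun t : Fin (k + 1) → ℝ => (φ (Q (tl t)) τ, t 0))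
          ((((V y τ).comp L).comp tl).prod (ContinuousLinearMap.proj 0)) 0 :=
        hBQ.prodMk (ContinuousLinearMap.proj (R := ℝ) (φ := fun _ : Fin (k + 1) => ℝ)
          0).hasStrictFDerivAt
      have hfin := HasStrictFDerivAt.comp (g := fun p : E × ℝ => φA p.1 p.2) 0
        (by simpa [htl0, y] using hAs) hpair
      have hQ'0 : φA (φ (Q (tl 0)) τ) ((0 : Fin (k + 1) → ℝ) 0) = φ y τ := by
        rw [htl0]
        exact hA0
      have hQc : ContinuousAt (fun t => Q (tl t)) 0 := by
        have h1 : ContinuousAt Q (tl 0) := by rw [htl0]; exact hQ.continuousAt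
        exact h1.comp tl.continuous.continuousAt
      -- The old family is transported by B for time τ, and then A is followed for the new
      -- parameter. The choice of τ makes the new direction independent of the transported ones.
      refine ⟨fun t => φA (φ (Q (tl t)) τ) (t 0), _, fun x => φ (H x) τ, hfin, ?_, ?_, ?_, ?_, ?_,
        ?_, ?_⟩
      · rw [injective_iff_map_eq_zero]
        intro t ht
        have ht' : V y τ (L (tl t)) + t 0 • A (φ y τ) = 0 := by
          simpa [htl0, y] using ht
        have h1 := congrArg (W y τ) ht'
        simp only [map_add, map_smul, map_zero, hWV _ hτI] at h1
        have ht0 : t 0 = 0 := by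
          by_contra hne
          apply hτR
          have : W y τ (A (φ y τ)) = (t 0)⁻¹ • L (-(tl t)) := by
            rw [map_neg, ← eq_neg_of_add_eq_zero_right h1, smul_smul, inv_mul_cancel₀ hne, one_smul]
          rw [this]
          exact R.smul_mem _ ⟨_, rfl⟩
        rw [ht0, zero_smul, add_zero] at h1
        have h2 : tl t = 0 := hLi (by rw [h1, map_zero])
        ext i
        refine Fin.cases ht0 (fun j => ?_) i
        exact congrFun h2 j
      · change B (φA (φ (Q (tl 0)) τ) ((0 : Fin (k + 1) → ℝ) 0)) ∈ _
        rw [hQ'0]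
        obtain ⟨u, hu⟩ := hBL
        refine ⟨Fin.cons 0 u, ?_⟩
        have hcons : tl (Fin.cons 0 u) = u := by
          ext j
          simp [tl]
        have hu' : L u = B y := hu
        have : V y τ (B y) = B (φ y τ) := by rw [← hWB τ hτI, hVW τ hτI]
        simp [hcons, hu', this, y]
      · have h1 : Tendsto (fun t : Fin (k + 1) → ℝ => tl t) (𝓝 0) (𝓝 0) :=
          tl.continuous.tendsto' _ _ htl0
        have hc0 : Tendsto (fun t : Fin (k + 1) → ℝ => t 0) (𝓝 0) (𝓝 0) :=
          (continuous_apply 0).tendsto' _ _ rfl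
        have h2 : ∀ᶠ t in 𝓝 (0 : Fin (k + 1) → ℝ), Q (tl t) ∈ Metric.ball q s' := by
          have := hQc.eventually (Metric.isOpen_ball.mem_nhds
            (show Q (tl 0) ∈ Metric.ball q s' by rw [htl0]; exact hQN))
          exact this
        have h3 : ∀ᶠ t in 𝓝 (0 : Fin (k + 1) → ℝ), φ (Q (tl t)) τ ∈ Metric.ball q s := by
          refine hBQ.continuousAt.eventually (Metric.isOpen_ball.mem_nhds ?_)
          change φ (Q (tl 0)) τ ∈ _
          rw [htl0]
          exact hzA
        filter_upwards [h1.eventually hrQ, h2, h3,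
          hc0 (Ioo_mem_nhds (neg_lt_zero.2 hε) hε)] with t e1 e2 e3 e4
        refine hr.trans e1 (hr.trans (y := φ (Q (tl t)) τ) ?_ ?_)
        · have := hflow (φ := φ (Q (tl t))) hrB
            (fun u hu => ⟨((hφ _ e2).2.2.1 u hu).1.1, ((hφ _ e2).2.2.1 u hu).2.1⟩) τ hτI
          rwa [(hφ _ e2).1] at this
        · have := hflow (φ := φA (φ (Q (tl t)) τ)) hrA (hφA _ e3).2.1 _ e4
          rwa [(hφA _ e3).1] at this
      · change φ (H q) τ = φA (φ (Q (tl 0)) τ) ((0 : Fin (k + 1) → ℝ) 0)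
        rw [hQ'0, hHq]
      · have h1 : ContinuousAt (fun y => φ y τ) (H q) := by rw [hHq]; exact hBs.continuousAt
        exact h1.comp hHc
      · have h2 : ∀ᶠ x in 𝓝 q, H x ∈ Metric.ball q s' :=
          hHc.eventually (Metric.isOpen_ball.mem_nhds (by rw [hHq]; exact hQN))
        filter_upwards [hrH, h2] with x e1 e2
        refine hr.trans e1 ?_
        have := hflow (φ := φ (H x)) hrB
          (fun u hu => ⟨((hφ _ e2).2.2.1 u hu).1.1, ((hφ _ e2).2.2.1 u hu).2.1⟩) τ hτI
        rwa [(hφ _ e2).1] at this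
      · change φA (φ (Q (tl 0)) τ) ((0 : Fin (k + 1) → ℝ) 0) ∈ N
        rw [hQ'0]
        exact hzN
  have hpos : 1 ≤ Module.finrank ℝ E := by
    have : Nontrivial E := ⟨⟨B q, 0, hB0 q hq⟩⟩
    exact Module.finrank_pos
  obtain ⟨Q, L, H, hQ, hLi, -, hrQ, hHq, hHc, hrH, -⟩ := key _ hpos le_rfl univ univ_mem
  -- In full dimension Q is open at 0, so all points near Q 0 = H q are equivalent to q. For y near
  -- q the point H y is among them, and y is equivalent to H y.
  have hsurj : LinearMap.range L.toLinearMap = ⊤ := by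
    have : Function.Surjective L.toLinearMap :=
      (LinearMap.injective_iff_surjective_of_finrank_eq_finrank (by simp)).1 hLi
    exact LinearMap.range_eq_top.2 this
  have hopen : ∀ᶠ z in 𝓝 (Q 0), r q z := by
    rw [← hQ.map_nhds_eq_of_surj hsurj]
    exact hrQ
  rw [← hHq] at hopen
  filter_upwards [hHc.eventually hopen, hrH] with y h1 h2
  exact hr.trans h1 (hr.symm h2)

end Accessibility

/-! ### Uniqueness of holomorphic functions -/

section Holomorphic

/-- A holomorphic function on a square which is continuous up to the boundary and vanishes on the
lower side vanishes at the centre. -/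
theorem Complex.eq_zero_center_of_eq_zero_lower_side {g : ℂ → ℂ} {c : ℂ} {b : ℝ} (hb : 0 < b)
    (hd : ∀ w : ℂ, |w.re| < b → |w.im| < b → DifferentiableAt ℂ g (c + w))
    (hc : ContinuousOn (fun w => g (c + w)) {w | |w.re| ≤ b ∧ |w.im| ≤ b})
    (h0 : ∀ w : ℂ, |w.re| ≤ b → w.im = -b → g (c + w) = 0) : g c = 0 := by
  set U : Set ℂ := {w | |w.re| < b ∧ |w.im| < b} with hU
  set K : Set ℂ := {w | |w.re| ≤ b ∧ |w.im| ≤ b} with hK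
  have hUo : IsOpen U := by
    have h1 : IsOpen {w : ℂ | |w.re| < b} :=
      isOpen_lt (continuous_abs.comp Complex.continuous_re) continuous_const
    have h2 : IsOpen {w : ℂ | |w.im| < b} :=
      isOpen_lt (continuous_abs.comp Complex.continuous_im) continuous_const
    exact h1.inter h2
  have hKc : IsClosed K := by
    have h1 : IsClosed {w : ℂ | |w.re| ≤ b} :=
      isClosed_le (continuous_abs.comp Complex.continuous_re) continuous_const
    have h2 : IsClosed {w : ℂ | |w.im| ≤ b} :=
      isClosed_le (continuous_abs.comp Complex.continuous_im) continuous_const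
    exact h1.inter h2
  have hUK : closure U ⊆ K := closure_minimal (fun w hw => ⟨hw.1.le, hw.2.le⟩) hKc
  have hbdd : Bornology.IsBounded U := by
    refine (Metric.isBounded_ball (x := (0 : ℂ)) (r := 2 * b + 1)).subset fun w hw => ?_
    rw [mem_ball_zero_iff]
    have := Complex.norm_le_abs_re_add_abs_im w
    linarith [hw.1, hw.2]
  -- The four factors are g rotated by quarter turns about c. On each side of the square one of them
  -- vanishes, so P is zero on the boundary; by the maximum principle P(0) = g(c)⁴ is zero.
  let P : ℂ → ℂ := fun w => g (c + w) * g (c + I * w) * (g (c + -w) * g (c + -(I * w)))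
  have hP : DiffContOnCl ℂ P U := by
    have hd' : ∀ (a : ℂ), (∀ w ∈ U, a * w ∈ U) → DifferentiableOn ℂ (fun w => g (c + a * w)) U :=
      fun a ha w hw => (DifferentiableAt.comp (g := g) w (hd (a * w) (ha w hw).1 (ha w hw).2)
        (f := fun w => c + a * w) (by fun_prop)).differentiableWithinAt
    have hc' : ∀ (a : ℂ), (∀ w ∈ K, a * w ∈ K) →
        ContinuousOn (fun w => g (c + a * w)) (closure U) := fun a ha =>
      ContinuousOn.comp (g := fun w => g (c + w)) hc (by fun_prop) fun w hw => ha w (hUK hw)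
    have k1 : DiffContOnCl ℂ (fun w => g (c + w)) U := by
      simpa using (⟨hd' 1 (by simp), hc' 1 (by simp)⟩ : DiffContOnCl ℂ (fun w => g (c + 1 * w)) U)
    have k2 : DiffContOnCl ℂ (fun w => g (c + I * w)) U :=
      ⟨hd' I (by simp [hU]; tauto), hc' I (by simp [hK]; tauto)⟩
    have k3 : DiffContOnCl ℂ (fun w => g (c + -w)) U := by
      simpa using (⟨hd' (-1) (by simp [hU]), hc' (-1) (by simp [hK])⟩ :
        DiffContOnCl ℂ (fun w => g (c + -1 * w)) U)
    have k4 : DiffContOnCl ℂ (fun w => g (c + -(I * w))) U := by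
      simpa using (⟨hd' (-I) (by simp [hU]; tauto), hc' (-I) (by simp [hK]; tauto)⟩ :
        DiffContOnCl ℂ (fun w => g (c + -I * w)) U)
    exact (k1.smul k2).smul (k3.smul k4)
  have hfr : ∀ w ∈ frontier U, ‖P w‖ ≤ 0 := by
    intro w hw
    rw [hUo.frontier_eq] at hw
    have hwK := hUK hw.1
    have hor : w.im = -b ∨ w.im = b ∨ w.re = b ∨ w.re = -b := by
      have hnot := hw.2
      simp only [hU, mem_ofPred_eq, not_and_or, not_lt] at hnot
      rcases hnot with h | h
      · have h' := le_antisymm hwK.1 h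
        rcases abs_eq hb.le |>.1 h' with h'' | h'' <;> tauto
      · have h' := le_antisymm hwK.2 h
        rcases abs_eq hb.le |>.1 h' with h'' | h'' <;> tauto
    rcases hor with h | h | h | h
    · simp [P, h0 w hwK.1 h]
    · simp [P, h0 (-w) (by simpa using hwK.1) (by simp [h])]
    · simp [P, h0 (-(I * w)) (by simpa using hwK.2) (by simp [h])]
    · simp [P, h0 (I * w) (by simpa using hwK.2) (by simp [h])]
  have h0U : (0 : ℂ) ∈ closure U := subset_closure (by simp [hU, hb])
  have := Complex.norm_le_of_forall_mem_frontier_norm_le hbdd hP hfr h0U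
  have hP0 : P 0 = 0 := norm_le_zero_iff.1 this
  simpa [P] using hP0

variable {E : Type*} [NormedAddCommGroup E] [NormedSpace ℂ E]

theorem differentiableOn_comp_line {F : E → ℂ} {W : Set E} (hF : DifferentiableOn ℂ F W)
    (z v : E) : DifferentiableOn ℂ (fun t : ℂ => F (z + t • v)) {t | z + t • v ∈ W} :=
  hF.comp (Differentiable.differentiableOn (by fun_prop)) fun _ ht => ht

theorem isPreconnected_line_preimage_ball (z v w : E) (r : ℝ) :
    IsPreconnected {t : ℂ | z + t • v ∈ Metric.ball w r} := by
  refine Convex.isPreconnected fun s hs t ht a b ha hb hab => ?_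
  have := convex_ball w r hs ht ha hb hab
  change z + (a • s + b • t) • v ∈ Metric.ball w r
  convert this using 1
  have hz : z = a • z + b • z := by rw [← add_smul, hab, one_smul]
  nth_rewrite 1 [hz]
  simp only [add_smul, smul_add, smul_assoc]
  abel

theorem isOpen_line_preimage {W : Set E} (hW : IsOpen W) (z v : E) :
    IsOpen {t : ℂ | z + t • v ∈ W} := hW.preimage (by fun_prop)

/-- Identity theorem on balls. -/
theorem eq_zero_on_ball_of_eventually_eq_zero {F : E → ℂ} {w w₀ : E} {r : ℝ}
    (hF : DifferentiableOn ℂ F (Metric.ball w r)) (hw₀ : w₀ ∈ Metric.ball w r)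
    (h0 : ∀ᶠ z in 𝓝 w₀, F z = 0) : ∀ z ∈ Metric.ball w r, F z = 0 := by
  intro z hz
  have hd := (differentiableOn_comp_line hF w₀ (z - w₀)).analyticOnNhd
    (isOpen_line_preimage Metric.isOpen_ball _ _)
  have hc : Tendsto (fun t : ℂ => w₀ + t • (z - w₀)) (𝓝 0) (𝓝 w₀) :=
    Continuous.tendsto' (by fun_prop) _ _ (by simp)
  have := hd.eqOn_zero_of_preconnected_of_eventuallyEq_zero
    (isPreconnected_line_preimage_ball w₀ (z - w₀) w r) (z₀ := 0) (by simpa using hw₀)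
    (hc.eventually h0)
  have h1 := this (x := 1) (by simpa using hz)
  simpa using h1

/-- Identity theorem. -/
theorem eq_zero_of_isPreconnected_of_eventually_eq_zero {F : E → ℂ} {W : Set E} (hW : IsOpen W)
    (hWc : IsPreconnected W) (hF : DifferentiableOn ℂ F W) {w₀ : E} (hw₀ : w₀ ∈ W)
    (h0 : ∀ᶠ z in 𝓝 w₀, F z = 0) : ∀ z ∈ W, F z = 0 := by
  have hsub : W ⊆ {w | ∀ᶠ z in 𝓝 w, F z = 0} := by
    refine hWc.subset_of_closure_inter_subset isOpen_setOfPred_eventually_nhds ⟨w₀, hw₀, h0⟩ ?_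
    rintro w ⟨hw, hwW⟩
    obtain ⟨r, hr, hrW⟩ := Metric.isOpen_iff.1 hW w hwW
    obtain ⟨w₁, hw₁, hw₁'⟩ := Metric.mem_closure_iff.1 hw r hr
    have := eq_zero_on_ball_of_eventually_eq_zero (hF.mono hrW)
      (by rwa [Metric.mem_ball, dist_comm]) hw₁
    exact Filter.mem_of_superset (Metric.ball_mem_nhds w hr) this
  exact fun z hz => (hsub hz).self_of_nhds

/-- A function holomorphic near `w` which vanishes on the real slice through `w` vanishes. -/
theorem eventually_eq_zero_of_eq_zero_on_real {F : C3 → ℂ} {w : C3} {r : ℝ} (hr : 0 < r)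
    (hF : DifferentiableOn ℂ F (Metric.ball w r))
    (h0 : ∀ x : C3, (∀ j, (x j).im = 0) → ‖x‖ < r → F (w + x) = 0) :
    ∀ᶠ z in 𝓝 w, F z = 0 := by
  filter_upwards [Metric.ball_mem_nhds w hr] with z hz
  -- With z = w + a + ib and a, b real, the one-variable function t ↦ F(w + a + tb) vanishes for
  -- small real t, hence identically on the slice of the ball, in particular at t = i.
  set a : C3 := fun j => ((z j - w j).re : ℂ) with ha
  set b : C3 := fun j => ((z j - w j).im : ℂ) with hb
  have hz' : w + a + Complex.I • b = z := by
    ext j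
    have := Complex.re_add_im (z j - w j)
    simp only [Pi.add_apply, Pi.smul_apply, smul_eq_mul, ha, hb]
    rw [mul_comm, add_assoc, this]
    ring
  have hare : ∀ j, (a j).im = 0 := fun j => by simp [ha]
  have hbre : ∀ j, (b j).im = 0 := fun j => by simp [hb]
  have hball : ‖z - w‖ < r := by rwa [← dist_eq_norm]
  have har : ‖a‖ < r := by
    refine lt_of_le_of_lt ?_ hball
    refine (pi_norm_le_iff_of_nonneg (norm_nonneg _)).2 fun j => ?_
    refine le_trans ?_ (norm_le_pi_norm (z - w) j)
    simp only [ha, Complex.norm_real]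
    exact Complex.abs_re_le_norm _
  have hd := (differentiableOn_comp_line hF (w + a) b).analyticOnNhd
    (isOpen_line_preimage Metric.isOpen_ball _ _)
  have hopen := isOpen_line_preimage (Metric.isOpen_ball (x := w) (ε := r)) (w + a) b
  have h0mem : (0 : ℂ) ∈ {t : ℂ | w + a + t • b ∈ Metric.ball w r} := by
    simpa [dist_eq_norm] using har
  have hreal : ∀ᶠ t : ℝ in 𝓝 0, F (w + a + (t : ℂ) • b) = 0 := by
    have hc : Tendsto (fun t : ℝ => (t : ℂ)) (𝓝 0) (𝓝 0) :=
      Complex.continuous_ofReal.tendsto' _ _ (by simp)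
    filter_upwards [hc (hopen.mem_nhds h0mem)] with t ht
    rw [add_assoc]
    refine h0 _ (fun j => ?_) ?_
    · simp [hare j, hbre j]
    · have ht' : w + a + (t : ℂ) • b ∈ Metric.ball w r := ht
      rwa [mem_ball_iff_norm, add_assoc, add_sub_cancel_left] at ht'
  have hfreq : ∃ᶠ t : ℂ in 𝓝[≠] 0, F (w + a + t • b) = (0 : ℂ → ℂ) t := by
    have hc : Tendsto (fun t : ℝ => (t : ℂ)) (𝓝[≠] 0) (𝓝[≠] 0) := by
      refine tendsto_nhdsWithin_iff.2 ⟨(Complex.continuous_ofReal.tendsto' _ _ (by simp)).mono_left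
        nhdsWithin_le_nhds, ?_⟩
      filter_upwards [self_mem_nhdsWithin] with t ht
      simpa using ht
    exact hc.frequently (hreal.filter_mono nhdsWithin_le_nhds).frequently
  have := hd.eqOn_of_preconnected_of_frequently_eq (fun t _ => analyticAt_const (v := (0 : ℂ)))
    (isPreconnected_line_preimage_ball (w + a) b w r) h0mem hfreq
  have h1 := this (x := Complex.I) (by rw [mem_ofPred_eq, hz']; exact hz)
  simpa [hz'] using h1

/-- Uniqueness for boundary values on a flat real edge: the direction `c` points into the
domain. -/
theorem exists_eventually_eq_zero_of_real_edge {G : C3 → ℂ} {W S : Set C3} (hW : IsOpen W)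
    (hG : DifferentiableOn ℂ G W) (hGc : ContinuousOn G (W ∪ S)) {p c : C3} {r : ℝ} (hr : 0 < r)
    (hS : ∀ x : C3, (∀ j, (x j).im = 0) → ‖x‖ < r → p + x ∈ S ∧ G (p + x) = 0)
    (hcW : ∀ x : C3, (∀ j, (x j).im = 0) → ‖x‖ < r → ∀ b : ℝ, 0 < b → b < r →
      p + x + (b : ℂ) • c ∈ W) :
    ∃ w ∈ W, ∀ᶠ z in 𝓝 w, G z = 0 := by
  set u : C3 := fun j => ((c j).re : ℂ) with hu
  set v : C3 := fun j => ((c j).im : ℂ) with hv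
  have hure : ∀ j, (u j).im = 0 := fun j => by simp [hu]
  have hvre : ∀ j, (v j).im = 0 := fun j => by simp [hv]
  have huv : c = u + Complex.I • v := by
    ext j
    have := Complex.re_add_im (c j)
    simp only [Pi.add_apply, Pi.smul_apply, smul_eq_mul, hu, hv]
    rw [mul_comm, this]
  -- With b = r / (4k), all displacements used below, for |Re t| ≤ b and 0 ≤ Im t ≤ 2b, remain
  -- within the radius r of the hypotheses.
  set k : ℝ := ‖v‖ + 2 * ‖u‖ + 2 with hk
  have hkpos : 0 < k := by positivity
  set b : ℝ := r / (4 * k) with hb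
  have hbpos : 0 < b := by positivity
  have hbk : b * k = r / 4 := by rw [hb]; field_simp
  have hb1 : 2 * b < r := by nlinarith [norm_nonneg u, norm_nonneg v]
  have hmem : ∀ x : C3, (∀ j, (x j).im = 0) → ‖x‖ < r / 2 → ∀ t : ℂ, |t.re| ≤ b → 0 < t.im →
      t.im ≤ 2 * b → p + x + t • v ∈ W := by
    intro x hx hxr t ht1 ht2 ht3
    -- Moving by t v, with v the imaginary part of c, is a real displacement followed by Im t times
    -- c. So the upper half of each complex line in the direction v lies in W and its real line lies
    -- in the edge.
    have hx' : p + x + t • v = p + (x + (t.re : ℂ) • v - (t.im : ℂ) • u) + (t.im : ℂ) • c := by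
      rw [huv]
      nth_rewrite 1 [← Complex.re_add_im t]
      simp only [add_smul, smul_add, mul_smul]
      abel
    rw [hx']
    refine hcW _ (fun j => by simp [hx j, hvre j, hure j]) ?_ _ ht2 (by linarith)
    have n1 : ‖(t.re : ℂ) • v‖ ≤ b * ‖v‖ := by
      rw [norm_smul, Complex.norm_real]
      gcongr
      exact ht1
    have n2 : ‖(t.im : ℂ) • u‖ ≤ 2 * b * ‖u‖ := by
      rw [norm_smul, Complex.norm_real, Real.norm_eq_abs, abs_of_pos ht2]
      gcongr
    have n3 := norm_sub_le (x + (t.re : ℂ) • v) ((t.im : ℂ) • u)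
    have n4 := norm_add_le x ((t.re : ℂ) • v)
    nlinarith [norm_nonneg u, norm_nonneg v]
  have hedge : ∀ x : C3, (∀ j, (x j).im = 0) → ‖x‖ < r / 2 → ∀ t : ℂ, |t.re| ≤ b → t.im = 0 →
      p + x + t • v ∈ S ∧ G (p + x + t • v) = 0 := by
    intro x hx hxr t ht1 ht2
    rw [add_assoc]
    refine hS _ (fun j => by simp [hx j, hvre j, ht2]) ?_
    have htt : t = (t.re : ℂ) := by apply Complex.ext <;> simp [ht2]
    have n1 : ‖t • v‖ ≤ b * ‖v‖ := by
      rw [htt, norm_smul, Complex.norm_real]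
      gcongr
      exact ht1
    have n4 := norm_add_le x (t • v)
    nlinarith [norm_nonneg u, norm_nonneg v]
  -- The square centred at ib with half-side b has its lower side on the edge. As x varies, its
  -- centres fill a totally real slice through one interior point.
  have hzero : ∀ x : C3, (∀ j, (x j).im = 0) → ‖x‖ < r / 2 →
      G (p + x + ((b : ℂ) * Complex.I) • v) = 0 := by
    intro x hx hxr
    refine Complex.eq_zero_center_of_eq_zero_lower_side (g := fun t => G (p + x + t • v)) hbpos
      ?_ ?_ ?_
    · intro w hw1 hw2
      have hm := hmem x hx hxr (b * Complex.I + w) (by simpa using hw1.le)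
        (by simp; linarith [(abs_lt.1 hw2).1]) (by simp; linarith [(abs_lt.1 hw2).2])
      exact DifferentiableAt.comp (b * Complex.I + w) (hG.differentiableAt (hW.mem_nhds hm))
        (by fun_prop)
    · refine ContinuousOn.comp (g := G) hGc (by fun_prop) fun w hw => ?_
      have h2 := abs_le.1 hw.2
      rcases h2.1.lt_or_eq with h | h
      · exact Or.inl (hmem x hx hxr _ (by simpa using hw.1) (by simp; linarith)
          (by simp; linarith))
      · exact Or.inr (hedge x hx hxr _ (by simpa using hw.1) (by simp; linarith)).1
    · intro w hw1 hw2
      exact (hedge x hx hxr _ (by simpa using hw1) (by simp [hw2])).2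
  set w₀ := p + ((b : ℂ) * Complex.I) • v
  have hw₀ : w₀ ∈ W := by
    have := hmem 0 (by simp) (by simpa using by linarith) (b * Complex.I) (by simpa using hbpos.le)
      (by simpa using hbpos) (by simp; linarith)
    simpa [w₀] using this
  obtain ⟨ρ, hρ, hρW⟩ := Metric.isOpen_iff.1 hW w₀ hw₀
  refine ⟨w₀, hw₀, eventually_eq_zero_of_eq_zero_on_real (r := min ρ (r / 2)) (by positivity)
    (hG.mono ((Metric.ball_subset_ball (min_le_left _ _)).trans hρW)) fun x hx hxr => ?_⟩
  have := hzero x hx (lt_of_lt_of_le hxr (min_le_right _ _))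
  rwa [show w₀ + x = p + x + ((b : ℂ) * Complex.I) • v by simp only [w₀]; abel]

/-- The complement of the zero set of an entire function is connected. -/
theorem isConnected_setOf_ne_zero {h : E → ℂ} (hh : Differentiable ℂ h) {z₀ : E}
    (hz₀ : h z₀ ≠ 0) : IsConnected {z | h z ≠ 0} := by
  refine ⟨⟨z₀, hz₀⟩, isPreconnected_of_forall z₀ fun w hw => ?_⟩
  -- The complex line through z₀ and w meets the zero set of h in a discrete, hence countable, set,
  -- and the plane minus a countable set is path connected.
  set f : ℂ → ℂ := fun t => h (z₀ + t • (w - z₀)) with hf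
  have hfd : Differentiable ℂ f := hh.comp (by fun_prop)
  have hfa : AnalyticOnNhd ℂ f univ := fun t _ => hfd.analyticAt t
  have hcount : (f ⁻¹' {0}).Countable := by
    have hcod : (f ⁻¹' {0})ᶜ ∈ codiscrete ℂ := by
      have := hfa.preimage_zero_mem_codiscrete (x := 0) (by simpa [hf] using hz₀)
      simpa using this
    have hdis := isDiscrete_of_codiscreteWithin hcod
    rw [inter_univ] at hdis
    have := hdis.to_subtype
    exact Set.countable_coe_iff.1 countable_of_Lindelof_of_discrete
  have hrank : 1 < Module.rank ℝ ℂ := by rw [Complex.rank_real_complex]; norm_num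
  have hpc := (hcount.isPathConnected_compl_of_one_lt_rank hrank).isConnected
  refine ⟨(fun t : ℂ => z₀ + t • (w - z₀)) '' (f ⁻¹' {0})ᶜ, ?_, ⟨0, ?_, by simp⟩, ⟨1, ?_, by simp⟩,
    hpc.isPreconnected.image _ (by fun_prop)⟩
  · rintro _ ⟨t, ht, rfl⟩
    exact ht
  · simpa [hf] using hz₀
  · simpa [hf] using hw

end Holomorphic

/-! ### The form `dG ∧ dz₁ ∧ dz₂ ∧ dz₃` -/

section DbarForm

/-- The coefficient of `ℓ ∧ dz₁ ∧ dz₂ ∧ dz₃` in the coordinates `Φ`. -/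
noncomputable def dbarWedge (Φ : RR 4 → C3) (t : RR 4) (ℓ : RR 4 →L[ℝ] ℂ) : ℂ :=
  Matrix.det (Matrix.of
    ![fun j : Fin 4 => ℓ (EuclideanSpace.single j 1),
      fun j : Fin 4 => fderiv ℝ Φ t (EuclideanSpace.single j 1) 0,
      fun j : Fin 4 => fderiv ℝ Φ t (EuclideanSpace.single j 1) 1,
      fun j : Fin 4 => fderiv ℝ Φ t (EuclideanSpace.single j 1) 2])

theorem dbarForm_eq_dbarWedge (Φ : RR 4 → C3) (G : RR 4 → ℂ) (t : RR 4) :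
    dbarForm Φ G t = dbarWedge Φ t (fderiv ℝ G t) := rfl

/-- The `3 × 3` minor of a `3 × n` matrix with columns `k`, `l`, `m`. -/
def minorThree {n : Type*} (a b c : n → ℂ) (k l m : n) : ℂ :=
  a k * (b l * c m - b m * c l) - a l * (b k * c m - b m * c k) + a m * (b k * c l - b l * c k)

theorem det_four_eq (r a b c : Fin 4 → ℂ) :
    Matrix.det (Matrix.of ![r, a, b, c]) =
      r 0 * minorThree a b c 1 2 3 - r 1 * minorThree a b c 0 2 3
        + r 2 * minorThree a b c 0 1 3 - r 3 * minorThree a b c 0 1 2 := by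
  simp [Matrix.det_succ_row_zero, Fin.sum_univ_succ, minorThree, Fin.succAbove]
  ring

theorem dbarWedge_add (Φ : RR 4 → C3) (t : RR 4) (ℓ ℓ' : RR 4 →L[ℝ] ℂ) :
    dbarWedge Φ t (ℓ + ℓ') = dbarWedge Φ t ℓ + dbarWedge Φ t ℓ' := by
  simp only [dbarWedge, det_four_eq, add_apply]
  ring

theorem dbarWedge_smul (Φ : RR 4 → C3) (t : RR 4) (c : ℂ) (ℓ : RR 4 →L[ℝ] ℂ) :
    dbarWedge Φ t (c • ℓ) = c * dbarWedge Φ t ℓ := by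
  simp only [dbarWedge, det_four_eq, smul_apply, smul_eq_mul]
  ring

/-- Complex linear combinations of the `dz_j` wedge to zero. -/
theorem dbarWedge_comp_eq_zero (Φ : RR 4 → C3) (t : RR 4) (ℓ : C3 →L[ℂ] ℂ) :
    dbarWedge Φ t ((ℓ.restrictScalars ℝ).comp (fderiv ℝ Φ t)) = 0 := by
  obtain ⟨a, b, c, h⟩ : ∃ a b c : ℂ, ∀ v : C3, ℓ v = v 0 * a + v 1 * b + v 2 * c := by
    refine ⟨ℓ (Pi.single 0 1), ℓ (Pi.single 1 1), ℓ (Pi.single 2 1), fun v => ?_⟩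
    have : v = v 0 • Pi.single 0 1 + v 1 • Pi.single 1 1 + v 2 • (Pi.single 2 1 : C3) := by
      ext j
      fin_cases j <;> simp
    conv_lhs => rw [this]
    simp only [map_add, map_smul, smul_eq_mul]
  simp only [dbarWedge, det_four_eq, ContinuousLinearMap.comp_apply,
    ContinuousLinearMap.coe_restrictScalars', h, minorThree]
  ring

/-- The Leibniz rule, one term for each row. The derivative sits behind an existential because only
its values enter the divergence computation. -/
theorem hasFDerivAt_minorThree {E : Type*} [NormedAddCommGroup E] [NormedSpace ℝ E] {n : Type*}
    {a b c : E → n → ℂ} {a' b' c' : n → E →L[ℝ] ℂ} {t : E} {k l m : n}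
    (ha : ∀ j, HasFDerivAt (fun t => a t j) (a' j) t)
    (hb : ∀ j, HasFDerivAt (fun t => b t j) (b' j) t)
    (hc : ∀ j, HasFDerivAt (fun t => c t j) (c' j) t) :
    ∃ L : E →L[ℝ] ℂ, HasFDerivAt (fun t => minorThree (a t) (b t) (c t) k l m) L t ∧
      ∀ v, L v = minorThree (fun j => a' j v) (b t) (c t) k l m +
        minorThree (a t) (fun j => b' j v) (c t) k l m +
        minorThree (a t) (b t) (fun j => c' j v) k l m := by
  refine ⟨_, (((ha k).fun_mul (((hb l).fun_mul (hc m)).fun_sub ((hb m).fun_mul (hc l)))).fun_sub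
    ((ha l).fun_mul (((hb k).fun_mul (hc m)).fun_sub ((hb m).fun_mul (hc k))))).fun_add
    ((ha m).fun_mul (((hb k).fun_mul (hc l)).fun_sub ((hb l).fun_mul (hc k)))), fun v => ?_⟩
  simp [minorThree]
  ring

theorem integral_fderiv_eq_zero_of_hasCompactSupport {F : RR 4 → ℂ} (hF : ContDiff ℝ 1 F)
    (hc : HasCompactSupport F) (v : RR 4) : ∫ t, fderiv ℝ F t v = 0 := by
  have hcont : Continuous fun t => fderiv ℝ F t v :=
    (hF.continuous_fderiv (by simp)).clm_apply continuous_const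
  have hc' : HasCompactSupport fun t => fderiv ℝ F t v := hc.fderiv_apply (𝕜 := ℝ) v
  have hi : Integrable (fun t => fderiv ℝ F t v) (volume : Measure (RR 4)) :=
    hcont.integrable_of_hasCompactSupport hc'
  have hi' : Integrable F (volume : Measure (RR 4)) :=
    hF.continuous.integrable_of_hasCompactSupport hc
  -- Integration by parts against the constant function 1.
  have := integral_mul_fderiv_eq_neg_fderiv_mul_of_integrable (v := v)
    (f := fun _ : RR 4 => (1 : ℂ)) (g := F) (by simp) (by simpa using hi) (by simpa using hi')
    (fun x _ => differentiableAt_const _) (fun x _ => hF.differentiable (by simp) x)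
  simpa using this

/-- Stokes' theorem for the exact form `dG ∧ dz₁ ∧ dz₂ ∧ dz₃`. -/
theorem integral_dbarForm_eq_zero {Φ : RR 4 → C3} {V : Set (RR 4)} (hV : IsOpen V)
    (hΦ : ContDiffOn ℝ ∞ Φ V) {G : RR 4 → ℂ} (hG : ContDiff ℝ ∞ G) (hGc : HasCompactSupport G)
    (hGV : tsupport G ⊆ V) : ∫ t, dbarForm Φ G t = 0 := by
  let e : Fin 4 → RR 4 := fun j => EuclideanSpace.single j 1
  let u : Fin 3 → RR 4 → Fin 4 → ℂ := fun i t j => fderiv ℝ Φ t (e j) i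
  -- The signed cofactors of the first row, so that the form is ∑ ∂ⱼG mⱼ.
  let m : Fin 4 → RR 4 → ℂ := fun j t =>
    ![minorThree (u 0 t) (u 1 t) (u 2 t) 1 2 3, -minorThree (u 0 t) (u 1 t) (u 2 t) 0 2 3,
      minorThree (u 0 t) (u 1 t) (u 2 t) 0 1 3, -minorThree (u 0 t) (u 1 t) (u 2 t) 0 1 2] j
  have hform : ∀ t, dbarForm Φ G t = ∑ j, fderiv ℝ G t (e j) * m j t := by
    intro t
    rw [dbarForm, det_four_eq, Fin.sum_univ_four]
    simp only [m, u, e, Matrix.cons_val]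
    ring
  have hu : ∀ i j, ContDiffOn ℝ ∞ (fun t => u i t j) V := by
    intro i j
    have h1 : ContDiffOn ℝ ∞ (fderiv ℝ Φ) V := hΦ.fderiv_of_isOpen hV (by simp)
    have h2 : ContDiffOn ℝ ∞ (fun t => fderiv ℝ Φ t (e j)) V := h1.clm_apply contDiffOn_const
    exact (contDiffOn_pi.1 h2) i
  have hm : ∀ j, ContDiffOn ℝ ∞ (m j) V := by
    intro j
    have h : ∀ k l n, ContDiffOn ℝ ∞ (fun t => minorThree (u 0 t) (u 1 t) (u 2 t) k l n) V := by
      intro k l n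
      simp only [minorThree]
      exact (((hu 0 k).mul (((hu 1 l).mul (hu 2 n)).sub ((hu 1 n).mul (hu 2 l)))).sub
        ((hu 0 l).mul (((hu 1 k).mul (hu 2 n)).sub ((hu 1 n).mul (hu 2 k))))).add
        ((hu 0 n).mul (((hu 1 k).mul (hu 2 l)).sub ((hu 1 l).mul (hu 2 k))))
    fin_cases j
    · exact h 1 2 3
    · exact (h 0 2 3).neg
    · exact h 0 1 3
    · exact (h 0 1 2).neg
  -- The cofactors are smooth only on V; multiplication by G, supported in V, makes the product
  -- smooth everywhere.
  have hF : ∀ j, ContDiff ℝ ∞ fun t => G t * m j t := by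
    intro j
    rw [contDiff_iff_contDiffAt]
    intro t
    by_cases ht : t ∈ tsupport G
    · exact hG.contDiffAt.mul ((hm j).contDiffAt (hV.mem_nhds (hGV ht)))
    · have : (fun t => G t * m j t) =ᶠ[𝓝 t] fun _ => 0 := by
        filter_upwards [notMem_tsupport_iff_eventuallyEq.1 ht] with s hs
        simp [hs]
      exact contDiffAt_const.congr_of_eventuallyEq this
  have hFc : ∀ j, HasCompactSupport fun t => G t * m j t := fun j => hGc.mul_right
  -- The form is the divergence of (G mⱼ) because ∑ ∂ⱼmⱼ = 0: dz₁ ∧ dz₂ ∧ dz₃ is closed, which in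
  -- coordinates is the symmetry of the second derivatives of Φ.
  have hdiv : ∀ t, dbarForm Φ G t = ∑ j, fderiv ℝ (fun t => G t * m j t) t (e j) := by
    intro t
    by_cases ht : t ∈ tsupport G
    · have htV := hGV ht
      have hGd := (hG.differentiable (by simp) t).hasFDerivAt
      let u' : Fin 3 → Fin 4 → RR 4 →L[ℝ] ℂ := fun i j => fderiv ℝ (fun t => u i t j) t
      have hu' : ∀ i j, HasFDerivAt (fun t => u i t j) (u' i j) t := fun i j =>
        (((hu i j).contDiffAt (hV.mem_nhds htV)).differentiableAt (by simp)).hasFDerivAt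
      have hsymm : ∀ i j k, u' i j (e k) = u' i k (e j) := by
        have hΦt : ContDiffAt ℝ ∞ Φ t := hΦ.contDiffAt (hV.mem_nhds htV)
        have hs : IsSymmSndFDerivAt ℝ Φ t := hΦt.isSymmSndFDerivAt (by simp; norm_cast)
        have hdd : DifferentiableAt ℝ (fderiv ℝ Φ) t :=
          (hΦt.fderiv_right (m := 1) (by norm_cast)).differentiableAt (by simp)
        have hval : ∀ i j v, u' i j v = fderiv ℝ (fderiv ℝ Φ) t v (e j) i := by
          intro i j v
          have h1 : HasFDerivAt (fun t => fderiv ℝ Φ t (e j)) _ t :=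
            hdd.hasFDerivAt.clm_apply (hasFDerivAt_const (e j) t)
          have h2 := (hasFDerivAt_pi'.1 h1) i
          have h3 : u' i j = _ := h2.fderiv
          rw [h3]
          simp
        intro i j k
        rw [hval, hval, hs.eq]
      choose L hL hLv using fun k l n : Fin 4 =>
        hasFDerivAt_minorThree (k := k) (l := l) (m := n) (hu' 0) (hu' 1) (hu' 2)
      have h0 := (hGd.fun_mul (hL 1 2 3)).fderiv
      have h1 := (hGd.fun_mul (hL 0 2 3).fun_neg).fderiv
      have h2 := (hGd.fun_mul (hL 0 1 3)).fderiv
      have h3 := (hGd.fun_mul (hL 0 1 2).fun_neg).fderiv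
      rw [hform, Fin.sum_univ_four, Fin.sum_univ_four]
      simp only [m, Matrix.cons_val]
      rw [h0, h1, h2, h3]
      simp only [add_apply, smul_apply,
        neg_apply, smul_eq_mul, hLv, minorThree]
      rw [hsymm 0 1 0, hsymm 0 2 0, hsymm 0 3 0, hsymm 0 2 1, hsymm 0 3 1, hsymm 0 3 2,
        hsymm 1 1 0, hsymm 1 2 0, hsymm 1 3 0, hsymm 1 2 1, hsymm 1 3 1, hsymm 1 3 2,
        hsymm 2 1 0, hsymm 2 2 0, hsymm 2 3 0, hsymm 2 2 1, hsymm 2 3 1, hsymm 2 3 2]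
      ring
    · have hz := notMem_tsupport_iff_eventuallyEq.1 ht
      have h1 : ∀ j, fderiv ℝ (fun t => G t * m j t) t = 0 := by
        intro j
        have : (fun t => G t * m j t) =ᶠ[𝓝 t] fun _ => 0 := by
          filter_upwards [hz] with s hs
          simp [hs]
        rw [this.fderiv_eq]
        simp
      have h2 : fderiv ℝ G t = 0 := by
        rw [hz.fderiv_eq]
        simp
      rw [hform, h2]
      simp [h1]
  simp_rw [hdiv]
  rw [integral_finsetSum]
  · exact Finset.sum_eq_zero fun j _ => integral_fderiv_eq_zero_of_hasCompactSupport
      ((hF j).of_le (by norm_cast)) (hFc j) (e j)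
  · intro j _
    refine Continuous.integrable_of_hasCompactSupport ?_ ((hFc j).fderiv_apply (𝕜 := ℝ) (e j))
    exact ((hF j).continuous_fderiv (by simp)).clm_apply continuous_const

theorem dbarForm_eq_zero_of_notMem_tsupport {Φ : RR 4 → C3} {G : RR 4 → ℂ} {t : RR 4}
    (ht : t ∉ tsupport G) : dbarForm Φ G t = 0 := by
  have h2 : fderiv ℝ G t = 0 := by
    rw [(notMem_tsupport_iff_eventuallyEq.1 ht).fderiv_eq]
    simp
  rw [dbarForm_eq_dbarWedge, h2]
  simp [dbarWedge, det_four_eq]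

/-- Restrictions of holomorphic functions are CR in the sense of distributions. -/
theorem integral_mul_dbarForm_eq_zero {Φ : RR 4 → C3} {V : Set (RR 4)} (hV : IsOpen V)
    (hΦ : ContDiffOn ℝ ∞ Φ V) {f : C3 → ℂ} (hf : ∀ t ∈ V, DifferentiableAt ℂ f (Φ t))
    (hfs : ContDiffOn ℝ ∞ (fun t => f (Φ t)) V) {G : RR 4 → ℂ} (hG : ContDiff ℝ ∞ G)
    (hGc : HasCompactSupport G) (hGV : tsupport G ⊆ V) :
    ∫ t in V, f (Φ t) * dbarForm Φ G t = 0 := by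
  have hprod : ContDiff ℝ ∞ fun t => f (Φ t) * G t := by
    rw [contDiff_iff_contDiffAt]
    intro t
    by_cases ht : t ∈ tsupport G
    · exact (hfs.contDiffAt (hV.mem_nhds (hGV ht))).mul hG.contDiffAt
    · have : (fun t => f (Φ t) * G t) =ᶠ[𝓝 t] fun _ => 0 := by
        filter_upwards [notMem_tsupport_iff_eventuallyEq.1 ht] with s hs
        simp [hs]
      exact contDiffAt_const.congr_of_eventuallyEq this
  have hpc : HasCompactSupport fun t => f (Φ t) * G t := hGc.mul_left
  have hsub : tsupport (fun t => f (Φ t) * G t) ⊆ tsupport G := tsupport_mul_subset_right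
  -- In d(fG) = f dG + G df the last term drops out after wedging, since df is a complex combination
  -- of the dzⱼ. The integral is thus reduced to the exact case.
  have hkey : ∀ t, f (Φ t) * dbarForm Φ G t = dbarForm Φ (fun t => f (Φ t) * G t) t := by
    intro t
    by_cases ht : t ∈ tsupport G
    · have htV := hGV ht
      have h1 : HasFDerivAt (fun t => f (Φ t))
          (((fderiv ℂ f (Φ t)).restrictScalars ℝ).comp (fderiv ℝ Φ t)) t :=
        (hf t htV).hasFDerivAt.restrictScalars ℝ |>.comp t
          ((hΦ.contDiffAt (hV.mem_nhds htV)).differentiableAt (by simp)).hasFDerivAt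
      have h2 := (h1.fun_mul (hG.differentiable (by simp) t).hasFDerivAt).fderiv
      rw [dbarForm_eq_dbarWedge, dbarForm_eq_dbarWedge, h2, dbarWedge_add, dbarWedge_smul,
        dbarWedge_smul, dbarWedge_comp_eq_zero]
      ring
    · rw [dbarForm_eq_zero_of_notMem_tsupport ht,
        dbarForm_eq_zero_of_notMem_tsupport fun h => ht (hsub h), mul_zero]
  have hzero : ∀ t ∉ V, f (Φ t) * dbarForm Φ G t = 0 := fun t ht => by
    rw [dbarForm_eq_zero_of_notMem_tsupport fun h => ht (hGV h), mul_zero]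
  rw [setIntegral_eq_integral_of_forall_compl_eq_zero hzero]
  simp_rw [hkey]
  exact integral_dbarForm_eq_zero hV hΦ hprod hpc (hsub.trans hGV)

end DbarForm

/-! ### Local parametrizations -/

section LocalParam

theorem IsLocalParam.mem {k : WithTop ℕ∞} {d : ℕ} {S : Set C3} {Φ : RR d → C3} {V : Set (RR d)}
    (h : IsLocalParam k d S Φ V) {t : RR d} (ht : t ∈ V) : Φ t ∈ S := by
  obtain ⟨O, -, hO⟩ := h.image_eq
  exact (hO ▸ mem_image_of_mem Φ ht : Φ t ∈ S ∩ O).1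

/-- A local parametrization is a homeomorphism onto its image, so curves in `S` lift. -/
theorem IsLocalParam.tangentAt_eq_range {k : WithTop ℕ∞} (hk : 1 ≤ k) {d : ℕ} {S : Set C3}
    {Φ : RR d → C3} {V : Set (RR d)} (h : IsLocalParam k d S Φ V) {t : RR d} (ht : t ∈ V) :
    tangentAt S (Φ t) = LinearMap.range (fderiv ℝ Φ t : RR d →ₗ[ℝ] C3) := by
  have hC : ContDiffAt ℝ k Φ t := h.contDiffOn.contDiffAt (h.isOpen.mem_nhds ht)
  have hk0 : k ≠ 0 := by
    rintro rfl
    simp at hk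
  have hD : HasStrictFDerivAt Φ (fderiv ℝ Φ t) t := hC.hasStrictFDerivAt hk0
  apply le_antisymm
  · refine Submodule.span_le.2 ?_
    rintro w ⟨γ, hγ0, hγS, hγd⟩
    -- Composing Φ with a linear left inverse of its differential gives a local diffeomorphism of
    -- the parameter space. This turns a continuous lift of the curve into a differentiable one.
    obtain ⟨L, hL⟩ := LinearMap.exists_leftInverse_of_injective (fderiv ℝ Φ t : RR d →ₗ[ℝ] C3)
      (LinearMap.ker_eq_bot.2 (h.immersion t ht))
    let L' : C3 →L[ℝ] RR d := LinearMap.toContinuousLinearMap L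
    have hLL : ∀ v, L' (fderiv ℝ Φ t v) = v := fun v => LinearMap.congr_fun hL v
    have hLΦ : HasStrictFDerivAt (fun x => L' (Φ x))
        ((ContinuousLinearEquiv.refl ℝ (RR d) : RR d ≃L[ℝ] RR d) : RR d →L[ℝ] RR d) t := by
      refine (L'.hasStrictFDerivAt.comp t hD).congr_fderiv ?_
      ext1 v
      simp [hLL]
    obtain ⟨O, hO, hOeq⟩ := h.image_eq
    have hpO : Φ t ∈ O := (hOeq ▸ mem_image_of_mem Φ ht : Φ t ∈ S ∩ O).2
    have hev : ∀ᶠ s in 𝓝 (0 : ℝ), ∃ x : V, Φ x = γ s := by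
      have : ∀ᶠ s in 𝓝 (0 : ℝ), γ s ∈ O :=
        hγd.continuousAt.eventually (hO.mem_nhds (by rwa [hγ0]))
      filter_upwards [hγS, this] with s h1 h2
      obtain ⟨x, hx, hxs⟩ : γ s ∈ Φ '' V := hOeq ▸ ⟨h1, h2⟩
      exact ⟨⟨x, hx⟩, hxs⟩
    have : ∀ s : ℝ, ∃ x : V, (∃ x : V, Φ x = γ s) → Φ x = γ s := by
      intro s
      by_cases hs : ∃ x : V, Φ x = γ s
      · exact ⟨hs.choose, fun _ => hs.choose_spec⟩
      · exact ⟨⟨t, ht⟩, fun h => absurd h hs⟩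
    choose c hc using this
    have hcev : ∀ᶠ s in 𝓝 (0 : ℝ), Φ (c s) = γ s := hev.mono fun s hs => hc s hs
    -- Continuity of the lift at 0 is where the embedding property is needed; an injective immersion
    -- would not suffice.
    have hct : Tendsto c (𝓝 0) (𝓝 ⟨t, ht⟩) := by
      rw [h.isEmbedding.isInducing.tendsto_nhds_iff]
      have h1 : Tendsto γ (𝓝 0) (𝓝 (Φ t)) := hγ0 ▸ hγd.continuousAt.tendsto
      exact h1.congr' (hcev.mono fun s hs => hs.symm)
    have hct' : Tendsto (fun s => (c s : RR d)) (𝓝 0) (𝓝 t) :=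
      (continuous_subtype_val.tendsto _).comp hct
    let inv : RR d → RR d := HasStrictFDerivAt.localInverse (fun x => L' (Φ x))
      (ContinuousLinearEquiv.refl ℝ (RR d)) t hLΦ
    have hinv : ∀ᶠ s in 𝓝 (0 : ℝ), (c s : RR d) = inv (L' (γ s)) := by
      filter_upwards [hct'.eventually hLΦ.eventually_left_inverse, hcev] with s h1 h2
      rw [← h2]
      exact h1.symm
    have hcd : HasDerivAt (fun s => (c s : RR d)) (L' w) 0 := by
      have h1 : HasFDerivAt inv
          ((ContinuousLinearEquiv.refl ℝ (RR d)).symm : RR d →L[ℝ] RR d) (L' (γ 0)) := by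
        rw [hγ0]
        exact hLΦ.to_localInverse.hasFDerivAt
      have h2 : HasDerivAt (fun s => L' (γ s)) (L' w) 0 := L'.hasFDerivAt.comp_hasDerivAt 0 hγd
      exact (h1.comp_hasDerivAt (0 : ℝ) h2).congr_of_eventuallyEq hinv
    have hc0 : (c 0 : RR d) = t := by
      have h1 : c 0 = ⟨t, ht⟩ := h.isEmbedding.injective (by
        change Φ (c 0) = Φ t
        rw [hcev.self_of_nhds, hγ0])
      rw [h1]
    have hfin : HasDerivAt γ (fderiv ℝ Φ t (L' w)) 0 := by
      have h1 : HasFDerivAt Φ (fderiv ℝ Φ t) (c 0 : RR d) := by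
        rw [hc0]
        exact hD.hasFDerivAt
      exact (h1.comp_hasDerivAt (0 : ℝ) hcd).congr_of_eventuallyEq
        (hcev.mono fun s hs => hs.symm)
    exact ⟨L' w, hfin.unique hγd⟩
  · rintro _ ⟨v, rfl⟩
    refine Submodule.subset_span ⟨fun s => Φ (t + s • v), by simp, ?_, ?_⟩
    · have : Tendsto (fun s : ℝ => t + s • v) (𝓝 0) (𝓝 t) := by
        have : Continuous fun s : ℝ => t + s • v := by fun_prop
        simpa using this.tendsto 0
      filter_upwards [this (h.isOpen.mem_nhds ht)] with s hs
      exact h.mem hs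
    · have h1 : HasDerivAt (fun s : ℝ => t + s • v) v 0 := by
        simpa using ((hasDerivAt_id (0 : ℝ)).smul_const v).const_add t
      have h2 : HasFDerivAt Φ (fderiv ℝ Φ t) (t + (0 : ℝ) • v) := by
        simpa using hD.hasFDerivAt
      exact h2.comp_hasDerivAt (0 : ℝ) h1

/-- Change of parameters in a local parametrization. -/
theorem IsLocalParam.comp {k : WithTop ℕ∞} (hk : 1 ≤ k) {d : ℕ} {S : Set C3} {Φ : RR d → C3}
    {V : Set (RR d)} (h : IsLocalParam k d S Φ V) (θ : OpenPartialHomeomorph (RR d) (RR d))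
    (hθ : ContDiffOn ℝ k θ θ.source) (hθ' : ContDiffOn ℝ k θ.symm θ.target) (hV : θ.target ⊆ V) :
    IsLocalParam k d S (Φ ∘ θ) θ.source := by
  have hk0 : k ≠ 0 := by
    rintro rfl
    simp at hk
  have hmaps : MapsTo θ θ.source V := fun x hx => hV (θ.map_source hx)
  refine ⟨θ.open_source, h.contDiffOn.comp hθ hmaps, fun t ht => ?_, ?_, ?_⟩
  · have h1 : DifferentiableAt ℝ Φ (θ t) :=
      (h.contDiffOn.contDiffAt (h.isOpen.mem_nhds (hmaps ht))).differentiableAt hk0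
    have h2 : DifferentiableAt ℝ θ t :=
      (hθ.contDiffAt (θ.open_source.mem_nhds ht)).differentiableAt hk0
    have h3 : DifferentiableAt ℝ θ.symm (θ t) :=
      (hθ'.contDiffAt (θ.open_target.mem_nhds (θ.map_source ht))).differentiableAt hk0
    rw [fderiv_comp t h1 h2]
    refine (h.immersion _ (hmaps ht)).comp ?_
    have h4 : (fderiv ℝ θ.symm (θ t)).comp (fderiv ℝ θ t) = ContinuousLinearMap.id ℝ _ := by
      rw [← fderiv_comp t h3 h2, ← fderiv_id (𝕜 := ℝ) (x := t)]
      refine Filter.EventuallyEq.fderiv_eq ?_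
      filter_upwards [θ.open_source.mem_nhds ht] with x hx
      exact θ.left_inv hx
    exact Function.LeftInverse.injective (g := fderiv ℝ θ.symm (θ t)) fun v =>
      congrArg (fun L => L v) h4
  · have h1 : IsEmbedding fun t : θ.source => (⟨θ t, hmaps t.2⟩ : V) := by
      have h2 : IsEmbedding ((θ.source).domRestrict θ) :=
        (θ.isOpenEmbedding_restrict).isEmbedding
      refine IsEmbedding.of_comp (g := ((↑) : V → RR d)) ?_ continuous_subtype_val h2
      exact h2.continuous.subtype_mk _
    exact h.isEmbedding.comp h1
  · obtain ⟨O, hO, hOeq⟩ := h.image_eq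
    obtain ⟨O', hO', hOO'⟩ := (h.isEmbedding.isInducing.isOpen_iff).1
      ((θ.open_target).preimage (continuous_subtype_val (p := (· ∈ V))))
    refine ⟨O ∩ O', hO.inter hO', ?_⟩
    rw [← inter_assoc, ← hOeq, image_comp, θ.image_source_eq_target]
    ext z
    constructor
    · rintro ⟨x, hx, rfl⟩
      refine ⟨mem_image_of_mem _ (hV hx), ?_⟩
      have : (⟨x, hV hx⟩ : V) ∈ (fun t : V => Φ t) ⁻¹' O' := by
        rw [hOO']
        exact hx
      exact this
    · rintro ⟨⟨x, hx, rfl⟩, hz⟩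
      refine ⟨x, ?_, rfl⟩
      have : (⟨x, hx⟩ : V) ∈ (fun t : V => Φ t) ⁻¹' O' := hz
      rw [hOO'] at this
      exact this

end LocalParam

/-! ### Charts adapted to a submersion to the complex plane -/

section AdaptedChart

/-- The complex coordinate `y₀ + i y₁`. -/
noncomputable def tauC : RR 4 →L[ℝ] ℂ :=
  Complex.ofRealCLM.comp (EuclideanSpace.proj 0) +
    Complex.I • Complex.ofRealCLM.comp (EuclideanSpace.proj 1)

theorem tauC_apply (y : RR 4) : tauC y = (y 0 : ℂ) + Complex.I * (y 1 : ℂ) := rfl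

theorem tauC_re (y : RR 4) : (tauC y).re = y 0 := by simp [tauC_apply]

theorem tauC_im (y : RR 4) : (tauC y).im = y 1 := by simp [tauC_apply]

/-- The function u is completed to a local diffeomorphism by two linear coordinates that restrict to
an isomorphism on the kernel of its differential. These charts turn a regular zero of h on M into
the model function y₀ + iy₁. -/
theorem exists_adapted_chart {V : Set (RR 4)} (hV : IsOpen V) {u : RR 4 → ℂ}
    (hu : ContDiffOn ℝ ∞ u V) {t₀ : RR 4} (ht₀ : t₀ ∈ V) (h0 : u t₀ = 0)
    (hs : Function.Surjective (fderiv ℝ u t₀)) :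
    ∃ θ : OpenPartialHomeomorph (RR 4) (RR 4), t₀ ∈ θ.source ∧ θ.source ⊆ V ∧ θ t₀ = 0 ∧
      ContDiffOn ℝ ∞ θ θ.source ∧ ContDiffOn ℝ ∞ θ.symm θ.target ∧
      ∀ t ∈ θ.source, tauC (θ t) = u t := by
  set A : RR 4 →L[ℝ] ℂ := fderiv ℝ u t₀ with hA
  have hker : Module.finrank ℝ (LinearMap.ker (A : RR 4 →ₗ[ℝ] ℂ)) = 2 := by
    have h1 := LinearMap.finrank_range_add_finrank_ker (A : RR 4 →ₗ[ℝ] ℂ)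
    rw [LinearMap.range_eq_top.2 hs, finrank_top, Complex.finrank_real_complex,
      finrank_euclideanSpace_fin] at h1
    omega
  obtain ⟨e⟩ : Nonempty (LinearMap.ker (A : RR 4 →ₗ[ℝ] ℂ) ≃ₗ[ℝ] (Fin 2 → ℝ)) :=
    FiniteDimensional.nonempty_linearEquiv_of_finrank_eq (by rw [hker]; simp)
  obtain ⟨g, hg⟩ := LinearMap.exists_extend (e : LinearMap.ker (A : RR 4 →ₗ[ℝ] ℂ) →ₗ[ℝ] (Fin 2 → ℝ))
  let g' : RR 4 →L[ℝ] (Fin 2 → ℝ) := LinearMap.toContinuousLinearMap g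
  let Q : ℂ × (Fin 2 → ℝ) →L[ℝ] RR 4 := LinearMap.toContinuousLinearMap
    { toFun := fun z => WithLp.toLp 2 ![z.1.re, z.1.im, z.2 0, z.2 1]
      map_add' := fun a b => by ext i; fin_cases i <;> simp
      map_smul' := fun a b => by ext i; fin_cases i <;> simp }
  have hQ : ∀ z, Q z = WithLp.toLp 2 ![z.1.re, z.1.im, z.2 0, z.2 1] := fun z => rfl
  have hQinj : ∀ z, Q z = 0 → z = 0 := by
    intro z hz
    have h : ∀ i, Q z i = 0 := fun i => by rw [hz]; rfl
    have e0 : z.1.re = 0 := by simpa [hQ] using h 0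
    have e1 : z.1.im = 0 := by simpa [hQ] using h 1
    have e2 : z.2 0 = 0 := by simpa [hQ] using h 2
    have e3 : z.2 1 = 0 := by simpa [hQ] using h 3
    refine Prod.ext (Complex.ext e0 e1) (funext fun i => ?_)
    · fin_cases i
      · exact e2
      · exact e3
  let F : RR 4 → RR 4 := fun t => Q (u t, g' (t - t₀))
  have hFd : ∀ t, ∀ A', HasFDerivAt u A' t → HasFDerivAt F (Q.comp (A'.prod g')) t := by
    intro t A' hA'
    have h1 : HasFDerivAt (fun t => g' (t - t₀)) g' t := by
      simpa using g'.hasFDerivAt.comp t ((hasFDerivAt_id t).sub_const t₀)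
    exact Q.hasFDerivAt.comp t (hA'.prodMk h1)
  have hinj : Function.Injective (Q.comp (A.prod g') : RR 4 →ₗ[ℝ] RR 4) := by
    rw [← LinearMap.ker_eq_bot, LinearMap.ker_eq_bot']
    intro v hv
    have h1 : (A v, g' v) = 0 := hQinj _ hv
    have h2 : A v = 0 := congrArg Prod.fst h1
    have h3 : g v = 0 := congrArg Prod.snd h1
    have h4 : e ⟨v, h2⟩ = 0 := by
      rw [← h3]
      exact (LinearMap.congr_fun hg ⟨v, h2⟩).symm
    have h5 := (LinearEquiv.map_eq_zero_iff e).1 h4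
    exact congrArg Subtype.val h5
  let E : RR 4 ≃L[ℝ] RR 4 :=
    (LinearEquiv.ofInjectiveEndo (Q.comp (A.prod g') : RR 4 →ₗ[ℝ] RR 4) hinj).toContinuousLinearEquiv
  have hE : (E : RR 4 →L[ℝ] RR 4) = Q.comp (A.prod g') := by
    ext1 v
    rfl
  have hut₀ : HasFDerivAt u A t₀ :=
    ((hu.contDiffAt (hV.mem_nhds ht₀)).differentiableAt (by simp)).hasFDerivAt
  have hFsm : ContDiffOn ℝ ∞ F V := by
    have h1 : ContDiff ℝ ∞ fun t => g' (t - t₀) := g'.contDiff.comp (contDiff_id.sub contDiff_const)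
    exact Q.contDiff.comp_contDiffOn (hu.prodMk h1.contDiffOn)
  have hFt : ContDiffAt ℝ ∞ F t₀ := hFsm.contDiffAt (hV.mem_nhds ht₀)
  have hFt' : HasFDerivAt F (E : RR 4 →L[ℝ] RR 4) t₀ := by
    rw [hE]
    exact hFd _ _ hut₀
  let θ₀ := hFt.toOpenPartialHomeomorph F hFt' (by simp)
  have hθ₀ : ∀ t, θ₀ t = F t := fun t => rfl
  -- Restricting to points where the differential is invertible makes the inverse smooth on the
  -- whole target, not just near the centre.
  let W : Set (RR 4) := V ∩ (fderiv ℝ F) ⁻¹' (range ((↑) : (RR 4 ≃L[ℝ] RR 4) → RR 4 →L[ℝ] RR 4))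
  have hW : IsOpen W := by
    have : ContinuousOn (fderiv ℝ F) V :=
      (hFsm.fderiv_of_isOpen hV (m := 0) (by simp)).continuousOn
    exact this.isOpen_inter_preimage hV ContinuousLinearEquiv.isOpen
  let θ := θ₀.restrOpen W hW
  have hθs : θ.source = θ₀.source ∩ W := θ₀.restrOpen_source W hW
  have hθ : ∀ t, θ t = F t := fun t => rfl
  refine ⟨θ, ?_, ?_, ?_, ?_, ?_, ?_⟩
  · rw [hθs]
    refine ⟨hFt.mem_toOpenPartialHomeomorph_source hFt' (by simp), ht₀, E, ?_⟩
    exact hFt'.fderiv.symm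
  · rw [hθs]
    exact fun t ht => ht.2.1
  · rw [hθ]
    change Q (u t₀, g' (t₀ - t₀)) = 0
    rw [h0, sub_self, map_zero]
    exact map_zero Q
  · refine hFsm.mono ?_
    rw [hθs]
    exact fun t ht => ht.2.1
  · intro y hy
    have hm : θ.symm y ∈ θ.source := θ.map_target hy
    rw [hθs] at hm
    obtain ⟨E', hE'⟩ := hm.2.2
    refine (θ.contDiffAt_symm (f₀' := E') hy ?_ ?_).contDiffWithinAt
    · rw [hE']
      exact ((hFsm.contDiffAt (hV.mem_nhds hm.2.1)).differentiableAt (by simp)).hasFDerivAt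
    · exact hFsm.contDiffAt (hV.mem_nhds hm.2.1)
  · intro t _
    rw [hθ]
    apply Complex.ext
    · rw [tauC_re]
      simp [F, hQ]
    · rw [tauC_im]
      simp [F, hQ]

end AdaptedChart

/-! ### Local integrability of reciprocals of submersions -/

section LocalIntegrability

theorem integrableOn_abs_rpow_neg {s : ℝ} (hs : s < 1) (R : ℝ) :
    IntegrableOn (fun x : ℝ => |x| ^ (-s)) (Icc (-R) R) := by
  rcases lt_or_ge R 0 with hR | hR
  · rw [Icc_eq_empty (by linarith)]
    exact integrableOn_empty
  have h1 : IntervalIntegrable (fun x : ℝ => |x| ^ (-s)) volume 0 R := by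
    refine (intervalIntegral.intervalIntegrable_rpow' (a := 0) (b := R) (r := -s)
      (by linarith)).congr fun x hx => ?_
    rw [uIoc_of_le hR] at hx
    simp [abs_of_pos hx.1]
  have h2 : IntervalIntegrable (fun x : ℝ => |x| ^ (-s)) volume (-R) 0 := by
    have := ((IntervalIntegrable.iff_comp_neg (by simp)).1 h1).symm
    simpa using this
  have h3 := h2.trans h1
  rw [intervalIntegrable_iff_integrableOn_Icc_of_le (by linarith)] at h3
  exact h3

theorem ae_coord_ne_zero (i : Fin 4) : ∀ᵐ y : RR 4, y i ≠ 0 := by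
  have h := Measure.ae_eval_ne (fun _ : Fin 4 => (volume : Measure ℝ)) i 0
  exact (PiLp.volume_preserving_ofLp (Fin 4)).quasiMeasurePreserving.ae h

theorem ae_tauC_ne_zero : ∀ᵐ y : RR 4, tauC y ≠ 0 := by
  filter_upwards [ae_coord_ne_zero 0] with y hy h
  rw [← tauC_re, h] at hy
  simp at hy

/-- From |y₀||y₁| ≤ |τ|² one gets |τ|^(-q) ≤ |y₀|^(-q/2) |y₁|^(-q/2), a product of one-variable
functions that are locally integrable because q/2 < 1. -/
theorem integrableOn_tauC_rpow_neg {q : ℝ} (hq0 : 0 ≤ q) (hq : q < 2) (R : ℝ) :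
    IntegrableOn (fun y : RR 4 => ‖tauC y‖ ^ (-q)) (Metric.ball 0 R) := by
  let g : Fin 4 → ℝ → ℝ := fun i => (Icc (-R) R).indicator
    (![fun x => |x| ^ (-(q / 2)), fun x => |x| ^ (-(q / 2)), fun _ => 1, fun _ => 1] i)
  have hg : ∀ i, Integrable (g i) := by
    intro i
    refine (integrable_indicator_iff measurableSet_Icc).2 ?_
    fin_cases i
    · exact integrableOn_abs_rpow_neg (by linarith) R
    · exact integrableOn_abs_rpow_neg (by linarith) R
    · exact integrableOn_const (by simp)
    · exact integrableOn_const (by simp)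
  have hprod : Integrable (fun x : Fin 4 → ℝ => ∏ i, g i (x i)) (volume : Measure (Fin 4 → ℝ)) :=
    Integrable.fintype_prod hg
  have hprod' : Integrable (fun y : RR 4 => ∏ i, g i (y i)) :=
    (PiLp.volume_preserving_ofLp (Fin 4)).integrable_comp_of_integrable hprod
  refine Integrable.mono' hprod'.integrableOn ?_ ?_
  · exact ((tauC.continuous.norm).measurable.pow_const (-q)).aestronglyMeasurable
  · rw [ae_restrict_iff' measurableSet_ball]
    filter_upwards [ae_coord_ne_zero 0, ae_coord_ne_zero 1] with y h0 h1 hy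
    have hyi : ∀ i, y i ∈ Icc (-R) R := by
      intro i
      rw [mem_Icc, ← abs_le]
      have h2 : ‖y i‖ ≤ ‖y‖ := PiLp.norm_apply_le y i
      rw [mem_ball_zero_iff] at hy
      exact (Real.norm_eq_abs _ ▸ h2).trans hy.le
    have hgi : ∀ i, g i (y i) =
        (![fun x => |x| ^ (-(q / 2)), fun x => |x| ^ (-(q / 2)), fun _ => 1, fun _ => 1] :
          Fin 4 → ℝ → ℝ) i (y i) := fun i => indicator_of_mem (hyi i) _
    have hg4 : ∏ i, g i (y i) = |y 0| ^ (-(q / 2)) * |y 1| ^ (-(q / 2)) := by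
      rw [Fin.prod_univ_four, hgi, hgi, hgi, hgi]
      simp
    rw [hg4, Real.norm_of_nonneg (by positivity), ← Real.mul_rpow (abs_nonneg _) (abs_nonneg _)]
    have hsq : |y 0| * |y 1| ≤ ‖tauC y‖ ^ 2 := by
      rw [Complex.sq_norm, Complex.normSq_apply, tauC_re, tauC_im]
      nlinarith [sq_nonneg (|y 0| - |y 1|), sq_abs (y 0), sq_abs (y 1), abs_nonneg (y 0),
        abs_nonneg (y 1), mul_nonneg (abs_nonneg (y 0)) (abs_nonneg (y 1))]
    have hpos : 0 < |y 0| * |y 1| := mul_pos (abs_pos.2 h0) (abs_pos.2 h1)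
    calc ‖tauC y‖ ^ (-q) = (‖tauC y‖ ^ 2) ^ (-(q / 2)) := by
          rw [← Real.rpow_natCast, ← Real.rpow_mul (norm_nonneg _)]
          congr 1
          push_cast
          ring
      _ ≤ (|y 0| * |y 1|) ^ (-(q / 2)) :=
          Real.rpow_le_rpow_of_nonpos hpos hsq (by linarith)

/-- If `0` is a regular value of `u`, then `|u|^{-q}` is locally integrable for `q < 2`. -/
theorem locallyIntegrableOn_norm_rpow_neg {V : Set (RR 4)} (hV : IsOpen V) {u : RR 4 → ℂ}
    (hu : ContDiffOn ℝ ∞ u V) (hs : ∀ t ∈ V, u t = 0 → Function.Surjective (fderiv ℝ u t)) {q : ℝ}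
    (hq0 : 0 ≤ q) (hq : q < 2) : LocallyIntegrableOn (fun t => ‖u t‖ ^ (-q)) V := by
  intro t₀ ht₀
  by_cases h0 : u t₀ = 0
  -- A chart straightens u to y₀ + iy₁, and the change of variables contributes only a Jacobian that
  -- is bounded on a small closed ball.
  · obtain ⟨θ, hθt, hθV, hθ0, hθ, hθ', hθu⟩ := exists_adapted_chart hV hu ht₀ h0 (hs t₀ ht₀ h0)
    have h0T : (0 : RR 4) ∈ θ.target := hθ0 ▸ θ.map_source hθt
    obtain ⟨r, hr, hrT⟩ := Metric.nhds_basis_closedBall.mem_iff.1 (θ.open_target.mem_nhds h0T)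
    have hball : Metric.ball 0 r ⊆ θ.target := Metric.ball_subset_closedBall.trans hrT
    refine ⟨θ.symm '' Metric.ball 0 r, ?_, ?_⟩
    · refine mem_nhdsWithin_of_mem_nhds ((θ.symm.isOpen_image_of_subset_source Metric.isOpen_ball
        hball).mem_nhds ⟨0, Metric.mem_ball_self hr, ?_⟩)
      rw [← hθ0, θ.left_inv hθt]
    · have hder : ∀ y ∈ Metric.ball (0 : RR 4) r, HasFDerivWithinAt θ.symm (fderiv ℝ θ.symm y)
          (Metric.ball 0 r) y := fun y hy =>
        ((hθ'.contDiffAt (θ.open_target.mem_nhds (hball hy))).differentiableAt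
          (by simp)).hasFDerivAt.hasFDerivWithinAt
      rw [integrableOn_image_iff_integrableOn_abs_det_fderiv_smul volume measurableSet_ball hder
        (θ.symm.injOn.mono hball)]
      have hcont : ContinuousOn (fun y => |(fderiv ℝ θ.symm y).det|) (Metric.closedBall 0 r) := by
        have h1 : ContinuousOn (fderiv ℝ θ.symm) θ.target :=
          (hθ'.fderiv_of_isOpen θ.open_target (m := 0) (by simp)).continuousOn
        exact (ContinuousLinearMap.continuous_det.comp_continuousOn (h1.mono hrT)).abs
      have h2 := (integrableOn_tauC_rpow_neg hq0 hq r).continuousOn_mul_of_subset hcont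
        (isCompact_closedBall 0 r) measurableSet_ball Metric.ball_subset_closedBall
      refine h2.congr_fun (fun y hy => ?_) measurableSet_ball
      change _ = |(fderiv ℝ θ.symm y).det| * ‖u (θ.symm y)‖ ^ (-q)
      rw [← hθu _ (θ.map_target (hball hy)), θ.right_inv (hball hy)]
  · have hop : IsOpen (V ∩ u ⁻¹' {0}ᶜ) := hu.continuousOn.isOpen_inter_preimage hV
      isClosed_singleton.isOpen_compl
    have hc : ContinuousOn (fun t => ‖u t‖ ^ (-q)) (V ∩ u ⁻¹' {0}ᶜ) :=
      ((hu.continuousOn.mono inter_subset_left).norm).rpow_const fun t ht =>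
        Or.inl (norm_ne_zero_iff.2 ht.2)
    obtain ⟨W, hW, hWi⟩ := hc.locallyIntegrableOn (μ := volume) hop.measurableSet t₀ ⟨ht₀, h0⟩
    rw [hop.nhdsWithin_eq ⟨ht₀, h0⟩] at hW
    exact ⟨W, mem_nhdsWithin_of_mem_nhds hW, hWi⟩

theorem memLp_inv_of_regular {V : Set (RR 4)} (hV : IsOpen V) {u : RR 4 → ℂ}
    (hu : ContDiffOn ℝ ∞ u V) (hs : ∀ t ∈ V, u t = 0 → Function.Surjective (fderiv ℝ u t))
    {p : ℝ≥0∞} (hp1 : 1 ≤ p) (hp2 : p < 2) {K : Set (RR 4)} (hKV : K ⊆ V) (hK : IsCompact K) :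
    MemLp (fun t => (u t)⁻¹) p (volume.restrict K) := by
  have hptop : p ≠ ⊤ := (hp2.trans (by simp)).ne
  have hp0 : p ≠ 0 := (zero_lt_one.trans_le hp1).ne'
  have hq : p.toReal < 2 := by
    have := (ENNReal.toReal_lt_toReal hptop (by simp)).2 hp2
    simpa using this
  have hmeas : AEStronglyMeasurable (fun t => (u t)⁻¹) (volume.restrict K) :=
    ((hu.continuousOn.mono hKV).aestronglyMeasurable hK.measurableSet).aemeasurable.inv
      |>.aestronglyMeasurable
  rw [← integrable_norm_rpow_iff hmeas hp0 hptop]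
  have := (locallyIntegrableOn_norm_rpow_neg hV hu hs ENNReal.toReal_nonneg
    hq).integrableOn_compact_subset hKV hK
  refine this.congr (ae_of_all _ fun t => ?_)
  change ‖u t‖ ^ (-p.toReal) = ‖(u t)⁻¹‖ ^ p.toReal
  rw [norm_inv, Real.inv_rpow (norm_nonneg _), Real.rpow_neg (norm_nonneg _)]

end LocalIntegrability

/-! ### The reciprocal of a defining function is not CR across its zero set -/

section NotCR

/-- If `ℓ` does not vanish on the complex tangent space of a generic immersion, then
`conj ℓ ∧ dz₁ ∧ dz₂ ∧ dz₃` does not vanish. -/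
theorem dbarWedge_conj_ne_zero {Φ : RR 4 → C3} {t : RR 4} {ℓ : C3 →L[ℂ] ℂ}
    (hgen : ∀ m : C3 →ₗ[ℂ] ℂ, (∀ v, m (fderiv ℝ Φ t v) = 0) → m = 0) {v w : RR 4}
    (hvw : fderiv ℝ Φ t w = Complex.I • fderiv ℝ Φ t v) (hv : ℓ (fderiv ℝ Φ t v) ≠ 0) :
    dbarWedge Φ t ((Complex.conjCLE : ℂ →L[ℝ] ℂ).comp
      ((ℓ.restrictScalars ℝ).comp (fderiv ℝ Φ t))) ≠ 0 := by
  intro hdet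
  -- A zero determinant gives a relation c₀ conj ℓ + m = 0 on the tangent space with m complex
  -- linear. Evaluating on a vector and on i times it separates the antilinear part from the linear
  -- one, so c₀ = 0; genericity then forces m = 0.
  obtain ⟨c, hc0, hc⟩ := Matrix.exists_vecMul_eq_zero_iff.2 hdet
  let m : C3 →ₗ[ℂ] ℂ := ∑ i : Fin 3, c i.succ • LinearMap.proj i
  have hm : ∀ z, m z = c 1 * z 0 + c 2 * z 1 + c 3 * z 2 := fun z => by
    simp [m, Fin.sum_univ_three]
  let L : RR 4 →L[ℝ] C3 := fderiv ℝ Φ t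
  have hbasis : ∀ j : Fin 4, c 0 * (starRingEnd ℂ) (ℓ (L (EuclideanSpace.single j 1))) +
      m (L (EuclideanSpace.single j 1)) = 0 := by
    intro j
    have h := congrFun hc j
    simp only [Matrix.vecMul, dotProduct, Fin.sum_univ_four, Pi.zero_apply] at h
    simp only [Matrix.of_apply, Matrix.cons_val] at h
    rw [hm]
    rw [← h]
    simp only [ContinuousLinearMap.comp_apply, ContinuousLinearMap.coe_restrictScalars',
      ContinuousLinearEquiv.coe_coe, Complex.conjCLE_apply, L]
    ring
  have hall : ∀ x : RR 4, c 0 * (starRingEnd ℂ) (ℓ (L x)) + m (L x) = 0 := by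
    intro x
    have hx : x = ∑ j, x j • EuclideanSpace.single j (1 : ℝ) := by
      ext i
      simp [Finset.sum_apply, Pi.single_apply]
    have h1 : ℓ (L x) = ∑ j, (x j : ℂ) * ℓ (L (EuclideanSpace.single j 1)) := by
      conv_lhs => rw [hx]
      simp only [map_sum, map_smul]
      refine Finset.sum_congr rfl fun j _ => ?_
      have := ℓ.map_smul (x j : ℂ) (L (EuclideanSpace.single j 1))
      rw [smul_eq_mul] at this
      rw [← this]
      rfl
    have h2 : m (L x) = ∑ j, (x j : ℂ) * m (L (EuclideanSpace.single j 1)) := by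
      conv_lhs => rw [hx]
      simp only [map_sum, map_smul]
      refine Finset.sum_congr rfl fun j _ => ?_
      have := m.map_smul (x j : ℂ) (L (EuclideanSpace.single j 1))
      rw [smul_eq_mul] at this
      rw [← this]
      rfl
    rw [h1, h2, map_sum, Finset.mul_sum, ← Finset.sum_add_distrib]
    refine Finset.sum_eq_zero fun j _ => ?_
    rw [map_mul, Complex.conj_ofReal]
    linear_combination (x j : ℂ) * hbasis j
  have h1 := hall v
  have h2 := hall w
  rw [show L w = Complex.I • L v from hvw, ℓ.map_smul, m.map_smul, smul_eq_mul, smul_eq_mul, map_mul,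
    Complex.conj_I] at h2
  have h3 : c 0 * (starRingEnd ℂ) (ℓ (L v)) = 0 := by
    linear_combination (1 / 2 : ℂ) * h1 + (Complex.I / 2) * h2 +
      (1 / 2 : ℂ) * (c 0 * (starRingEnd ℂ) (ℓ (L v)) - m (L v)) * Complex.I_sq
  have hc00 : c 0 = 0 := by
    rcases mul_eq_zero.1 h3 with h | h
    · exact h
    · exact absurd ((map_eq_zero _).1 h) hv
  have hm0 : m = 0 := hgen m fun x => by
    have := hall x
    rw [hc00, zero_mul, zero_add] at this
    exact this
  apply hc0
  have hmi : ∀ i : Fin 3, c i.succ = 0 := by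
    intro i
    have := LinearMap.congr_fun hm0 (Pi.single i 1)
    rw [hm] at this
    fin_cases i <;> simpa using this
  ext i
  refine Fin.cases hc00 hmi i

theorem continuousOn_dbarWedge {Φ : RR 4 → C3} {V : Set (RR 4)} (hV : IsOpen V)
    (hΦ : ContDiffOn ℝ ∞ Φ V) {ℓ : RR 4 → RR 4 →L[ℝ] ℂ} (hℓ : Continuous ℓ) :
    ContinuousOn (fun t => dbarWedge Φ t (ℓ t)) V := by
  have h1 : ContinuousOn (fderiv ℝ Φ) V := (hΦ.fderiv_of_isOpen hV (m := 0) (by simp)).continuousOn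
  have h2 : ∀ (j : Fin 4) (i : Fin 3),
      ContinuousOn (fun t => fderiv ℝ Φ t (EuclideanSpace.single j 1) i) V := fun j i =>
    (continuous_apply i).comp_continuousOn (h1.clm_apply continuousOn_const)
  have h3 : ∀ j : Fin 4, ContinuousOn (fun t => ℓ t (EuclideanSpace.single j 1)) V := fun j =>
    (hℓ.clm_apply continuous_const).continuousOn
  have h4 : ∀ k l n : Fin 4, ContinuousOn (fun t => minorThree
      (fun j : Fin 4 => fderiv ℝ Φ t (EuclideanSpace.single j 1) 0)
      (fun j : Fin 4 => fderiv ℝ Φ t (EuclideanSpace.single j 1) 1)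
      (fun j : Fin 4 => fderiv ℝ Φ t (EuclideanSpace.single j 1) 2) k l n) V := by
    intro k l n
    simp only [minorThree]
    exact (((h2 k 0).mul (((h2 l 1).mul (h2 n 2)).sub ((h2 n 1).mul (h2 l 2)))).sub
      ((h2 l 0).mul (((h2 k 1).mul (h2 n 2)).sub ((h2 n 1).mul (h2 k 2))))).add
      ((h2 n 0).mul (((h2 k 1).mul (h2 l 2)).sub ((h2 l 1).mul (h2 k 2))))
  simp only [dbarWedge, det_four_eq]
  exact ((((h3 0).mul (h4 1 2 3)).sub ((h3 1).mul (h4 0 2 3))).add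
    ((h3 2).mul (h4 0 1 3))).sub ((h3 3).mul (h4 0 1 2))

/-- The conjugate complex coordinate `y₀ - i y₁`. -/
noncomputable def tauBar : RR 4 →L[ℝ] ℂ := (Complex.conjCLE : ℂ →L[ℝ] ℂ).comp tauC

theorem tauC_mul_tauBar (y : RR 4) : tauC y * tauBar y = ((‖tauC y‖ ^ 2 : ℝ) : ℂ) := by
  have : tauBar y = (starRingEnd ℂ) (tauC y) := rfl
  rw [this, Complex.mul_conj, Complex.sq_norm]

/-- The Gaussian `exp (-N² |y₀ + i y₁|²)`. -/
noncomputable def gaussTau (N : ℝ) (y : RR 4) : ℂ := Complex.exp (-(N : ℂ) ^ 2 * (tauC y * tauBar y))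

theorem gaussTau_eq (N : ℝ) (y : RR 4) :
    gaussTau N y = (Real.exp (-(N ^ 2 * ‖tauC y‖ ^ 2)) : ℂ) := by
  rw [gaussTau, tauC_mul_tauBar]
  push_cast
  ring_nf

theorem contDiff_gaussTau (N : ℝ) : ContDiff ℝ ∞ (gaussTau N) :=
  (contDiff_const.mul (tauC.contDiff.mul tauBar.contDiff)).cexp

theorem hasFDerivAt_gaussTau (N : ℝ) (y : RR 4) :
    HasFDerivAt (gaussTau N)
      ((gaussTau N y * -(N : ℂ) ^ 2 * tauC y) • tauBar +
        (gaussTau N y * -(N : ℂ) ^ 2 * tauBar y) • tauC) y := by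
  have h := ((tauC.hasFDerivAt (x := y)).fun_mul (tauBar.hasFDerivAt (x := y))).const_mul
    (-(N : ℂ) ^ 2) |>.cexp
  refine h.congr_fderiv ?_
  rw [smul_add, smul_add, smul_smul, smul_smul, smul_smul, smul_smul]
  simp only [gaussTau, mul_assoc]

theorem norm_gaussTau_le (N : ℝ) (y : RR 4) : ‖gaussTau N y‖ ≤ 1 := by
  rw [gaussTau_eq, Complex.norm_real, Real.norm_of_nonneg (Real.exp_pos _).le]
  exact Real.exp_le_one_iff.2 (by have := mul_nonneg (sq_nonneg N) (sq_nonneg ‖tauC y‖); linarith)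

theorem tendsto_gaussTau {y : RR 4} (hy : tauC y ≠ 0) :
    Tendsto (fun n : ℕ => gaussTau (n + 1 : ℝ) y) atTop (𝓝 0) := by
  rw [tendsto_zero_iff_norm_tendsto_zero]
  have h1 : Tendsto (fun n : ℕ => (n + 1 : ℝ) ^ 2 * ‖tauC y‖ ^ 2) atTop atTop := by
    refine Tendsto.atTop_mul_const (by positivity) ?_
    exact (tendsto_pow_atTop two_ne_zero).comp
      (tendsto_atTop_add_const_right _ _ tendsto_natCast_atTop_atTop)
  have h2 := Real.tendsto_exp_neg_atTop_nhds_zero.comp h1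
  refine h2.congr fun n => ?_
  rw [gaussTau_eq, Complex.norm_real, Real.norm_of_nonneg (Real.exp_pos _).le]
  rfl

theorem integrableOn_tauC_inv (r : ℝ) :
    IntegrableOn (fun y : RR 4 => (tauC y)⁻¹) (Metric.closedBall 0 r) := by
  have h := (integrableOn_tauC_rpow_neg (q := 1) (by norm_num) (by norm_num) (r + 1)).mono_set
    (Metric.closedBall_subset_ball (by linarith : r < r + 1))
  refine Integrable.mono' h ?_ (ae_of_all _ fun y => ?_)
  · exact (tauC.continuous.measurable.inv).aestronglyMeasurable
  · rw [norm_inv, Real.rpow_neg_one]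

/-- A box in which the Gaussian `gaussTau N` is bounded below. -/
def gaussBox (N c : ℝ) : Set (RR 4) :=
  WithLp.ofLp ⁻¹' Icc (-![c / N, c / N, c, c]) ![c / N, c / N, c, c]

theorem measurableSet_gaussBox (N c : ℝ) : MeasurableSet (gaussBox N c) :=
  (PiLp.volume_preserving_ofLp (Fin 4)).measurable measurableSet_Icc

/-- The box shrinks like 1/N in the two directions transverse to the zero set only. The resulting
N⁻² exactly balances the factor N² produced by differentiating the Gaussian. -/
theorem volume_gaussBox {N c : ℝ} (hN : 0 < N) (hc : 0 < c) :
    volume.real (gaussBox N c) = 16 * c ^ 4 / N ^ 2 := by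
  rw [gaussBox, measureReal_def, (PiLp.volume_preserving_ofLp (Fin 4)).measure_preimage
    measurableSet_Icc.nullMeasurableSet, Real.volume_Icc_pi_toReal]
  · simp [Fin.prod_univ_four]
    field_simp
    ring
  · intro i
    have : 0 < c / N := by positivity
    fin_cases i <;> simp <;> linarith

theorem abs_le_of_mem_gaussBox {N c : ℝ} {y : RR 4} (hy : y ∈ gaussBox N c) :
    |y 0| ≤ c / N ∧ |y 1| ≤ c / N ∧ |y 2| ≤ c ∧ |y 3| ≤ c := by
  have h1 : ∀ i, -(![c / N, c / N, c, c] : Fin 4 → ℝ) i ≤ y i := fun i => hy.1 i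
  have h2 : ∀ i, y i ≤ (![c / N, c / N, c, c] : Fin 4 → ℝ) i := fun i => hy.2 i
  exact ⟨abs_le.2 ⟨h1 0, h2 0⟩, abs_le.2 ⟨h1 1, h2 1⟩, abs_le.2 ⟨h1 2, h2 2⟩, abs_le.2 ⟨h1 3, h2 3⟩⟩

theorem gaussBox_subset {N c : ℝ} (hN : 1 ≤ N) (hc : 0 < c) :
    gaussBox N c ⊆ Metric.closedBall 0 (2 * c) := by
  intro y hy
  obtain ⟨h0, h1, h2, h3⟩ := abs_le_of_mem_gaussBox hy
  have hcN : c / N ≤ c := div_le_self hc.le hN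
  rw [mem_closedBall_zero_iff, EuclideanSpace.norm_eq, Fin.sum_univ_four]
  refine Real.sqrt_le_iff.2 ⟨by positivity, ?_⟩
  simp only [Real.norm_eq_abs]
  have h : ∀ x : ℝ, |x| ≤ c → |x| ^ 2 ≤ c ^ 2 := fun x hx => pow_le_pow_left₀ (abs_nonneg x) hx 2
  nlinarith [h _ (h0.trans hcN), h _ (h1.trans hcN), h _ h2, h _ h3]

theorem le_gaussTau_of_mem_gaussBox {N c : ℝ} (hN : 0 < N) {y : RR 4}
    (hy : y ∈ gaussBox N c) :
    Real.exp (-(2 * c ^ 2)) ≤ Real.exp (-(N ^ 2 * ‖tauC y‖ ^ 2)) := by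
  obtain ⟨h0, h1, -, -⟩ := abs_le_of_mem_gaussBox hy
  refine Real.exp_le_exp.2 (neg_le_neg ?_)
  rw [Complex.sq_norm, Complex.normSq_apply, tauC_re, tauC_im]
  have h : ∀ x : ℝ, |x| ≤ c / N → N ^ 2 * (x * x) ≤ c ^ 2 := by
    intro x hx
    have h1 : N * |x| ≤ c := by
      rw [le_div_iff₀ hN] at hx
      linarith
    have h2 : (N * |x|) ^ 2 ≤ c ^ 2 := pow_le_pow_left₀ (by positivity) h1 2
    rw [mul_pow, sq_abs] at h2
    linarith
  nlinarith [h _ h0, h _ h1]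

end NotCR

/-! ### Testing the reciprocal against Gaussians -/

section NotCR

/-- In coordinates with `h ∘ Φ = y₀ + i y₁`, the distribution `∂̄ (1 / h)` is a nonzero multiple of
the current of integration over `h = 0`. -/
theorem exists_integral_inv_mul_dbarForm_ne_zero {Φ : RR 4 → C3} {V : Set (RR 4)} (hV : IsOpen V)
    (h0V : (0 : RR 4) ∈ V) (hΦ : ContDiffOn ℝ ∞ Φ V) {h : C3 → ℂ} (hh : Differentiable ℂ h)
    (hτ : ∀ y ∈ V, h (Φ y) = tauC y) (hD : dbarWedge Φ 0 tauBar ≠ 0) :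
    ∃ G : RR 4 → ℂ, ContDiff ℝ ∞ G ∧ HasCompactSupport G ∧ tsupport G ⊆ V ∧
      ∫ y in V, (h (Φ y))⁻¹ * dbarForm Φ G y ≠ 0 := by
  set D : RR 4 → ℂ := fun y => dbarWedge Φ y tauBar with hDdef
  have hDc : ContinuousOn D V := continuousOn_dbarWedge hV hΦ continuous_const
  have hev : ∀ᶠ y in 𝓝 (0 : RR 4), 1 / 2 < (D y * (D 0)⁻¹).re := by
    have h1 : ContinuousAt (fun y => (D y * (D 0)⁻¹).re) 0 :=
      Complex.continuous_re.continuousAt.comp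
        ((hDc.continuousAt (hV.mem_nhds h0V)).mul continuousAt_const)
    refine h1.eventually (lt_mem_nhds ?_)
    change 1 / 2 < (D 0 * (D 0)⁻¹).re
    rw [mul_inv_cancel₀ hD]
    norm_num
  obtain ⟨r, hr, hrV⟩ := Metric.nhds_basis_closedBall.mem_iff.1
    (inter_mem (hV.mem_nhds h0V) hev)
  set K : Set (RR 4) := Metric.closedBall 0 r with hK
  have hKc : IsCompact K := isCompact_closedBall 0 r
  have hKV : K ⊆ V := fun y hy => (hrV hy).1
  have hKD : ∀ y ∈ K, 1 / 2 < (D y * (D 0)⁻¹).re := fun y hy => (hrV hy).2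
  let b : ContDiffBump (0 : RR 4) := ⟨r / 2, r, by positivity, by linarith⟩
  let η : RR 4 → ℂ := fun y => (b y : ℂ)
  have hη : ContDiff ℝ ∞ η := Complex.ofRealCLM.contDiff.comp b.contDiff
  have hηt : tsupport η = K := by
    have : Function.support η = Function.support b := by
      ext y
      simp [η]
    rw [tsupport, this]
    exact b.tsupport_eq
  let B : RR 4 → ℂ := fun y => dbarForm Φ η y
  have hBc : ContinuousOn B K := (continuousOn_dbarWedge hV hΦ
    (hη.continuous_fderiv (by simp))).mono hKV
  -- If all integrals against test functions vanished, then so would those for a cutoff times a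
  -- Gaussian concentrating on the zero set.
  let G : ℝ → RR 4 → ℂ := fun N y => gaussTau N y * η y
  have hGs : ∀ N, ContDiff ℝ ∞ (G N) := fun N => (contDiff_gaussTau N).mul hη
  have hGt : ∀ N, tsupport (G N) ⊆ K := fun N => hηt ▸ tsupport_mul_subset_right
  have hGc : ∀ N, HasCompactSupport (G N) := fun N =>
    hKc.of_isClosed_subset (isClosed_tsupport _) (hGt N)
  by_contra hcon
  push Not at hcon
  -- Differentiating the Gaussian gives a tauBar term and a tauC term. The latter wedges to zero
  -- because tauC is dh in these coordinates; the former carries a factor tauC that cancels 1/h.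
  have hform : ∀ N, ∀ y ∈ K, dbarForm Φ (G N) y =
      gaussTau N y * B y - (N : ℂ) ^ 2 * (η y * gaussTau N y * tauC y * D y) := by
    intro N y hy
    have h1 : HasFDerivAt (G N) _ y :=
      (hasFDerivAt_gaussTau N y).fun_mul (hη.differentiable (by simp) y).hasFDerivAt
    have h2 : tauC = ((fderiv ℂ h (Φ y)).restrictScalars ℝ).comp (fderiv ℝ Φ y) := by
      have h3 : HasFDerivAt (fun y => h (Φ y))
          (((fderiv ℂ h (Φ y)).restrictScalars ℝ).comp (fderiv ℝ Φ y)) y :=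
        ((hh (Φ y)).hasFDerivAt.restrictScalars ℝ).comp y
          ((hΦ.contDiffAt (hV.mem_nhds (hKV hy))).differentiableAt (by simp)).hasFDerivAt
      have h4 : HasFDerivAt (fun y => h (Φ y)) tauC y := by
        refine tauC.hasFDerivAt.congr_of_eventuallyEq ?_
        filter_upwards [hV.mem_nhds (hKV hy)] with x hx
        exact hτ x hx
      exact h4.unique h3
    have h5 : dbarWedge Φ y tauC = 0 := by
      rw [h2]
      exact dbarWedge_comp_eq_zero _ _ _
    rw [dbarForm_eq_dbarWedge, h1.fderiv, dbarWedge_add, dbarWedge_smul, dbarWedge_smul,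
      dbarWedge_add, dbarWedge_smul, dbarWedge_smul, h5]
    change gaussTau N y * B y + η y * (gaussTau N y * -(N : ℂ) ^ 2 * tauC y * D y +
      gaussTau N y * -(N : ℂ) ^ 2 * tauBar y * 0) = _
    ring
  have hgc : ∀ N, ContinuousOn (gaussTau N) K := fun N =>
    (contDiff_gaussTau N).continuous.continuousOn
  have hint2 : ∀ N, IntegrableOn (fun y => gaussTau N y * B y * (tauC y)⁻¹) K := fun N =>
    (integrableOn_tauC_inv r).continuousOn_mul ((hgc N).mul hBc) hKc
  have hint1 : ∀ N : ℝ, IntegrableOn (fun y => (N : ℂ) ^ 2 * (η y * gaussTau N y * D y)) K :=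
    fun N => (continuousOn_const.mul ((hη.continuous.continuousOn.mul (hgc N)).mul
      (hDc.mono hKV))).integrableOn_compact hKc
  have heq : ∀ N : ℝ, ∫ y in K, (N : ℂ) ^ 2 * (η y * gaussTau N y * D y) =
      ∫ y in K, gaussTau N y * B y * (tauC y)⁻¹ := by
    intro N
    have h1 := hcon (G N) (hGs N) (hGc N) ((hGt N).trans hKV)
    rw [setIntegral_eq_of_subset_of_forall_sdiff_eq_zero (t := V) (s := K) hV.measurableSet hKV
      (fun y hy => by
        rw [dbarForm_eq_zero_of_notMem_tsupport fun h => hy.2 (hGt N h), mul_zero])] at h1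
    have h2 : ∫ y in K, (h (Φ y))⁻¹ * dbarForm Φ (G N) y =
        ∫ y in K, (gaussTau N y * B y * (tauC y)⁻¹ - (N : ℂ) ^ 2 * (η y * gaussTau N y * D y)) := by
      refine setIntegral_congr_ae hKc.measurableSet ?_
      filter_upwards [ae_tauC_ne_zero] with y hy hyK
      rw [hτ y (hKV hyK), hform N y hyK]
      field_simp
    rw [h2, integral_sub (hint2 N) (hint1 N), sub_eq_zero] at h1
    exact h1.symm
  -- The cutoff term tends to zero: the Gaussians are at most 1 and converge to 0 off the null set
  -- tauC = 0, and 1/tauC is integrable.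
  have hlim : Tendsto (fun n : ℕ => ∫ y in K, gaussTau (n + 1 : ℝ) y * B y * (tauC y)⁻¹) atTop
      (𝓝 0) := by
    have h1 : Tendsto (fun n : ℕ => ∫ y in K, gaussTau (n + 1 : ℝ) y * B y * (tauC y)⁻¹) atTop
        (𝓝 (∫ y in K, (0 : ℂ))) := by
      refine tendsto_integral_of_dominated_convergence (fun y => ‖B y * (tauC y)⁻¹‖)
        (fun n => (hint2 _).aestronglyMeasurable)
        ((integrableOn_tauC_inv r).continuousOn_mul hBc hKc).norm ?_ ?_
      · refine fun n => ae_of_all _ fun y => ?_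
        rw [mul_assoc, norm_mul]
        exact mul_le_of_le_one_left (norm_nonneg _) (norm_gaussTau_le _ _)
      · refine ae_of_all _ fun y => ?_
        by_cases hy : tauC y = 0
        · simp [hy]
        · simp_rw [mul_assoc]
          simpa using (tendsto_gaussTau hy).mul_const (B y * (tauC y)⁻¹)
    simpa using h1
  -- The boxes then lie in the ball of radius r / 2, on which the cutoff equals 1.
  let c : ℝ := r / 4
  have hc : 0 < c := by positivity
  -- After division by D 0 the integrand is nonnegative on K, with Re (D / D 0) > 1/2. Keeping only
  -- the box leaves N² e^(-2c²) · (1/2) · 16c⁴/N², independent of N, which contradicts the limit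
  -- zero.
  have hlow : ∀ n : ℕ, 8 * c ^ 4 * Real.exp (-(2 * c ^ 2)) ≤
      ((∫ y in K, ((n + 1 : ℝ) : ℂ) ^ 2 * (η y * gaussTau (n + 1 : ℝ) y * D y)) * (D 0)⁻¹).re := by
    intro n
    set N : ℝ := n + 1 with hN
    have hN1 : 1 ≤ N := by simp [hN]
    have hN0 : 0 < N := by linarith
    rw [← integral_mul_const, show ∀ z : ℂ, z.re = Complex.reCLM z from fun z => rfl,
      ← Complex.reCLM.integral_comp_comm ((hint1 N).mul_const _)]
    have hre : ∀ y, Complex.reCLM ((N : ℂ) ^ 2 * (η y * gaussTau N y * D y) * (D 0)⁻¹) =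
        N ^ 2 * (b y * Real.exp (-(N ^ 2 * ‖tauC y‖ ^ 2))) * (D y * (D 0)⁻¹).re := by
      intro y
      rw [gaussTau_eq, Complex.reCLM_apply, ← Complex.re_ofReal_mul]
      congr 1
      push_cast
      ring
    simp_rw [hre]
    have hi : IntegrableOn (fun y => N ^ 2 * (b y * Real.exp (-(N ^ 2 * ‖tauC y‖ ^ 2))) *
        (D y * (D 0)⁻¹).re) K := by
      simp_rw [← hre]
      exact Complex.reCLM.integrable_comp ((hint1 N).mul_const _)
    have hbox : gaussBox N c ⊆ K := (gaussBox_subset hN1 hc).trans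
      (Metric.closedBall_subset_closedBall (by simp only [c]; linarith))
    have hnn : ∀ y ∈ K, 0 ≤ N ^ 2 * (b y * Real.exp (-(N ^ 2 * ‖tauC y‖ ^ 2))) *
        (D y * (D 0)⁻¹).re := fun y hy =>
      mul_nonneg (mul_nonneg (sq_nonneg _) (mul_nonneg b.nonneg (Real.exp_pos _).le))
        (by linarith [hKD y hy])
    have h1 : ∀ y ∈ gaussBox N c, N ^ 2 * Real.exp (-(2 * c ^ 2)) * (1 / 2) ≤
        N ^ 2 * (b y * Real.exp (-(N ^ 2 * ‖tauC y‖ ^ 2))) * (D y * (D 0)⁻¹).re := by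
      intro y hy
      have hb : b y = 1 := b.one_of_mem_closedBall (by
        have := gaussBox_subset hN1 hc hy
        rw [mem_closedBall_zero_iff] at this ⊢
        refine this.trans_eq ?_
        change 2 * (r / 4) = r / 2
        ring)
      rw [hb, one_mul]
      have := le_gaussTau_of_mem_gaussBox hN0 hy
      exact mul_le_mul (mul_le_mul_of_nonneg_left this (sq_nonneg _)) (hKD y (hbox hy)).le
        (by norm_num) (by positivity)
    have h2 := setIntegral_ge_of_const_le_real (measurableSet_gaussBox N c)
      ((measure_mono hbox).trans_lt hKc.measure_lt_top).ne h1 (hi.mono_set hbox)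
    rw [volume_gaussBox hN0 hc] at h2
    calc 8 * c ^ 4 * Real.exp (-(2 * c ^ 2))
        = N ^ 2 * Real.exp (-(2 * c ^ 2)) * (1 / 2) * (16 * c ^ 4 / N ^ 2) := by
          field_simp
          ring
      _ ≤ _ := h2
      _ ≤ _ := setIntegral_mono_set hi (by
          rw [EventuallyLE, ae_restrict_iff' hKc.measurableSet]
          exact ae_of_all _ hnn) (LE.le.eventuallyLE hbox)
  have hlim2 : Tendsto (fun n : ℕ =>
      ((∫ y in K, ((n + 1 : ℝ) : ℂ) ^ 2 * (η y * gaussTau (n + 1 : ℝ) y * D y)) *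
        (D 0)⁻¹).re) atTop (𝓝 0) := by
    simp_rw [heq]
    have := (Complex.continuous_re.tendsto _).comp (hlim.mul_const (D 0)⁻¹)
    rw [zero_mul, Complex.zero_re] at this
    exact this
  have := ge_of_tendsto' hlim2 hlow
  have : 0 < 8 * c ^ 4 * Real.exp (-(2 * c ^ 2)) := by positivity
  linarith

/-- Differential of a holomorphic function along an immersion. -/
theorem hasFDerivAt_comp_param {Φ : RR 4 → C3} {V : Set (RR 4)} (hV : IsOpen V)
    (hΦ : ContDiffOn ℝ ∞ Φ V) {h : C3 → ℂ} (hh : Differentiable ℂ h) {t : RR 4} (ht : t ∈ V) :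
    HasFDerivAt (fun t => h (Φ t))
      (((fderiv ℂ h (Φ t)).restrictScalars ℝ).comp (fderiv ℝ Φ t)) t :=
  ((hh (Φ t)).hasFDerivAt.restrictScalars ℝ).comp t
    ((hΦ.contDiffAt (hV.mem_nhds ht)).differentiableAt (by simp)).hasFDerivAt

theorem J_apply (v : C3) : J v = Complex.I • v := rfl

/-- `dh` does not vanish on the complex tangent space of `S` at `p`. -/
def IsCRRegularAt (S : Set C3) (h : C3 → ℂ) (p : C3) : Prop :=
  ∃ v ∈ complexTangentAt S p, fderiv ℂ h p v ≠ 0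

/-- A complex tangent vector is both dΦ w and i dΦ v. Complex linearity of dh allows the
nonvanishing to be stated at v. -/
theorem IsLocalParam.exists_of_isCRRegularAt {S : Set C3} {Φ : RR 4 → C3} {V : Set (RR 4)}
    (hΦ : IsLocalParam ∞ 4 S Φ V) {t : RR 4} (ht : t ∈ V) {h : C3 → ℂ}
    (hreg : IsCRRegularAt S h (Φ t)) :
    ∃ v w : RR 4, fderiv ℝ Φ t w = Complex.I • fderiv ℝ Φ t v ∧
      fderiv ℂ h (Φ t) (fderiv ℝ Φ t v) ≠ 0 := by
  obtain ⟨x, ⟨hx1, hx2⟩, hx⟩ := hreg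
  rw [hΦ.tangentAt_eq_range (by norm_cast) ht] at hx1
  obtain ⟨y, hy, hyx⟩ := hx2
  rw [SetLike.mem_coe, hΦ.tangentAt_eq_range (by norm_cast) ht] at hy
  obtain ⟨w, hw⟩ := hx1
  obtain ⟨v, hv⟩ := hy
  have hw' : fderiv ℝ Φ t w = x := hw
  have hv' : fderiv ℝ Φ t v = y := hv
  refine ⟨v, w, ?_, ?_⟩
  · rw [hw', hv', ← hyx, J_apply]
  · rw [hv']
    rw [← hyx, J_apply, map_smul] at hx
    exact fun h0 => hx (by rw [h0, smul_zero])

/-- The differential of h ∘ Φ takes the values a and ia for some a ≠ 0, and these span ℂ over ℝ.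
Hence zeros of h on S are regular as soon as dh is nonzero on the complex tangent space. -/
theorem surjective_of_isCRRegularAt {S : Set C3} {Φ : RR 4 → C3} {V : Set (RR 4)}
    (hΦ : IsLocalParam ∞ 4 S Φ V) {t : RR 4} (ht : t ∈ V) {h : C3 → ℂ} (hh : Differentiable ℂ h)
    (hreg : IsCRRegularAt S h (Φ t)) :
    Function.Surjective (fderiv ℝ (fun t => h (Φ t)) t) := by
  obtain ⟨v, w, hvw, hv⟩ := hΦ.exists_of_isCRRegularAt ht hreg
  rw [(hasFDerivAt_comp_param hΦ.isOpen hΦ.contDiffOn hh ht).fderiv]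
  set a := fderiv ℂ h (Φ t) (fderiv ℝ Φ t v) with ha
  intro z
  refine ⟨(z / a).re • v + (z / a).im • w, ?_⟩
  rw [map_add, map_smul, map_smul]
  change (z / a).re • fderiv ℂ h (Φ t) (fderiv ℝ Φ t v) +
    (z / a).im • fderiv ℂ h (Φ t) (fderiv ℝ Φ t w) = z
  rw [hvw, map_smul, ← ha, smul_eq_mul, Complex.real_smul, Complex.real_smul]
  calc ((z / a).re : ℂ) * a + ((z / a).im : ℂ) * (Complex.I * a)
      = (((z / a).re : ℂ) + ((z / a).im : ℂ) * Complex.I) * a := by ring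
    _ = z := by rw [Complex.re_add_im, div_mul_cancel₀ _ hv]

theorem isLpLoc_inv {S : Set C3} {h : C3 → ℂ} (hh : ContDiff ℝ ∞ h) (hhd : Differentiable ℂ h)
    (hreg : ∀ p ∈ S, h p = 0 → IsCRRegularAt S h p) {p : ℝ≥0∞} (hp1 : 1 ≤ p) (hp2 : p < 2) :
    IsLpLoc p S fun z => (h z)⁻¹ := by
  intro Φ V hΦ K hKV hK
  exact memLp_inv_of_regular hΦ.isOpen (hh.comp_contDiffOn hΦ.contDiffOn)
    (fun t ht h0 => surjective_of_isCRRegularAt hΦ ht hhd (hreg _ (hΦ.mem ht) h0)) hp1 hp2 hKV hK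

theorem isDistCR_inv {S : Set C3} {h : C3 → ℂ} (hh : ContDiff ℝ ∞ h) (hhd : Differentiable ℂ h)
    (h0 : ∀ p ∈ S, h p ≠ 0) : IsDistCR S fun z => (h z)⁻¹ := by
  refine ⟨isLpLoc_inv hh hhd (fun p hp h => absurd h (h0 p hp)) le_rfl (by norm_num), ?_⟩
  intro Φ V hΦ G hG hGc hGV
  refine integral_mul_dbarForm_eq_zero (f := fun z => (h z)⁻¹) hΦ.isOpen hΦ.contDiffOn
    (fun t ht => (hhd _).inv (h0 _ (hΦ.mem ht))) ?_ hG hGc hGV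
  exact (hh.comp_contDiffOn hΦ.contDiffOn).inv fun t ht => h0 _ (hΦ.mem ht)

/-- In a chart where h is y₀ + iy₁, tauBar is the conjugate of dh; its wedge with the dzⱼ is nonzero
by regularity and genericity, so the Gaussian test applies. -/
theorem not_isDistCR_inv {S : Set C3} {Φ : RR 4 → C3} {V : Set (RR 4)}
    (hΦ : IsLocalParam ∞ 4 S Φ V) (hgen : IsGeneric S) {h : C3 → ℂ} (hh : ContDiff ℝ ∞ h)
    (hhd : Differentiable ℂ h) {t₀ : RR 4} (ht₀ : t₀ ∈ V) (h0 : h (Φ t₀) = 0)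
    (hreg : IsCRRegularAt S h (Φ t₀)) : ¬ IsDistCR S fun z => (h z)⁻¹ := by
  rintro ⟨-, hCR⟩
  obtain ⟨θ, hθt, hθV, hθ0, hθ, hθ', hθu⟩ := exists_adapted_chart hΦ.isOpen
    (hh.comp_contDiffOn hΦ.contDiffOn) ht₀ h0 (surjective_of_isCRRegularAt hΦ ht₀ hhd hreg)
  have hsymm0 : θ.symm 0 = t₀ := by rw [← hθ0, θ.left_inv hθt]
  have h0T : (0 : RR 4) ∈ θ.target := hθ0 ▸ θ.map_source hθt
  have hΨ : IsLocalParam ∞ 4 S (Φ ∘ θ.symm) θ.target :=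
    hΦ.comp (by norm_cast) θ.symm hθ' (by simpa using hθ) (by simpa using hθV)
  set Ψ := Φ ∘ θ.symm with hΨdef
  have hΨ0 : Ψ 0 = Φ t₀ := by simp [hΨdef, hsymm0]
  have hτ : ∀ y ∈ θ.target, h (Ψ y) = tauC y := by
    intro y hy
    have := hθu _ (θ.map_target hy)
    rw [θ.right_inv hy] at this
    exact this.symm
  obtain ⟨v, w, hvw, hv⟩ := hΨ.exists_of_isCRRegularAt h0T (hΨ0 ▸ hreg)
  have hD : dbarWedge Ψ 0 tauBar ≠ 0 := by
    have h2 : tauC = ((fderiv ℂ h (Ψ 0)).restrictScalars ℝ).comp (fderiv ℝ Ψ 0) := by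
      refine HasFDerivAt.unique ?_ (hasFDerivAt_comp_param hΨ.isOpen hΨ.contDiffOn hhd h0T)
      refine tauC.hasFDerivAt.congr_of_eventuallyEq ?_
      filter_upwards [θ.open_target.mem_nhds h0T] with y hy
      exact hτ y hy
    rw [tauBar, h2]
    refine dbarWedge_conj_ne_zero (fun m hm => ?_) hvw hv
    have htop := hgen (Ψ 0) (hΨ.mem h0T)
    rw [hΨ.tangentAt_eq_range (by norm_cast) h0T] at htop
    refine LinearMap.ext fun z => ?_
    have hz : z ∈ (⊤ : Submodule ℝ C3) := Submodule.mem_top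
    rw [← htop] at hz
    obtain ⟨_, ⟨x, rfl⟩, _, ⟨_, ⟨y, rfl⟩, rfl⟩, rfl⟩ := Submodule.mem_sup.1 hz
    have hx := hm x
    have hy := hm y
    rw [map_add, J_apply, m.map_smul]
    change m (fderiv ℝ Ψ 0 x) + Complex.I • m (fderiv ℝ Ψ 0 y) = 0
    rw [hx, hy, smul_zero, add_zero]
  obtain ⟨G, hG, hGc, hGV, hne⟩ := exists_integral_inv_mul_dbarForm_ne_zero θ.open_target h0T
    hΨ.contDiffOn hhd hτ hD
  exact hne (hCR Ψ θ.target hΨ G hG hGc hGV)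

end NotCR

/-! ### Nonremovability of the zero set of a holomorphic function -/

section Removability

/-- Every local wedge at a CR-regular zero of `h` contains a zero of `h`. -/
theorem IsLocalWedge.exists_zero {M : Set C3} (hM : IsSubmanifold ∞ 4 M) {h : C3 → ℂ}
    (hh : ContDiff ℝ ∞ h) (hhd : Differentiable ℂ h) {p : C3} (hp : p ∈ M) (hp0 : h p = 0)
    (hreg : IsCRRegularAt M h p) {W : Set C3} (hW : IsLocalWedge M p W) : ∃ z ∈ W, h z = 0 := by
  obtain ⟨N, O, Γ, U, δ, -, -, -, ⟨c, hc⟩, hcone, hU, hpU, hδ, rfl⟩ := hW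
  obtain ⟨Φ, V, hΦ, t₀, ht₀, rfl⟩ := hM.2 p hp
  have hΦd := (hΦ.contDiffOn.contDiffAt (hΦ.isOpen.mem_nhds ht₀)).hasStrictFDerivAt (n := ∞)
    (by simp)
  let g : RR 4 × ℝ → C3 := fun x => Φ x.1 + x.2 • c
  have hg : HasStrictFDerivAt g ((fderiv ℝ Φ t₀).comp (ContinuousLinearMap.fst ℝ (RR 4) ℝ) +
      (ContinuousLinearMap.snd ℝ (RR 4) ℝ).smulRight c) (t₀, 0) := by
    have h1 : HasStrictFDerivAt (fun x : RR 4 × ℝ => Φ x.1) _ (t₀, (0 : ℝ)) :=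
      HasStrictFDerivAt.comp (t₀, (0 : ℝ)) hΦd hasStrictFDerivAt_fst
    exact h1.fun_add (((ContinuousLinearMap.snd ℝ (RR 4) ℝ).smulRight c).hasStrictFDerivAt)
  have hg0 : g (t₀, 0) = Φ t₀ := by simp [g]
  have hhs : HasStrictFDerivAt h ((fderiv ℂ h (Φ t₀)).restrictScalars ℝ) (g (t₀, 0)) := by
    rw [hg0]
    have h1 := (hh.contDiffAt (x := Φ t₀)).hasStrictFDerivAt (n := ∞) (by simp)
    rwa [((hhd (Φ t₀)).hasFDerivAt.restrictScalars ℝ).fderiv] at h1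
  -- The map (t, s) ↦ (h(Φ t + s c), s) is a submersion at (t₀, 0), so it attains (0, ε) for small ε
  -- > 0: the translate of M by εc still meets the zero set.
  let H : RR 4 × ℝ → ℂ × ℝ := fun x => (h (g x), x.2)
  have hH : HasStrictFDerivAt H _ (t₀, 0) := (hhs.comp (t₀, (0 : ℝ)) hg).prodMk hasStrictFDerivAt_snd
  have hsurj := surjective_of_isCRRegularAt hΦ ht₀ hhd hreg
  rw [(hasFDerivAt_comp_param hΦ.isOpen hΦ.contDiffOn hhd ht₀).fderiv] at hsurj
  have hopen := hH.map_nhds_eq_of_surj (by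
    rw [LinearMap.range_eq_top]
    rintro ⟨a, b⟩
    obtain ⟨v, hv⟩ := hsurj (a - fderiv ℂ h (Φ t₀) (b • c))
    refine ⟨(v, b), ?_⟩
    change (fderiv ℂ h (Φ t₀) (fderiv ℝ Φ t₀ v + b • c), b) = (a, b)
    rw [map_add, show fderiv ℂ h (Φ t₀) (fderiv ℝ Φ t₀ v) = _ from hv, sub_add_cancel])
  have hH0 : H (t₀, 0) = (0, 0) := by simp only [H, hg0, hp0]
  have hnhds : {x : RR 4 × ℝ | x.1 ∈ V ∧ Φ x.1 ∈ U ∧ g x ∈ Metric.ball (Φ t₀) δ} ∈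
      𝓝 (t₀, (0 : ℝ)) := by
    have h1 : ContinuousAt (fun x : RR 4 × ℝ => Φ x.1) (t₀, (0 : ℝ)) :=
      ContinuousAt.comp (f := Prod.fst) (x := (t₀, (0 : ℝ))) hΦd.continuousAt continuousAt_fst
    have h2 : ∀ᶠ x : RR 4 × ℝ in 𝓝 (t₀, (0 : ℝ)), g x ∈ Metric.ball (Φ t₀) δ :=
      hg.continuousAt.eventually (by
        rw [hg0]
        exact Metric.ball_mem_nhds _ hδ)
    filter_upwards [continuousAt_fst (hΦ.isOpen.mem_nhds ht₀), h1 (hU.mem_nhds hpU), h2]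
      with x hx1 hx2 hx3
    exact ⟨hx1, hx2, hx3⟩
  have himg := image_mem_map (m := H) hnhds
  rw [hopen, hH0] at himg
  have hpath : Tendsto (fun ε : ℝ => ((0 : ℂ), ε)) (𝓝[>] 0) (𝓝 (0, 0)) :=
    tendsto_nhdsWithin_of_tendsto_nhds (by
      have : Continuous fun ε : ℝ => ((0 : ℂ), ε) := by fun_prop
      exact this.tendsto 0)
  obtain ⟨ε, ⟨⟨t, s⟩, ⟨htV, htU, htb⟩, hts⟩, hε⟩ :=
    ((hpath.eventually_mem himg).and self_mem_nhdsWithin).exists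
  have hs : s = ε := congrArg Prod.snd hts
  have hz : h (g (t, s)) = 0 := congrArg Prod.fst hts
  refine ⟨g (t, s), ⟨⟨Φ t, ⟨hΦ.mem htV, htU⟩, s • c, hcone c hc s ?_, rfl⟩, htb⟩, hz⟩
  rw [hs]
  exact hε

/-- The real points of norm less than `r`. -/
def realBall (r : ℝ) : Set C3 := {x | (∀ j, (x j).im = 0) ∧ ‖x‖ < r}

/-- An extension F of 1/h would satisfy Fh = 1 on the real points near the origin. Edge uniqueness
and connectedness spread this identity over W, where a zero of h contradicts it. -/
theorem not_isCRRemovable {M C : Set C3} (hM : IsSubmanifold ∞ 4 M) {h : C3 → ℂ}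
    (hh : ContDiff ℝ ∞ h) (hhd : Differentiable ℂ h) (hC : C = {p ∈ M | h p = 0})
    (hCne : C.Nonempty) (hreg : ∀ p ∈ C, IsCRRegularAt M h p) {r : ℝ} (hr : 0 < r)
    (hball : realBall r ⊆ M \ C) : ¬ IsCRRemovable M C := by
  rintro ⟨W, ⟨hWo, hWc, hWw⟩, hext⟩
  have h0 : ∀ p ∈ M \ C, h p ≠ 0 := fun p hp h0 => hp.2 (hC ▸ ⟨hp.1, h0⟩)
  obtain ⟨F, hF, hFc, hFf⟩ := hext (fun z => (h z)⁻¹)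
    (hh.continuous.continuousOn.inv₀ h0) (isDistCR_inv hh hhd h0)
  have h0M : (0 : C3) ∈ M := (hball ⟨by simp, by simpa⟩).1
  obtain ⟨W', hW'W, N, O, Γ, U, δ, -, -, -, ⟨c, hc⟩, hcone, hU, hpU, hδ, rfl⟩ := hWw 0 h0M
  obtain ⟨ε, hε, hεU⟩ := Metric.isOpen_iff.1 hU 0 hpU
  let G : C3 → ℂ := fun z => F z * h z - 1
  have hG : DifferentiableOn ℂ G W := (hF.mul hhd.differentiableOn).sub_const 1
  have hGc : ContinuousOn G (W ∪ (M \ C)) :=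
    (hFc.mul hh.continuous.continuousOn).sub continuousOn_const
  -- The four bounds keep x in M \ C and in U, and keep x + bc inside the polydisc of radius δ.
  let r' : ℝ := min (min r ε) (min (δ / 2) (δ / (2 * (‖c‖ + 1))))
  have hr' : 0 < r' := by positivity
  obtain ⟨w, hwW, hw⟩ := exists_eventually_eq_zero_of_real_edge (S := M \ C) (p := 0) (c := c)
    (r := r') hWo hG hGc hr' (fun x hx hxr => by
      have hxS : x ∈ M \ C := hball ⟨hx, hxr.trans_le ((min_le_left _ _).trans (min_le_left _ _))⟩
      rw [zero_add]
      refine ⟨hxS, ?_⟩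
      change F x * h x - 1 = 0
      rw [hFf hxS, inv_mul_cancel₀ (h0 x hxS), sub_self]) (fun x hx hxr b hb hbr => by
      have hxS : x ∈ M \ C := hball ⟨hx, hxr.trans_le ((min_le_left _ _).trans (min_le_left _ _))⟩
      refine hW'W ⟨⟨x, ⟨hxS.1, hεU ?_⟩, b • c, hcone c hc b hb, ?_⟩, ?_⟩
      · rw [mem_ball_zero_iff]
        exact hxr.trans_le ((min_le_left _ _).trans (min_le_right _ _))
      · rw [zero_add]
        rfl
      · rw [zero_add, mem_ball_zero_iff]
        have h1 : ‖x‖ < δ / 2 := hxr.trans_le ((min_le_right _ _).trans (min_le_left _ _))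
        have h2 : b < δ / (2 * (‖c‖ + 1)) :=
          hbr.trans_le ((min_le_right _ _).trans (min_le_right _ _))
        have h3 : ‖(b : ℂ) • c‖ ≤ δ / 2 := by
          rw [norm_smul, Complex.norm_real, Real.norm_of_nonneg hb.le]
          rw [lt_div_iff₀ (by positivity)] at h2
          nlinarith [norm_nonneg c]
        calc ‖x + (b : ℂ) • c‖ ≤ ‖x‖ + ‖(b : ℂ) • c‖ := norm_add_le _ _
          _ < δ := by linarith)
  obtain ⟨p, hpC⟩ := hCne
  have hp : p ∈ M ∧ h p = 0 := by
    rw [hC] at hpC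
    exact hpC
  obtain ⟨Wp, hWp, hWpl⟩ := hWw p hp.1
  obtain ⟨z, hz, hz0⟩ := hWpl.exists_zero hM hh hhd hp.1 hp.2 (hreg p hpC)
  have := eq_zero_of_isPreconnected_of_eventually_eq_zero hWo hWc.isPreconnected hG hwW hw z
    (hWp hz)
  simp [G, hz0] at this

/-- The complement of the zero set is connected, and being a neighbourhood of each point of S it
contains local wedges of any shape. -/
theorem isWedgelikeDomain_setOf_ne_zero {S : Set C3} (hS : S.Nonempty) {h : C3 → ℂ}
    (hhd : Differentiable ℂ h) (h0 : ∀ p ∈ S, h p ≠ 0) : IsWedgelikeDomain S {z | h z ≠ 0} := by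
  have hopen : IsOpen {z | h z ≠ 0} := isOpen_ne_fun hhd.continuous continuous_const
  obtain ⟨p₀, hp₀⟩ := hS
  refine ⟨hopen, isConnected_setOf_ne_zero hhd (h0 p₀ hp₀), fun p hp => ?_⟩
  obtain ⟨N, hN⟩ := Submodule.exists_isCompl (tangentAt S p)
  obtain ⟨δ, hδ, hδh⟩ := Metric.isOpen_iff.1 hopen p (h0 p hp)
  -- The cone may be the whole complement N, as the polydisc already lies in the open set.
  refine ⟨_, ?_, N, univ, univ ∩ N, univ, δ, hN, isOpen_univ, rfl, ⟨0, mem_univ _, N.zero_mem⟩,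
    fun c hc r _ => ⟨mem_univ _, N.smul_mem r hc.2⟩, isOpen_univ, mem_univ _, hδ, rfl⟩
  exact inter_subset_right.trans hδh

/-- Here W₁ is the full set h ≠ 0 and f = 1/h. The relation Fh = 1 holds on the open set W₃ and
spreads to W₂, which must contain zeros of h. -/
theorem not_isWRemovable {M C : Set C3} (hM : IsSubmanifold ∞ 4 M) {h : C3 → ℂ}
    (hh : ContDiff ℝ ∞ h) (hhd : Differentiable ℂ h) (hC : C = {p ∈ M | h p = 0})
    (hCne : C.Nonempty) (hreg : ∀ p ∈ C, IsCRRegularAt M h p) (hMC : (M \ C).Nonempty) :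
    ¬ IsWRemovable M C := by
  intro hrem
  have h0 : ∀ p ∈ M \ C, h p ≠ 0 := fun p hp h0 => hp.2 (hC ▸ ⟨hp.1, h0⟩)
  obtain ⟨W₂, W₃, ⟨hW₂o, hW₂c, hW₂w⟩, ⟨hW₃o, hW₃c, -⟩, hsub, hext⟩ :=
    hrem _ (isWedgelikeDomain_setOf_ne_zero hMC hhd h0)
  obtain ⟨F, hF, hFf⟩ := hext (fun z => (h z)⁻¹) (hhd.differentiableOn.inv fun z hz => hz)
  let G : C3 → ℂ := fun z => F z * h z - 1
  have hG : DifferentiableOn ℂ G W₂ := (hF.mul hhd.differentiableOn).sub_const 1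
  obtain ⟨w, hw⟩ := hW₃c.nonempty
  have hw0 : ∀ᶠ z in 𝓝 w, G z = 0 := by
    filter_upwards [hW₃o.mem_nhds hw] with z hz
    change F z * h z - 1 = 0
    rw [hFf hz, inv_mul_cancel₀ (hsub hz).1, sub_self]
  obtain ⟨p, hpC⟩ := hCne
  have hp : p ∈ M ∧ h p = 0 := by
    rw [hC] at hpC
    exact hpC
  obtain ⟨Wp, hWp, hWpl⟩ := hW₂w p hp.1
  obtain ⟨z, hz, hz0⟩ := hWpl.exists_zero hM hh hhd hp.1 hp.2 (hreg p hpC)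
  have := eq_zero_of_isPreconnected_of_eventually_eq_zero hW₂o hW₂c.isPreconnected hG (hsub hw).2
    hw0 z (hWp hz)
  simp [G, hz0] at this

/-- The bound p < 2 reflects the real codimension two of C in M: 1/h behaves like the reciprocal of
a complex coordinate. -/
theorem not_isLpRemovable {M C : Set C3} (hM : IsSubmanifold ∞ 4 M) (hgen : IsGeneric M)
    {h : C3 → ℂ} (hh : ContDiff ℝ ∞ h) (hhd : Differentiable ℂ h) (hC : C = {p ∈ M | h p = 0})
    (hCne : C.Nonempty) (hreg : ∀ p ∈ C, IsCRRegularAt M h p) {p : ℝ≥0∞} (hp1 : 1 ≤ p)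
    (hp2 : p < 2) : ¬ IsLpRemovable p M C := by
  intro hrem
  have h0 : ∀ p ∈ M \ C, h p ≠ 0 := fun p hp h0 => hp.2 (hC ▸ ⟨hp.1, h0⟩)
  have h1 := hrem (fun z => (h z)⁻¹) (isLpLoc_inv hh hhd
    (fun p hp h0 => hreg p (hC ▸ ⟨hp, h0⟩)) hp1 hp2) (isDistCR_inv hh hhd h0)
  obtain ⟨q, hqC⟩ := hCne
  have hq : q ∈ M ∧ h q = 0 := by
    rw [hC] at hqC
    exact hqC
  obtain ⟨Φ, V, hΦ, t₀, ht₀, rfl⟩ := hM.2 q hq.1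
  exact not_isDistCR_inv hΦ hgen hh hhd ht₀ hq.2 (hreg _ hqC) h1

end Removability

/-! ### Images of embeddings with a smooth left inverse -/

section LeftInverse

theorem isLocalParam_of_leftInverse {d : ℕ} {Φ : RR d → C3} {π : C3 → RR d}
    (hΦ : ContDiff ℝ ∞ Φ) (hπ : Differentiable ℝ π) (hl : ∀ t, π (Φ t) = t) {V : Set (RR d)}
    (hV : IsOpen V) : IsLocalParam ∞ d (Φ '' V) Φ V := by
  refine ⟨hV, hΦ.contDiffOn, fun t _ => ?_, ?_, univ, isOpen_univ, (inter_univ _).symm⟩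
  · have h1 : (fderiv ℝ π (Φ t)).comp (fderiv ℝ Φ t) = ContinuousLinearMap.id ℝ _ := by
      rw [← fderiv_comp t (hπ _) (hΦ.differentiable (by simp) t), ← fderiv_id (𝕜 := ℝ) (x := t)]
      congr 1
      exact funext hl
    exact Function.LeftInverse.injective (g := fderiv ℝ π (Φ t)) fun v =>
      congrArg (fun L => L v) h1
  · have h1 : IsEmbedding Φ :=
      IsEmbedding.of_leftInverse hl hπ.continuous hΦ.continuous
    exact h1.comp IsEmbedding.subtypeVal

variable {P E : Type*} [NormedAddCommGroup P] [NormedSpace ℝ P] [NormedAddCommGroup E]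
  [NormedSpace ℝ E]

/-- Lie brackets of related vector fields are related. -/
theorem lieBracket_comp_of_related {Φ : P → E} {A B : E → E} {a b : P → P} {q : P}
    (hΦ : ContDiffAt ℝ ∞ Φ q) (hA : DifferentiableAt ℝ A (Φ q)) (hB : DifferentiableAt ℝ B (Φ q))
    (ha : DifferentiableAt ℝ a q) (hb : DifferentiableAt ℝ b q)
    (hAa : ∀ᶠ x in 𝓝 q, A (Φ x) = fderiv ℝ Φ x (a x))
    (hBb : ∀ᶠ x in 𝓝 q, B (Φ x) = fderiv ℝ Φ x (b x)) :
    VectorField.lieBracket ℝ A B (Φ q) = fderiv ℝ Φ q (VectorField.lieBracket ℝ a b q) := by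
  have hs : IsSymmSndFDerivAt ℝ Φ q := hΦ.isSymmSndFDerivAt (by simp; norm_cast)
  have hdd : DifferentiableAt ℝ (fderiv ℝ Φ) q :=
    (hΦ.fderiv_right (m := 1) (by norm_cast)).differentiableAt (by simp)
  have hΦd : HasFDerivAt Φ (fderiv ℝ Φ q) q := (hΦ.differentiableAt (by simp)).hasFDerivAt
  -- Differentiating A ∘ Φ = dΦ(a) produces a second derivative of Φ; in the bracket these terms
  -- cancel by symmetry.
  have key : ∀ {A : E → E} {a : P → P}, DifferentiableAt ℝ A (Φ q) → DifferentiableAt ℝ a q →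
      (∀ᶠ x in 𝓝 q, A (Φ x) = fderiv ℝ Φ x (a x)) → ∀ v,
      fderiv ℝ A (Φ q) (fderiv ℝ Φ q v) =
        fderiv ℝ (fderiv ℝ Φ) q v (a q) + fderiv ℝ Φ q (fderiv ℝ a q v) := by
    intro A a hA ha hAa v
    have h1 : HasFDerivAt (fun x => A (Φ x)) ((fderiv ℝ A (Φ q)).comp (fderiv ℝ Φ q)) q :=
      hA.hasFDerivAt.comp q hΦd
    have h2 := (hdd.hasFDerivAt.clm_apply ha.hasFDerivAt).congr_of_eventuallyEq hAa
    have h3 := congrArg (fun L => L v) (h1.unique h2)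
    simpa [add_comm] using h3
  rw [VectorField.lieBracket, VectorField.lieBracket, hAa.self_of_nhds, hBb.self_of_nhds,
    key hB hb hBb, key hA ha hAa, hs.eq, map_sub]
  abel

theorem contDiffOn_lieBracket {A B : E → E} {U : Set E} (hU : IsOpen U) (hA : ContDiffOn ℝ ∞ A U)
    (hB : ContDiffOn ℝ ∞ B U) : ContDiffOn ℝ ∞ (VectorField.lieBracket ℝ A B) U := fun x hx =>
  ((hA.contDiffAt (hU.mem_nhds hx)).lieBracket_vectorField (hB.contDiffAt (hU.mem_nhds hx))
    (by simp)).contDiffWithinAt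

/-- A vector field tangent to the image of `Φ` lifts. -/
theorem fderiv_leftInverse_apply {Φ : P → E} {π : E → P} (hΦ : Differentiable ℝ Φ)
    (hπ : Differentiable ℝ π) (hl : ∀ t, π (Φ t) = t) (q v : P) :
    fderiv ℝ π (Φ q) (fderiv ℝ Φ q v) = v := by
  have h1 : (fderiv ℝ π (Φ q)).comp (fderiv ℝ Φ q) = ContinuousLinearMap.id ℝ _ := by
    rw [← fderiv_comp q (hπ _) (hΦ q), ← fderiv_id (𝕜 := ℝ) (x := q)]
    congr 1
    exact funext hl
  exact congrArg (fun L => L v) h1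

/-- Iterated brackets of sections of `T^c M` are tangent to `M`. -/
theorem IsCRBracket.mem_tangentAt {M U : Set C3} (hU : IsOpen U) {Φ : P → C3} {π : C3 → P}
    (hΦ : ContDiff ℝ ∞ Φ) (hπ : ContDiff ℝ ∞ π) (hl : ∀ t, π (Φ t) = t) {D : Set P}
    (hD : IsOpen D) (hM : M = Φ '' D)
    (htan : ∀ q ∈ D, tangentAt M (Φ q) = LinearMap.range (fderiv ℝ Φ q : P →ₗ[ℝ] C3))
    {k : ℕ} {X : C3 → C3} (hX : IsCRBracket M U k X) :
    ContDiffOn ℝ ∞ X U ∧ ∀ p ∈ M ∩ U, X p ∈ tangentAt M p := by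
  induction hX with
  | base X hX hXt => exact ⟨hX, fun p hp => (hXt p hp).1⟩
  | bracket j k X Y _ _ ihX ihY =>
    refine ⟨contDiffOn_lieBracket hU ihX.1 ihY.1, ?_⟩
    rintro p ⟨hpM, hpU⟩
    rw [hM] at hpM
    obtain ⟨q, hq, rfl⟩ := hpM
    rw [htan q hq]
    have hDU : D ∩ Φ ⁻¹' U ∈ 𝓝 q :=
      inter_mem (hD.mem_nhds hq) (hΦ.continuous.continuousAt (hU.mem_nhds hpU))
    -- The derivative of π recovers the coordinate field of a field tangent to M, so the bracket in
    -- ℂ³ is related to a bracket in coordinates and is again tangent.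
    have lift : ∀ {X : C3 → C3}, ContDiffOn ℝ ∞ X U → (∀ p ∈ M ∩ U, X p ∈ tangentAt M p) →
        DifferentiableAt ℝ (fun x => fderiv ℝ π (Φ x) (X (Φ x))) q ∧
        ∀ᶠ x in 𝓝 q, X (Φ x) = fderiv ℝ Φ x (fderiv ℝ π (Φ x) (X (Φ x))) := by
      intro X hX hXt
      constructor
      · have h1 : ContDiff ℝ 1 fun x => fderiv ℝ π (Φ x) :=
          (hπ.fderiv_right (m := 1) (by norm_cast)).comp (hΦ.of_le (by norm_cast))
        have h2 : ContDiffAt ℝ 1 (fun x => X (Φ x)) q :=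
          ((hX.contDiffAt (hU.mem_nhds hpU)).of_le (by norm_cast)).comp q
            ((hΦ.of_le (by norm_cast)).contDiffAt)
        exact (h1.contDiffAt.clm_apply h2).differentiableAt (by simp)
      · filter_upwards [hDU] with x hx
        have h3 := hXt (Φ x) ⟨hM ▸ mem_image_of_mem Φ hx.1, hx.2⟩
        rw [htan x hx.1] at h3
        obtain ⟨v, hv⟩ := h3
        have hv' : fderiv ℝ Φ x v = X (Φ x) := hv
        rw [← hv', fderiv_leftInverse_apply (hΦ.differentiable (by simp))
          (hπ.differentiable (by simp)) hl]
    have hdX : DifferentiableAt ℝ X (Φ q) :=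
      (ihX.1.contDiffAt (hU.mem_nhds hpU)).differentiableAt (by simp)
    have hdY : DifferentiableAt ℝ Y (Φ q) :=
      (ihY.1.contDiffAt (hU.mem_nhds hpU)).differentiableAt (by simp)
    exact ⟨_, (lieBracket_comp_of_related hΦ.contDiffAt hdX hdY (lift ihX.1 ihX.2).1
      (lift ihY.1 ihY.2).1 (lift ihX.1 ihX.2).2 (lift ihY.1 ihY.2).2).symm⟩

end LeftInverse

/-! ### Real and imaginary parts in `ℂ³` -/

section RealImag

/-- `(x, y) ↦ x + i y`. -/
noncomputable def toC : RR 3 × RR 3 →L[ℝ] C3 :=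
  ContinuousLinearMap.pi fun j =>
    Complex.ofRealCLM.comp ((EuclideanSpace.proj j).comp (ContinuousLinearMap.fst ℝ (RR 3) (RR 3))) +
    Complex.I • Complex.ofRealCLM.comp
      ((EuclideanSpace.proj j).comp (ContinuousLinearMap.snd ℝ (RR 3) (RR 3)))

theorem toC_apply (x y : RR 3) (j : Fin 3) : toC (x, y) j = (x j : ℂ) + Complex.I * (y j : ℂ) := rfl

/-- The real part of a vector of `ℂ³`. -/
noncomputable def reC : C3 →L[ℝ] RR 3 := LinearMap.toContinuousLinearMap
  { toFun := fun z => WithLp.toLp 2 fun j => (z j).re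
    map_add' := fun a b => by ext i; simp
    map_smul' := fun a b => by ext i; simp }

/-- The imaginary part of a vector of `ℂ³`. -/
noncomputable def imC : C3 →L[ℝ] RR 3 := LinearMap.toContinuousLinearMap
  { toFun := fun z => WithLp.toLp 2 fun j => (z j).im
    map_add' := fun a b => by ext i; simp
    map_smul' := fun a b => by ext i; simp }

theorem reC_apply (z : C3) (j : Fin 3) : reC z j = (z j).re := rfl

theorem imC_apply (z : C3) (j : Fin 3) : imC z j = (z j).im := rfl

@[simp] theorem reC_toC (x y : RR 3) : reC (toC (x, y)) = x := by
  ext j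
  simp [reC_apply, toC_apply]

@[simp] theorem imC_toC (x y : RR 3) : imC (toC (x, y)) = y := by
  ext j
  simp [imC_apply, toC_apply]

theorem toC_reC_imC (z : C3) : toC (reC z, imC z) = z := by
  ext j
  rw [toC_apply, reC_apply, imC_apply, mul_comm]
  exact Complex.re_add_im _

theorem I_smul_toC (x y : RR 3) : Complex.I • toC (x, y) = toC (-y, x) := by
  ext j
  rw [Pi.smul_apply, toC_apply, toC_apply, smul_eq_mul]
  simp only [PiLp.neg_apply, Complex.ofReal_neg]
  linear_combination (y j : ℂ) * Complex.I_mul_I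

theorem J_toC (x y : RR 3) : J (toC (x, y)) = toC (-y, x) := by
  rw [J_apply, I_smul_toC]

end RealImag

/-! ### Generic submanifolds built from a frame of vector fields -/

section SecondOrder

variable {E : Type*} [NormedAddCommGroup E] [NormedSpace ℝ E]

/-- The expansion at `s = 0` of the solution of `ξ + T ζ = ψ'`, `ζ = T ξ`, where
`T = s A + s² B + s³ C`. -/
theorem taylor_of_cubic_system {ξ ζ ξ₁ ζ₁ : ℝ → E} {ζ₂ : E} {A B C : E →L[ℝ] E} {x y z : E}
    (hξ : ∀ᶠ s in 𝓝 (0 : ℝ), ξ s = x + (2 * s) • y + (3 * s ^ 2) • z -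
      (s • A + s ^ 2 • B + s ^ 3 • C) (ζ s))
    (hζ : ∀ᶠ s in 𝓝 (0 : ℝ), ζ s = (s • A + s ^ 2 • B + s ^ 3 • C) (ξ s))
    (hξ₁ : ∀ᶠ s in 𝓝 (0 : ℝ), HasDerivAt ξ (ξ₁ s) s)
    (hζ₁ : ∀ᶠ s in 𝓝 (0 : ℝ), HasDerivAt ζ (ζ₁ s) s) (hζ₂ : HasDerivAt ζ₁ ζ₂ 0) :
    ξ 0 = x ∧ ζ 0 = 0 ∧ ξ₁ 0 = (2 : ℝ) • y ∧ ζ₁ 0 = A x ∧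
      HasDerivAt ξ₁ ((6 : ℝ) • z - (2 : ℝ) • A (A x)) 0 := by
  have hT : ∀ s : ℝ, HasDerivAt (fun s : ℝ => s • A + s ^ 2 • B + s ^ 3 • C)
      (A + (2 * s) • B + (3 * s ^ 2) • C) s := by
    intro s
    have h1 := (hasDerivAt_id s).smul_const A
    have h2 := (hasDerivAt_pow 2 s).smul_const B
    have h3 := (hasDerivAt_pow 3 s).smul_const C
    refine ((h1.fun_add h2).fun_add h3).congr_deriv ?_
    simp
  have hT' : HasDerivAt (fun s : ℝ => A + (2 * s) • B + (3 * s ^ 2) • C) ((2 : ℝ) • B) 0 := by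
    have h2 := ((hasDerivAt_id (0 : ℝ)).const_mul 2).smul_const B
    have h3 := ((hasDerivAt_pow 2 (0 : ℝ)).const_mul 3).smul_const C
    refine (((hasDerivAt_const (0 : ℝ) A).fun_add h2).fun_add h3).congr_deriv ?_
    simp
  have hψ : ∀ s : ℝ, HasDerivAt (fun s : ℝ => x + (2 * s) • y + (3 * s ^ 2) • z)
      ((2 : ℝ) • y + (6 * s) • z) s := by
    intro s
    have h2 := ((hasDerivAt_id s).const_mul 2).smul_const y
    have h3 := ((hasDerivAt_pow 2 s).const_mul 3).smul_const z
    refine (((hasDerivAt_const s x).fun_add h2).fun_add h3).congr_deriv ?_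
    simp
    ring_nf
  have hψ' : HasDerivAt (fun s : ℝ => (2 : ℝ) • y + (6 * s) • z) ((6 : ℝ) • z) 0 := by
    have h3 := ((hasDerivAt_id (0 : ℝ)).const_mul 6).smul_const z
    refine ((hasDerivAt_const (0 : ℝ) ((2 : ℝ) • y)).fun_add h3).congr_deriv ?_
    simp
  have hζ0 : ζ 0 = 0 := by simpa using hζ.self_of_nhds
  have hξ0 : ξ 0 = x := by simpa using hξ.self_of_nhds
  have hξ₁eq : ∀ᶠ s in 𝓝 (0 : ℝ), ξ₁ s = (2 : ℝ) • y + (6 * s) • z -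
      ((A + (2 * s) • B + (3 * s ^ 2) • C) (ζ s) + (s • A + s ^ 2 • B + s ^ 3 • C) (ζ₁ s)) := by
    filter_upwards [hξ.eventually_nhds, hξ₁, hζ₁] with s h1 h2 h3
    exact h2.unique (((hψ s).fun_sub ((hT s).clm_apply h3)).congr_of_eventuallyEq h1)
  have hζ₁0 : ζ₁ 0 = A x := by
    have h2 := hζ₁.self_of_nhds
    have h3 := h2.unique (((hT 0).clm_apply hξ₁.self_of_nhds).congr_of_eventuallyEq hζ)
    simpa [hξ0] using h3
  refine ⟨hξ0, hζ0, by simpa [hζ0] using hξ₁eq.self_of_nhds, hζ₁0, ?_⟩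
  -- The second derivative ζ₂ is never computed: it is multiplied by T(0) = 0, so its mere existence
  -- is enough.
  have h1 := hψ'.fun_sub ((hT'.clm_apply hζ₁.self_of_nhds).fun_add ((hT 0).clm_apply hζ₂))
  refine (h1.congr_of_eventuallyEq hξ₁eq).congr_deriv ?_
  simp only [hζ0, hζ₁0, map_zero]
  simp
  rw [two_smul]

end SecondOrder

/-- Vector fields on `ℝ³` from which a generic four-dimensional submanifold of `ℂ³` is built. -/
structure CRFrame where
  X : RR 3 → RR 3
  Y : RR 3 → RR 3
  Z : RR 3 → RR 3
  contDiff_X : ContDiff ℝ ∞ X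
  contDiff_Y : ContDiff ℝ ∞ Y
  contDiff_Z : ContDiff ℝ ∞ Z
  -- Orthogonality to X lets s be read off from the imaginary part by projecting on X, which gives
  -- the parametrization a global smooth left inverse.
  inner_X_Y : ∀ x, inner ℝ (X x) (Y x) = 0
  inner_X_Z : ∀ x, inner ℝ (X x) (Z x) = 0
  -- The third vector is the value of [β,[β,α]] on the real slice.
  linearIndependent : ∀ x, LinearIndependent ℝ ![X x, Y x, (6 : ℝ) • Z x +
    (fderiv ℝ (fun y => fderiv ℝ X y (X y)) x (X x) -
      (3 : ℝ) • fderiv ℝ X x (fderiv ℝ X x (X x)))]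

/-! ### The parametrization, its complex tangent fields and their brackets -/

namespace CRFrame

variable (F : CRFrame)

theorem X_ne_zero (x : RR 3) : F.X x ≠ 0 := (F.linearIndependent x).ne_zero 0

/-- The imaginary part `s X + s² Y + s³ Z`. -/
noncomputable def psi (q : RR 3 × ℝ) : RR 3 :=
  q.2 • F.X q.1 + q.2 ^ 2 • F.Y q.1 + q.2 ^ 3 • F.Z q.1

/-- The `s`-derivative of `psi`. -/
noncomputable def psi' (q : RR 3 × ℝ) : RR 3 :=
  F.X q.1 + (2 * q.2) • F.Y q.1 + (3 * q.2 ^ 2) • F.Z q.1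

/-- The `x`-derivative of `psi`. -/
noncomputable def T (q : RR 3 × ℝ) : RR 3 →L[ℝ] RR 3 :=
  q.2 • fderiv ℝ F.X q.1 + q.2 ^ 2 • fderiv ℝ F.Y q.1 + q.2 ^ 3 • fderiv ℝ F.Z q.1

/-- The parametrization `(x, s) ↦ x + i (s X + s² Y + s³ Z)`. -/
noncomputable def param (q : RR 3 × ℝ) : C3 := toC (q.1, F.psi q)

/-- A left inverse of the parametrization. -/
noncomputable def proj (z : C3) : RR 3 × ℝ :=
  (reC z, inner ℝ (F.X (reC z)) (imC z) / inner ℝ (F.X (reC z)) (F.X (reC z)))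

theorem inner_X_X_ne (x : RR 3) : inner ℝ (F.X x) (F.X x) ≠ 0 :=
  fun h => F.X_ne_zero x (inner_self_eq_zero.1 h)

theorem proj_param (q : RR 3 × ℝ) : F.proj (F.param q) = q := by
  have h1 : reC (F.param q) = q.1 := reC_toC _ _
  have h2 : imC (F.param q) = F.psi q := imC_toC _ _
  rw [proj, h1, h2, psi, inner_add_right, inner_add_right, inner_smul_right, inner_smul_right,
    inner_smul_right, F.inner_X_Y, F.inner_X_Z, mul_zero, mul_zero, add_zero, add_zero,
    mul_div_cancel_right₀ _ (F.inner_X_X_ne _)]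

theorem contDiff_psi : ContDiff ℝ ∞ F.psi := by
  have hX := F.contDiff_X.comp (contDiff_fst (E := RR 3) (F := ℝ))
  have hY := F.contDiff_Y.comp (contDiff_fst (E := RR 3) (F := ℝ))
  have hZ := F.contDiff_Z.comp (contDiff_fst (E := RR 3) (F := ℝ))
  exact ((contDiff_snd.smul hX).add ((contDiff_snd.pow 2).smul hY)).add ((contDiff_snd.pow 3).smul hZ)

theorem contDiff_psi' : ContDiff ℝ ∞ F.psi' := by
  have hX := F.contDiff_X.comp (contDiff_fst (E := RR 3) (F := ℝ))
  have hY := F.contDiff_Y.comp (contDiff_fst (E := RR 3) (F := ℝ))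
  have hZ := F.contDiff_Z.comp (contDiff_fst (E := RR 3) (F := ℝ))
  exact (hX.add ((contDiff_const.mul contDiff_snd).smul hY)).add
    ((contDiff_const.mul (contDiff_snd.pow 2)).smul hZ)

theorem contDiff_T : ContDiff ℝ ∞ F.T := by
  have hX := (F.contDiff_X.fderiv_right (m := ∞) (by simp)).comp (contDiff_fst (E := RR 3) (F := ℝ))
  have hY := (F.contDiff_Y.fderiv_right (m := ∞) (by simp)).comp (contDiff_fst (E := RR 3) (F := ℝ))
  have hZ := (F.contDiff_Z.fderiv_right (m := ∞) (by simp)).comp (contDiff_fst (E := RR 3) (F := ℝ))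
  exact ((contDiff_snd.smul hX).add ((contDiff_snd.pow 2).smul hY)).add ((contDiff_snd.pow 3).smul hZ)

theorem contDiff_param : ContDiff ℝ ∞ F.param :=
  toC.contDiff.comp (contDiff_fst.prodMk F.contDiff_psi)

theorem contDiff_proj : ContDiff ℝ ∞ F.proj := by
  have hX : ContDiff ℝ ∞ fun z => F.X (reC z) := F.contDiff_X.comp reC.contDiff
  exact reC.contDiff.prodMk ((hX.inner ℝ imC.contDiff).div (hX.inner ℝ hX)
    fun z => F.inner_X_X_ne _)

theorem hasFDerivAt_psi (q : RR 3 × ℝ) : HasFDerivAt F.psi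
    ((F.T q).comp (ContinuousLinearMap.fst ℝ (RR 3) ℝ) +
      (ContinuousLinearMap.snd ℝ (RR 3) ℝ).smulRight (F.psi' q)) q := by
  have hc : ∀ {V : RR 3 → RR 3}, ContDiff ℝ ∞ V → HasFDerivAt (fun q : RR 3 × ℝ => V q.1)
      ((fderiv ℝ V q.1).comp (ContinuousLinearMap.fst ℝ (RR 3) ℝ)) q := fun hV =>
    (hV.differentiable (by simp) q.1).hasFDerivAt.comp q hasFDerivAt_fst
  have hs : HasFDerivAt (fun q : RR 3 × ℝ => q.2) (ContinuousLinearMap.snd ℝ (RR 3) ℝ) q :=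
    hasFDerivAt_snd
  have h1 := hs.fun_smul (hc F.contDiff_X)
  have h2 := (hs.pow 2).fun_smul (hc F.contDiff_Y)
  have h3 := (hs.pow 3).fun_smul (hc F.contDiff_Z)
  refine ((h1.fun_add h2).fun_add h3).congr_fderiv ?_
  refine ContinuousLinearMap.ext fun v => ?_
  simp [T, psi']
  module

theorem fderiv_param (q : RR 3 × ℝ) (v : RR 3) (σ : ℝ) :
    fderiv ℝ F.param q (v, σ) = toC (v, F.T q v + σ • F.psi' q) := by
  have h : HasFDerivAt F.param _ q :=
    toC.hasFDerivAt.comp q (hasFDerivAt_fst.prodMk (F.hasFDerivAt_psi q))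
  rw [h.fderiv]
  rfl

/-- The set on which `1 + T²` is invertible. -/
def regularSet : Set (RR 3 × ℝ) := {q | IsUnit (1 + F.T q * F.T q)}

theorem isOpen_regularSet : IsOpen F.regularSet :=
  Units.isOpen.preimage (continuous_const.add (F.contDiff_T.continuous.mul F.contDiff_T.continuous))

theorem T_zero (x : RR 3) : F.T (x, 0) = 0 := by
  ext1 v
  simp [T]

theorem mem_regularSet (x : RR 3) : (x, (0 : ℝ)) ∈ F.regularSet := by
  simp [regularSet, T_zero]

/-- The solution of `(1 + T²) ξ = ψ'`. -/
noncomputable def xi (q : RR 3 × ℝ) : RR 3 := Ring.inverse (1 + F.T q * F.T q) (F.psi' q)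

/-- `ζ = T ξ`. -/
noncomputable def zeta (q : RR 3 × ℝ) : RR 3 := F.T q (F.xi q)

theorem contDiffOn_xi : ContDiffOn ℝ ∞ F.xi F.regularSet := by
  intro q hq
  obtain ⟨u, hu⟩ := hq
  have h1 : ContDiffAt ℝ ∞ (fun q => 1 + F.T q * F.T q) q :=
    contDiffAt_const.add (F.contDiff_T.contDiffAt.mul F.contDiff_T.contDiffAt)
  have h2 : ContDiffAt ℝ ∞ (fun q => Ring.inverse (1 + F.T q * F.T q)) q := by
    refine ContDiffAt.comp (g := Ring.inverse) q ?_ h1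
    rw [← hu]
    exact contDiffAt_ringInverse ℝ u
  exact (h2.clm_apply F.contDiff_psi'.contDiffAt).contDiffWithinAt

theorem contDiffOn_zeta : ContDiffOn ℝ ∞ F.zeta F.regularSet :=
  F.contDiff_T.contDiffOn.clm_apply F.contDiffOn_xi

theorem xi_eq {q : RR 3 × ℝ} (hq : q ∈ F.regularSet) : F.xi q = F.psi' q - F.T q (F.zeta q) := by
  have h := Ring.mul_inverse_cancel _ hq
  have h1 := congrArg (fun L : RR 3 →L[ℝ] RR 3 => L (F.psi' q)) h
  have h2 : F.xi q + F.T q (F.T q (F.xi q)) = F.psi' q := h1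
  rw [zeta, ← h2, add_sub_cancel_right]

theorem inner_X_psi' (q : RR 3 × ℝ) : inner ℝ (F.X q.1) (F.psi' q) = inner ℝ (F.X q.1) (F.X q.1) := by
  rw [psi', inner_add_right, inner_add_right, inner_smul_right, inner_smul_right, F.inner_X_Y,
    F.inner_X_Z, mul_zero, mul_zero, add_zero, add_zero]

/-- If ξ vanished then so would ψ', but its inner product with X is |X|². -/
theorem xi_ne_zero {q : RR 3 × ℝ} (hq : q ∈ F.regularSet) : F.xi q ≠ 0 := by
  intro h
  have h1 := F.xi_eq hq
  rw [zeta, h, map_zero, map_zero, sub_zero] at h1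
  have h2 := F.inner_X_psi' q
  rw [← h1, inner_zero_right] at h2
  exact F.inner_X_X_ne _ h2.symm

/-- The first basic section of the complex tangent bundle, in coordinates. -/
noncomputable def alpha (q : RR 3 × ℝ) : RR 3 × ℝ := (F.xi q, 0)

/-- The second basic section of the complex tangent bundle, in coordinates. -/
noncomputable def beta (q : RR 3 × ℝ) : RR 3 × ℝ := (-F.zeta q, 1)

theorem contDiffOn_alpha : ContDiffOn ℝ ∞ F.alpha F.regularSet :=
  F.contDiffOn_xi.prodMk contDiffOn_const

theorem contDiffOn_beta : ContDiffOn ℝ ∞ F.beta F.regularSet :=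
  F.contDiffOn_zeta.neg.prodMk contDiffOn_const

theorem fderiv_param_alpha (q : RR 3 × ℝ) :
    fderiv ℝ F.param q (F.alpha q) = toC (F.xi q, F.zeta q) := by
  rw [alpha, fderiv_param, zero_smul, add_zero, zeta]

/-- Multiplication by i turns ξ + iζ into -ζ + iξ. This is the image of (-ζ, 1) exactly because ξ =
ψ' - Tζ, which explains the equation (1 + T²)ξ = ψ'. -/
theorem fderiv_param_beta {q : RR 3 × ℝ} (hq : q ∈ F.regularSet) :
    fderiv ℝ F.param q (F.beta q) = Complex.I • fderiv ℝ F.param q (F.alpha q) := by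
  rw [fderiv_param_alpha, I_smul_toC, beta, fderiv_param, one_smul, map_neg]
  congr 2
  rw [F.xi_eq hq]
  abel

/-- A tangent vector `w` with `i w` tangent is a combination of `alpha` and `beta`. -/
theorem eq_of_fderiv_param_eq_I_smul {q : RR 3 × ℝ} (hq : q ∈ F.regularSet) {a b : RR 3 × ℝ}
    (h : fderiv ℝ F.param q a = Complex.I • fderiv ℝ F.param q b) :
    b = a.2 • F.alpha q + b.2 • F.beta q := by
  obtain ⟨a₁, a₂⟩ := a
  obtain ⟨b₁, b₂⟩ := b
  rw [fderiv_param, fderiv_param, I_smul_toC] at h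
  have h1 := congrArg reC h
  have h2 := congrArg imC h
  rw [reC_toC, reC_toC] at h1
  rw [imC_toC, imC_toC] at h2
  have hinj : ∀ v, v + F.T q (F.T q v) = 0 → v = 0 := by
    intro v hv
    have h3 := congrArg (fun L : RR 3 →L[ℝ] RR 3 => L v) (Ring.inverse_mul_cancel _ hq)
    have h4 : Ring.inverse (1 + F.T q * F.T q) (v + F.T q (F.T q v)) = v := h3
    rw [← h4, hv, map_zero]
  have hξ := F.xi_eq hq
  have hψ : F.psi' q = F.xi q + F.T q (F.zeta q) := by rw [hξ]; abel
  have h6 : b₁ + F.T q (F.T q b₁) = a₂ • F.psi' q - b₂ • F.T q (F.psi' q) := by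
    have h7 := congrArg (F.T q) h1
    rw [map_neg, map_add, map_smul] at h7
    rw [h7] at h2
    nth_rewrite 1 [← h2]
    abel
  have h5 := hinj (b₁ - (a₂ • F.xi q - b₂ • F.zeta q)) (by
    have h8 : b₁ - (a₂ • F.xi q - b₂ • F.zeta q) + F.T q (F.T q (b₁ - (a₂ • F.xi q - b₂ • F.zeta q)))
        = b₁ + F.T q (F.T q b₁) - a₂ • (F.xi q + F.T q (F.zeta q)) +
          b₂ • F.T q (F.xi q + F.T q (F.zeta q)) := by
      simp only [map_add, map_sub, map_smul]
      simp only [zeta]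
      module
    rw [h8, h6, ← hψ]
    abel)
  rw [sub_eq_zero] at h5
  simp [alpha, beta, h5, sub_eq_add_neg]

/-- The defining equations of ξ and ζ, restricted to the line s ↦ (x, s), determine their expansion
at the real slice to the order that the double bracket requires. -/
theorem taylor (x : RR 3) : F.xi (x, 0) = F.X x ∧ F.zeta (x, 0) = 0 ∧
    fderiv ℝ F.xi (x, 0) (0, 1) = (2 : ℝ) • F.Y x ∧
    fderiv ℝ F.zeta (x, 0) (0, 1) = fderiv ℝ F.X x (F.X x) ∧
    HasDerivAt (fun s : ℝ => fderiv ℝ F.xi (x, s) (0, 1))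
      ((6 : ℝ) • F.Z x - (2 : ℝ) • fderiv ℝ F.X x (fderiv ℝ F.X x (F.X x))) 0 := by
  have hline : ∀ s : ℝ, HasDerivAt (fun s : ℝ => (x, s)) ((0 : RR 3), (1 : ℝ)) s := fun s =>
    (hasDerivAt_const s x).prodMk (hasDerivAt_id s)
  have hreg : ∀ᶠ s in 𝓝 (0 : ℝ), (x, s) ∈ F.regularSet :=
    (hline 0).continuousAt (F.isOpen_regularSet.mem_nhds (F.mem_regularSet x))
  have hd : ∀ {f : RR 3 × ℝ → RR 3}, ContDiffOn ℝ ∞ f F.regularSet → ∀ᶠ s in 𝓝 (0 : ℝ),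
      HasDerivAt (fun s => f (x, s)) (fderiv ℝ f (x, s) (0, 1)) s := by
    intro f hf
    filter_upwards [hreg] with s hs
    exact ((hf.contDiffAt (F.isOpen_regularSet.mem_nhds hs)).differentiableAt
      (by simp)).hasFDerivAt.comp_hasDerivAt s (hline s)
  have hζ₂ : ∃ z, HasDerivAt (fun s : ℝ => fderiv ℝ F.zeta (x, s) (0, 1)) z 0 := by
    have h1 : DifferentiableAt ℝ (fderiv ℝ F.zeta) (x, 0) :=
      (((F.contDiffOn_zeta.contDiffAt (F.isOpen_regularSet.mem_nhds (F.mem_regularSet x))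
        ).fderiv_right (m := 1) (by norm_cast)).differentiableAt (by simp))
    exact ⟨_, (h1.hasFDerivAt.comp_hasDerivAt (0 : ℝ) (hline 0)).clm_apply
      (hasDerivAt_const (0 : ℝ) ((0 : RR 3), (1 : ℝ)))⟩
  obtain ⟨z, hz⟩ := hζ₂
  exact taylor_of_cubic_system (ξ := fun s => F.xi (x, s)) (ζ := fun s => F.zeta (x, s))
    (ξ₁ := fun s => fderiv ℝ F.xi (x, s) (0, 1)) (ζ₁ := fun s => fderiv ℝ F.zeta (x, s) (0, 1))
    (x := F.X x) (y := F.Y x) (z := F.Z x) (A := fderiv ℝ F.X x) (B := fderiv ℝ F.Y x) (C := fderiv ℝ F.Z x)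
    (hreg.mono fun s hs => F.xi_eq hs) (Eventually.of_forall fun s => rfl) (hd F.contDiffOn_xi)
    (hd F.contDiffOn_zeta) hz

theorem differentiableAt_xi {q : RR 3 × ℝ} (hq : q ∈ F.regularSet) : DifferentiableAt ℝ F.xi q :=
  (F.contDiffOn_xi.contDiffAt (F.isOpen_regularSet.mem_nhds hq)).differentiableAt (by simp)

theorem differentiableAt_zeta {q : RR 3 × ℝ} (hq : q ∈ F.regularSet) :
    DifferentiableAt ℝ F.zeta q :=
  (F.contDiffOn_zeta.contDiffAt (F.isOpen_regularSet.mem_nhds hq)).differentiableAt (by simp)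

theorem differentiableAt_fderiv_xi {q : RR 3 × ℝ} (hq : q ∈ F.regularSet) :
    DifferentiableAt ℝ (fderiv ℝ F.xi) q :=
  ((F.contDiffOn_xi.contDiffAt (F.isOpen_regularSet.mem_nhds hq)).fderiv_right
    (m := 1) (by norm_cast)).differentiableAt (by simp)

theorem differentiableAt_fderiv_zeta {q : RR 3 × ℝ} (hq : q ∈ F.regularSet) :
    DifferentiableAt ℝ (fderiv ℝ F.zeta) q :=
  ((F.contDiffOn_zeta.contDiffAt (F.isOpen_regularSet.mem_nhds hq)).fderiv_right
    (m := 1) (by norm_cast)).differentiableAt (by simp)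

theorem hasFDerivAt_slice (x : RR 3) :
    HasFDerivAt (fun y : RR 3 => (y, (0 : ℝ))) (ContinuousLinearMap.inl ℝ (RR 3) ℝ) x :=
  (hasFDerivAt_id x).prodMk (hasFDerivAt_const (0 : ℝ) x)

theorem fderiv_xi_fst (x v : RR 3) : fderiv ℝ F.xi (x, 0) (v, 0) = fderiv ℝ F.X x v := by
  have h1 : HasFDerivAt (fun y : RR 3 => F.xi (y, 0)) _ x :=
    HasFDerivAt.comp (g := F.xi) x (F.differentiableAt_xi (F.mem_regularSet x)).hasFDerivAt (hasFDerivAt_slice x)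
  have h2 : (fun y : RR 3 => F.xi (y, 0)) = F.X := funext fun y => (F.taylor y).1
  rw [h2] at h1
  rw [h1.fderiv]
  rfl

theorem fderiv_zeta_fst (x v : RR 3) : fderiv ℝ F.zeta (x, 0) (v, 0) = 0 := by
  have h1 : HasFDerivAt (fun y : RR 3 => F.zeta (y, 0)) _ x :=
    HasFDerivAt.comp (g := F.zeta) x (F.differentiableAt_zeta (F.mem_regularSet x)).hasFDerivAt
      (hasFDerivAt_slice x)
  have h2 : (fun y : RR 3 => F.zeta (y, 0)) = fun _ => 0 := funext fun y => (F.taylor y).2.1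
  rw [h2] at h1
  have h3 := h1.unique (hasFDerivAt_const (0 : RR 3) x)
  exact congrArg (fun L => L v) h3

theorem alpha_zero (x : RR 3) : F.alpha (x, 0) = (F.X x, 0) := by
  rw [alpha, (F.taylor x).1]

theorem beta_zero (x : RR 3) : F.beta (x, 0) = (0, 1) := by
  rw [beta, (F.taylor x).2.1, neg_zero]

theorem hasFDerivAt_alpha {q : RR 3 × ℝ} (hq : q ∈ F.regularSet) :
    HasFDerivAt F.alpha ((fderiv ℝ F.xi q).prod 0) q :=
  (F.differentiableAt_xi hq).hasFDerivAt.prodMk (hasFDerivAt_const (0 : ℝ) q)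

theorem hasFDerivAt_beta {q : RR 3 × ℝ} (hq : q ∈ F.regularSet) :
    HasFDerivAt F.beta ((-fderiv ℝ F.zeta q).prod 0) q :=
  (F.differentiableAt_zeta hq).hasFDerivAt.neg.prodMk (hasFDerivAt_const (1 : ℝ) q)

/-- The first component of the bracket of `beta` and `alpha`. -/
noncomputable def bracketFst (q : RR 3 × ℝ) : RR 3 :=
  fderiv ℝ F.xi q (F.beta q) + fderiv ℝ F.zeta q (F.alpha q)

theorem lieBracket_beta_alpha {q : RR 3 × ℝ} (hq : q ∈ F.regularSet) :
    VectorField.lieBracket ℝ F.beta F.alpha q = (F.bracketFst q, 0) := by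
  rw [VectorField.lieBracket, (F.hasFDerivAt_alpha hq).fderiv, (F.hasFDerivAt_beta hq).fderiv]
  simp [bracketFst]

theorem bracketFst_zero (x : RR 3) : F.bracketFst (x, 0) = (2 : ℝ) • F.Y x := by
  rw [bracketFst, alpha_zero, beta_zero, fderiv_zeta_fst, add_zero, (F.taylor x).2.2.1]

/-- Symmetry of second derivatives allows the s-derivative to be taken first. Along the slice it is
DX(X), which is then differentiated tangentially. -/
theorem fderiv_fderiv_zeta (x v : RR 3) :
    fderiv ℝ (fderiv ℝ F.zeta) (x, 0) (0, 1) (v, 0) =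
      fderiv ℝ (fun y => fderiv ℝ F.X y (F.X y)) x v := by
  have hq := F.mem_regularSet x
  have hs : IsSymmSndFDerivAt ℝ F.zeta (x, 0) :=
    (F.contDiffOn_zeta.contDiffAt (F.isOpen_regularSet.mem_nhds hq)).isSymmSndFDerivAt
      (by simp; norm_cast)
  rw [hs.eq]
  have h1 : HasFDerivAt (fun y : RR 3 => fderiv ℝ F.zeta (y, 0)) _ x :=
    HasFDerivAt.comp (g := fderiv ℝ F.zeta) x (F.differentiableAt_fderiv_zeta hq).hasFDerivAt (hasFDerivAt_slice x)
  have h2 := h1.clm_apply (hasFDerivAt_const ((0 : RR 3), (1 : ℝ)) x)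
  have h3 : (fun y : RR 3 => fderiv ℝ F.zeta (y, 0) (0, 1)) =
      fun y => fderiv ℝ F.X y (F.X y) := funext fun y => (F.taylor y).2.2.2.1
  rw [h3] at h2
  rw [h2.fderiv]
  simp

/-- The second s-derivative of ξ contributes 6Z - 2(DX)²X, the derivative of β contributes -(DX)²X,
and the mixed derivative of ζ contributes D(DX X)X. Together these give the coefficient 3. -/
theorem hasDerivAt_bracketFst (x : RR 3) :
    HasDerivAt (fun s : ℝ => F.bracketFst (x, s)) ((6 : ℝ) • F.Z x +
      (fderiv ℝ (fun y => fderiv ℝ F.X y (F.X y)) x (F.X x) -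
      (3 : ℝ) • fderiv ℝ F.X x (fderiv ℝ F.X x (F.X x)))) 0 := by
  have hq := F.mem_regularSet x
  have hline : HasDerivAt (fun s : ℝ => (x, s)) ((0 : RR 3), (1 : ℝ)) 0 :=
    (hasDerivAt_const (0 : ℝ) x).prodMk (hasDerivAt_id (0 : ℝ))
  obtain ⟨t1, t2, t3, t4, t5⟩ := F.taylor x
  have hDxi : HasDerivAt (fun s : ℝ => fderiv ℝ F.xi (x, s)) _ 0 :=
    (F.differentiableAt_fderiv_xi hq).hasFDerivAt.comp_hasDerivAt (0 : ℝ) hline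
  have hDze : HasDerivAt (fun s : ℝ => fderiv ℝ F.zeta (x, s)) _ 0 :=
    (F.differentiableAt_fderiv_zeta hq).hasFDerivAt.comp_hasDerivAt (0 : ℝ) hline
  have ha : HasDerivAt (fun s : ℝ => F.alpha (x, s)) _ 0 :=
    (F.hasFDerivAt_alpha hq).comp_hasDerivAt (0 : ℝ) hline
  have hb : HasDerivAt (fun s : ℝ => F.beta (x, s)) _ 0 :=
    (F.hasFDerivAt_beta hq).comp_hasDerivAt (0 : ℝ) hline
  have h5 := t5.unique (hDxi.clm_apply (hasDerivAt_const (0 : ℝ) ((0 : RR 3), (1 : ℝ))))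
  simp only [map_zero, add_zero] at h5
  refine ((hDxi.clm_apply hb).fun_add (hDze.clm_apply ha)).congr_deriv ?_
  rw [beta_zero, alpha_zero, ← h5, fderiv_fderiv_zeta]
  change (6 : ℝ) • F.Z x - (2 : ℝ) • fderiv ℝ F.X x (fderiv ℝ F.X x (F.X x)) +
    fderiv ℝ F.xi (x, 0) (-fderiv ℝ F.zeta (x, 0) (0, 1), 0) +
    (fderiv ℝ (fun y => fderiv ℝ F.X y (F.X y)) x (F.X x) +
      fderiv ℝ F.zeta (x, 0) (fderiv ℝ F.xi (x, 0) (0, 1), 0)) = _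
  rw [fderiv_xi_fst, fderiv_zeta_fst, t4, map_neg]
  module

/-- On the slice β is the s-direction, so the double bracket is the s-derivative of the single one.
The other term involves a tangential derivative of ζ, which is zero there. -/
theorem lieBracket_beta_lieBracket_zero (x : RR 3) :
    VectorField.lieBracket ℝ F.beta (VectorField.lieBracket ℝ F.beta F.alpha) (x, 0) =
      ((6 : ℝ) • F.Z x + (fderiv ℝ (fun y => fderiv ℝ F.X y (F.X y)) x (F.X x) -
        (3 : ℝ) • fderiv ℝ F.X x (fderiv ℝ F.X x (F.X x))), 0) := by
  have hq := F.mem_regularSet x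
  have hreg := F.isOpen_regularSet.mem_nhds hq
  have hsm : ContDiffOn ℝ ∞ (VectorField.lieBracket ℝ F.beta F.alpha) F.regularSet :=
    contDiffOn_lieBracket F.isOpen_regularSet F.contDiffOn_beta F.contDiffOn_alpha
  have hd : HasFDerivAt (VectorField.lieBracket ℝ F.beta F.alpha)
      (fderiv ℝ (VectorField.lieBracket ℝ F.beta F.alpha) (x, 0)) (x, 0) :=
    ((hsm.contDiffAt hreg).differentiableAt (by simp)).hasFDerivAt
  have hline : HasDerivAt (fun s : ℝ => (x, s)) ((0 : RR 3), (1 : ℝ)) 0 :=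
    (hasDerivAt_const (0 : ℝ) x).prodMk (hasDerivAt_id (0 : ℝ))
  have h1 : HasDerivAt (fun s : ℝ => VectorField.lieBracket ℝ F.beta F.alpha (x, s)) _ 0 :=
    hd.comp_hasDerivAt (0 : ℝ) hline
  have h2 := (F.hasDerivAt_bracketFst x).prodMk (hasDerivAt_const (0 : ℝ) (0 : ℝ))
  have hev : ∀ᶠ s in 𝓝 (0 : ℝ), VectorField.lieBracket ℝ F.beta F.alpha (x, s) =
      (F.bracketFst (x, s), 0) := by
    filter_upwards [hline.continuousAt hreg] with s hs
    exact F.lieBracket_beta_alpha hs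
  have h3 := h1.unique (h2.congr_of_eventuallyEq hev)
  rw [VectorField.lieBracket, F.beta_zero, h3, F.lieBracket_beta_alpha hq, bracketFst_zero,
    (F.hasFDerivAt_beta hq).fderiv]
  simp [fderiv_zeta_fst]

/-- The four fields which span the tangent space. -/
noncomputable def fields (q : RR 3 × ℝ) : Fin 4 → RR 3 × ℝ :=
  ![F.alpha q, F.beta q, VectorField.lieBracket ℝ F.beta F.alpha q,
    VectorField.lieBracket ℝ F.beta (VectorField.lieBracket ℝ F.beta F.alpha) q]

theorem linearIndependent_fields_zero (x : RR 3) : LinearIndependent ℝ (F.fields (x, 0)) := by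
  have h := F.linearIndependent x
  rw [Fintype.linearIndependent_iff] at h ⊢
  intro g hg
  rw [fields, F.alpha_zero, F.beta_zero, F.lieBracket_beta_alpha (F.mem_regularSet x),
    F.bracketFst_zero, F.lieBracket_beta_lieBracket_zero, Fin.sum_univ_four] at hg
  simp only [Matrix.cons_val, Prod.smul_mk, Prod.mk_add_mk, smul_eq_mul, mul_zero, mul_one,
    add_zero, zero_add, smul_zero, Prod.mk_eq_zero] at hg
  obtain ⟨h1, h2⟩ := hg
  have h3 := h ![g 0, 2 * g 2, g 3] (by
    rw [Fin.sum_univ_three]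
    simp only [Matrix.cons_val]
    rw [← h1]
    module)
  intro i
  fin_cases i
  · exact h3 0
  · exact h2
  · have := h3 1
    simpa using this
  · exact h3 2

/-- The set on which the four fields are independent. -/
def goodSet : Set (RR 3 × ℝ) := F.regularSet ∩ F.fields ⁻¹' {f | LinearIndependent ℝ f}

theorem isOpen_goodSet : IsOpen F.goodSet := by
  have h1 := contDiffOn_lieBracket F.isOpen_regularSet F.contDiffOn_beta F.contDiffOn_alpha
  have h2 := contDiffOn_lieBracket F.isOpen_regularSet F.contDiffOn_beta h1
  have hc : ContinuousOn F.fields F.regularSet := by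
    refine continuousOn_pi.2 fun i => ?_
    fin_cases i
    · exact F.contDiffOn_alpha.continuousOn
    · exact F.contDiffOn_beta.continuousOn
    · exact h1.continuousOn
    · exact h2.continuousOn
  exact hc.isOpen_inter_preimage F.isOpen_regularSet isOpen_setOfPred_linearIndependent

theorem span_fields {q : RR 3 × ℝ} (hq : q ∈ F.goodSet) :
    Submodule.span ℝ {F.alpha q, F.beta q, VectorField.lieBracket ℝ F.beta F.alpha q,
      VectorField.lieBracket ℝ F.beta (VectorField.lieBracket ℝ F.beta F.alpha) q} = ⊤ := by
  have h := hq.2.span_eq_top_of_card_eq_finrank (by simp)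
  rw [← h, fields]
  congr 1
  ext v
  simp [Matrix.range_cons]
  tauto

end CRFrame

/-! ### Complex tangent arcs -/

section CRArc

theorem IsCRArc.symm {M : Set C3} {p q : C3} (h : IsCRArc M p q) : IsCRArc M q p := by
  obtain ⟨γ, hγ, h0, h1, hM⟩ := h
  have hmaps : MapsTo (fun s : ℝ => 1 - s) (Icc 0 1) (Icc 0 1) := fun s hs =>
    ⟨by linarith [hs.2], by linarith [hs.1]⟩
  have hder : ∀ s ∈ Icc (0 : ℝ) 1, derivWithin (fun s => γ (1 - s)) (Icc 0 1) s =
      (-1 : ℝ) • derivWithin γ (Icc 0 1) (1 - s) := by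
    intro s hs
    have h1 : HasDerivWithinAt γ (derivWithin γ (Icc 0 1) (1 - s)) (Icc 0 1) (1 - s) :=
      ((hγ.differentiableOn (by simp)) _ (hmaps hs)).hasDerivWithinAt
    have h2 : HasDerivWithinAt (fun s : ℝ => 1 - s) (-1) (Icc 0 1) s := by
      simpa using ((hasDerivAt_id s).const_sub 1).hasDerivWithinAt
    exact (h1.scomp s h2 hmaps).derivWithin (uniqueDiffOn_Icc zero_lt_one s hs)
  refine ⟨fun s => γ (1 - s), hγ.comp (by fun_prop) hmaps, by simp [h1], by simp [h0],
    fun s hs => ⟨(hM _ (hmaps hs)).1, ?_, ?_⟩⟩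
  · rw [hder s hs]
    exact Submodule.smul_mem _ _ (hM _ (hmaps hs)).2.1
  · rw [hder s hs]
    exact smul_ne_zero (by norm_num) (hM _ (hmaps hs)).2.2

theorem equivalence_reflTransGen_isCRArc (M : Set C3) :
    Equivalence (Relation.ReflTransGen (IsCRArc M)) where
  refl _ := Relation.ReflTransGen.refl
  symm h := by
    induction h with
    | refl => exact Relation.ReflTransGen.refl
    | tail _ h ih => exact Relation.ReflTransGen.head h.symm ih
  trans := Relation.ReflTransGen.trans

/-- Images of integral curves of sections of the complex tangent bundle are CR arcs. -/
theorem isCRArc_of_integral_curve {P : Type*} [NormedAddCommGroup P] [NormedSpace ℝ P]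
    [CompleteSpace P] {M : Set C3} {Φ : P → C3} (hΦ : ContDiff ℝ ∞ Φ) {D U : Set P}
    (hDU : D ⊆ U) {V : P → P} (hV : ContDiffOn ℝ ∞ V U) (hM : ∀ q ∈ D, Φ q ∈ M)
    (hT : ∀ q ∈ D, fderiv ℝ Φ q (V q) ∈ complexTangentAt M (Φ q))
    (h0 : ∀ q ∈ D, fderiv ℝ Φ q (V q) ≠ 0) {γ : ℝ → P} {a b : ℝ} (hab : a < b)
    (hγ : ∀ t ∈ Icc a b, γ t ∈ D ∧ HasDerivAt γ (V (γ t)) t) : IsCRArc M (Φ (γ a)) (Φ (γ b)) := by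
  have hmaps : MapsTo (fun s : ℝ => a + s * (b - a)) (Icc 0 1) (Icc a b) := fun s hs =>
    ⟨by nlinarith [hs.1], by nlinarith [hs.2]⟩
  let c : ℝ → P := fun s => γ (a + s * (b - a))
  have hc : ∀ s ∈ Icc (0 : ℝ) 1, HasDerivAt c ((b - a) • V (c s)) s := by
    intro s hs
    have h2 : HasDerivAt (fun s : ℝ => a + s * (b - a)) (b - a) s := by
      simpa using ((hasDerivAt_id s).mul_const (b - a)).const_add a
    exact (hγ _ (hmaps hs)).2.scomp s h2
  have hcD : ∀ s ∈ Icc (0 : ℝ) 1, c s ∈ D := fun s hs => (hγ _ (hmaps hs)).1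
  have hsm : ContDiffOn ℝ ∞ c (Icc 0 1) := by
    -- Integral curves of smooth fields are smooth, by regularity of solutions of differential
    -- equations.
    refine ODE.contDiffOn_enat_Icc_of_hasDerivWithinAt (n := ⊤) (f := fun _ x => (b - a) • V x) (u := U)
      ?_ (fun s hs => (hc s hs).hasDerivWithinAt) fun s hs => hDU (hcD s hs)
    exact (contDiffOn_const (c := b - a)).smul (hV.comp contDiffOn_snd fun x hx => hx.2)
  have hd : ∀ s ∈ Icc (0 : ℝ) 1, derivWithin (fun s => Φ (c s)) (Icc 0 1) s =
      (b - a) • fderiv ℝ Φ (c s) (V (c s)) := by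
    intro s hs
    have h1 := ((hΦ.differentiable (by simp) (c s)).hasFDerivAt.comp_hasDerivAt s
      (hc s hs)).hasDerivWithinAt (s := Icc 0 1)
    rw [map_smul] at h1
    exact h1.derivWithin (uniqueDiffOn_Icc zero_lt_one s hs)
  refine ⟨fun s => Φ (c s), hΦ.comp_contDiffOn hsm, by simp [c], by simp [c], fun s hs =>
    ⟨hM _ (hcD s hs), ?_, ?_⟩⟩
  · rw [hd s hs]
    exact Submodule.smul_mem _ _ (hT _ (hcD s hs))
  · rw [hd s hs]
    exact smul_ne_zero (by linarith) (h0 _ (hcD s hs))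

end CRArc

/-! ### The manifold: CR structure, type and global minimality -/

namespace CRFrame

variable (F : CRFrame) (L : RR 4 ≃L[ℝ] RR 3 × ℝ)

/-- The coordinate domain. -/
def dom : Set (RR 3 × ℝ) := L '' Metric.ball 0 1

/-- The submanifold of `ℂ³` parametrized by an ellipsoid. -/
def manifold : Set C3 := F.param '' dom L

theorem isOpen_dom : IsOpen (dom L) := L.isOpenMap _ Metric.isOpen_ball

theorem isPreconnected_dom : IsPreconnected (dom L) :=
  ((convex_ball (0 : RR 4) 1).isPreconnected).image _ L.continuous.continuousOn

theorem isLocalParam_manifold :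
    IsLocalParam ∞ 4 (F.manifold L) (F.param ∘ L) (Metric.ball 0 1) := by
  have h := isLocalParam_of_leftInverse (Φ := F.param ∘ L) (π := L.symm ∘ F.proj)
    (F.contDiff_param.comp L.contDiff)
    ((L.symm.contDiff.comp F.contDiff_proj).differentiable (n := ∞) (by simp))
    (fun t => by simp [F.proj_param]) (Metric.isOpen_ball (x := (0 : RR 4)) (ε := 1))
  rwa [image_comp] at h

theorem isDiffeoToBall_manifold : IsDiffeoToBall 4 (F.manifold L) :=
  ⟨_, F.isLocalParam_manifold L, by rw [image_comp]; rfl⟩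

theorem isSubmanifold_manifold : IsSubmanifold ∞ 4 (F.manifold L) := by
  refine ⟨?_, fun p hp => ⟨_, _, F.isLocalParam_manifold L, ?_⟩⟩
  · refine IsConnected.image ⟨⟨L 0, mem_image_of_mem _ (by simp)⟩, isPreconnected_dom L⟩ _
      F.contDiff_param.continuous.continuousOn
  · rw [image_comp]
    exact hp

theorem tangentAt_manifold {q : RR 3 × ℝ} (hq : q ∈ dom L) :
    tangentAt (F.manifold L) (F.param q) =
      LinearMap.range (fderiv ℝ F.param q : RR 3 × ℝ →ₗ[ℝ] C3) := by
  obtain ⟨t, ht, rfl⟩ := hq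
  have h := (F.isLocalParam_manifold L).tangentAt_eq_range (by norm_cast) ht
  rw [Function.comp_apply] at h
  rw [h, fderiv_comp t (F.contDiff_param.differentiable (by simp) _)
    L.differentiableAt]
  ext w
  constructor
  · rintro ⟨v, rfl⟩
    exact ⟨L v, by rw [L.fderiv]; rfl⟩
  · rintro ⟨v, rfl⟩
    exact ⟨L.symm v, by rw [L.fderiv]; simp⟩

variable {L}

theorem fderiv_param_injective (q : RR 3 × ℝ) : Function.Injective (fderiv ℝ F.param q) :=
  Function.LeftInverse.injective (g := fderiv ℝ F.proj (F.param q)) fun v =>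
    fderiv_leftInverse_apply (F.contDiff_param.differentiable (by simp))
      (F.contDiff_proj.differentiable (by simp)) F.proj_param q v

theorem mem_complexTangentAt_iff (hL : dom L ⊆ F.goodSet) {q : RR 3 × ℝ} (hq : q ∈ dom L) (w : C3) :
    w ∈ complexTangentAt (F.manifold L) (F.param q) ↔
      ∃ a b : ℝ, w = fderiv ℝ F.param q (a • F.alpha q + b • F.beta q) := by
  have hreg := (hL hq).1
  have hβ := F.fderiv_param_beta hreg
  rw [complexTangentAt, F.tangentAt_manifold L hq, Submodule.mem_inf]
  constructor
  · rintro ⟨⟨a, rfl⟩, _, ⟨b, rfl⟩, hab⟩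
    have h1 : fderiv ℝ F.param q a = Complex.I • fderiv ℝ F.param q b := hab.symm
    have h2 := F.eq_of_fderiv_param_eq_I_smul hreg h1
    -- The vector is i times the image of a.2 α + b.2 β; since i sends α to β and β to -α, the
    -- coefficients become -b.2 and a.2.
    refine ⟨-b.2, a.2, ?_⟩
    change fderiv ℝ F.param q a = _
    rw [h1, congrArg (fderiv ℝ F.param q) h2, map_add, map_add, map_smul, map_smul, map_smul, map_smul, hβ, smul_add]
    simp only [smul_comm Complex.I (_ : ℝ), smul_smul, Complex.I_mul_I]
    simp
    abel
  · rintro ⟨a, b, rfl⟩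
    refine ⟨⟨_, rfl⟩, fderiv ℝ F.param q (b • F.alpha q - a • F.beta q), ⟨_, rfl⟩, ?_⟩
    rw [J_apply, map_sub, map_add, map_smul, map_smul, map_smul, map_smul, hβ, smul_sub]
    simp only [smul_comm Complex.I (_ : ℝ), smul_smul, Complex.I_mul_I]
    simp
    abel

theorem fderiv_alpha_mem (hL : dom L ⊆ F.goodSet) {q : RR 3 × ℝ} (hq : q ∈ dom L) :
    fderiv ℝ F.param q (F.alpha q) ∈ complexTangentAt (F.manifold L) (F.param q) :=
  (F.mem_complexTangentAt_iff hL hq _).2 ⟨1, 0, by simp⟩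

theorem fderiv_beta_mem (hL : dom L ⊆ F.goodSet) {q : RR 3 × ℝ} (hq : q ∈ dom L) :
    fderiv ℝ F.param q (F.beta q) ∈ complexTangentAt (F.manifold L) (F.param q) :=
  (F.mem_complexTangentAt_iff hL hq _).2 ⟨0, 1, by simp⟩

theorem hasCRDim_manifold (hL : dom L ⊆ F.goodSet) : HasCRDim 1 (F.manifold L) := by
  rintro _ ⟨q, hq, rfl⟩
  have hreg := (hL hq).1
  have hli : LinearIndependent ℝ
      ![fderiv ℝ F.param q (F.alpha q), fderiv ℝ F.param q (F.beta q)] := by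
    rw [LinearIndependent.pair_iff]
    intro s t hst
    rw [← map_smul, ← map_smul, ← map_add] at hst
    have h1 := F.fderiv_param_injective q (hst.trans (map_zero _).symm)
    have h2 := congrArg Prod.snd h1
    have h3 := congrArg Prod.fst h1
    simp [alpha, beta] at h2 h3
    rw [h2] at h3
    simp [F.xi_ne_zero hreg] at h3
    exact ⟨h3, h2⟩
  have hspan : complexTangentAt (F.manifold L) (F.param q) = Submodule.span ℝ
      (range ![fderiv ℝ F.param q (F.alpha q), fderiv ℝ F.param q (F.beta q)]) := by
    ext w
    rw [F.mem_complexTangentAt_iff hL hq, Matrix.range_cons, Matrix.range_cons, Matrix.range_empty,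
      union_empty, singleton_union, Submodule.mem_span_pair]
    simp only [map_add, map_smul, eq_comm]
  rw [hspan, finrank_span_eq_card hli]
  rfl

/-- A dimension count: TM and J TM have real dimension 4 and meet in dimension 2, so their sum has
dimension 6. -/
theorem isGeneric_manifold (hL : dom L ⊆ F.goodSet) : IsGeneric (F.manifold L) := by
  intro p hp
  have h2 := F.hasCRDim_manifold hL p hp
  obtain ⟨q, hq, rfl⟩ := hp
  set S := tangentAt (F.manifold L) (F.param q) with hS
  have h4 : Module.finrank ℝ S = 4 := by
    rw [hS, F.tangentAt_manifold L hq, LinearMap.finrank_range_of_inj (F.fderiv_param_injective q)]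
    simp
  have hJ : Function.Injective J := fun v w h => smul_right_injective C3 Complex.I_ne_zero h
  have h5 : Module.finrank ℝ (S.map J) = 4 := by
    rw [← h4]
    exact LinearEquiv.finrank_eq (Submodule.equivMapOfInjective J hJ S).symm
  have h6 := Submodule.finrank_sup_add_finrank_inf_eq S (S.map J)
  rw [h4, h5] at h6
  have h7 : Module.finrank ℝ (S ⊓ S.map J : Submodule ℝ C3) = 2 * 1 := h2
  apply Submodule.eq_top_of_finrank_eq
  have h8 : Module.finrank ℝ C3 = 6 := by
    rw [← Module.finrank_mul_finrank ℝ ℂ C3]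
    simp
  omega

/-- The fields α and β are pushed forward and extended off M by means of the left inverse of the
parametrization. Brackets of related fields are related, so independence in coordinates transfers to
M; length 3 suffices. -/
theorem isOfTypeAt_manifold (hL : dom L ⊆ F.goodSet) :
    ∀ p ∈ F.manifold L, IsOfTypeAt 4 (F.manifold L) p := by
  rintro _ ⟨q, hq, rfl⟩
  have hD := isOpen_dom L
  apply le_antisymm
  · refine Submodule.span_le.2 ?_
    rintro _ ⟨U, k, X, hU, hpU, -, hX, rfl⟩
    exact (hX.mem_tangentAt hU F.contDiff_param F.contDiff_proj F.proj_param hD rfl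
      fun q hq => F.tangentAt_manifold L hq).2 _ ⟨mem_image_of_mem _ hq, hpU⟩
  · have hreg : dom L ⊆ F.regularSet := fun q hq => (hL hq).1
    let U : Set C3 := F.proj ⁻¹' dom L
    have hU : IsOpen U := hD.preimage F.contDiff_proj.continuous
    have hmem : ∀ x ∈ dom L, F.param x ∈ U := fun x hx => by
      change F.proj (F.param x) ∈ dom L
      rwa [F.proj_param]
    let ext : (RR 3 × ℝ → RR 3 × ℝ) → C3 → C3 := fun v z =>
      fderiv ℝ F.param (F.proj z) (v (F.proj z))
    have hext : ∀ v x, ext v (F.param x) = fderiv ℝ F.param x (v x) := fun v x => by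
      simp only [ext, F.proj_param]
    have hextsm : ∀ v, ContDiffOn ℝ ∞ v (dom L) → ContDiffOn ℝ ∞ (ext v) U := by
      intro v hv
      have h1 : ContDiff ℝ ∞ fun z => fderiv ℝ F.param (F.proj z) :=
        (F.contDiff_param.fderiv_right (m := ∞) (by simp)).comp F.contDiff_proj
      exact h1.contDiffOn.clm_apply (hv.comp F.contDiff_proj.contDiffOn fun z hz => hz)
    have hα := F.contDiffOn_alpha.mono hreg
    have hβ := F.contDiffOn_beta.mono hreg
    have hβα := contDiffOn_lieBracket hD hβ hα
    have hMU : ∀ z ∈ F.manifold L ∩ U, ∃ x ∈ dom L, F.param x = z := fun z hz => hz.1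
    have hA : IsCRBracket (F.manifold L) U 1 (ext F.alpha) :=
      .base _ (hextsm _ hα) fun z hz => by
        obtain ⟨x, hx, rfl⟩ := hMU z hz
        rw [hext]
        exact F.fderiv_alpha_mem hL hx
    have hB : IsCRBracket (F.manifold L) U 1 (ext F.beta) :=
      .base _ (hextsm _ hβ) fun z hz => by
        obtain ⟨x, hx, rfl⟩ := hMU z hz
        rw [hext]
        exact F.fderiv_beta_mem hL hx
    have hBA := IsCRBracket.bracket _ _ _ _ hB hA
    have hBBA := IsCRBracket.bracket _ _ _ _ hB hBA
    have hda : ∀ {E : Type} [NormedAddCommGroup E] [NormedSpace ℝ E] {f : E → E} {O : Set E}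
        {x : E}, IsOpen O → ContDiffOn ℝ ∞ f O → x ∈ O → DifferentiableAt ℝ f x :=
      fun hO hf hx => (hf.contDiffAt (hO.mem_nhds hx)).differentiableAt (by simp)
    have hsBA : ContDiffOn ℝ ∞ (VectorField.lieBracket ℝ (ext F.beta) (ext F.alpha)) U :=
      contDiffOn_lieBracket hU (hextsm _ hβ) (hextsm _ hα)
    have e1 : ∀ x ∈ dom L, VectorField.lieBracket ℝ (ext F.beta) (ext F.alpha) (F.param x) =
        fderiv ℝ F.param x (VectorField.lieBracket ℝ F.beta F.alpha x) := fun x hx =>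
      lieBracket_comp_of_related F.contDiff_param.contDiffAt (hda hU (hextsm _ hβ) (hmem x hx))
        (hda hU (hextsm _ hα) (hmem x hx)) (hda hD hβ hx) (hda hD hα hx)
        (Eventually.of_forall (hext _)) (Eventually.of_forall (hext _))
    have e2 : VectorField.lieBracket ℝ (ext F.beta)
        (VectorField.lieBracket ℝ (ext F.beta) (ext F.alpha)) (F.param q) =
        fderiv ℝ F.param q (VectorField.lieBracket ℝ F.beta
          (VectorField.lieBracket ℝ F.beta F.alpha) q) :=
      lieBracket_comp_of_related F.contDiff_param.contDiffAt (hda hU (hextsm _ hβ) (hmem q hq))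
        (hda hU hsBA (hmem q hq)) (hda hD hβ hq) (hda hD hβα hq)
        (Eventually.of_forall (hext _)) (by
          filter_upwards [hD.mem_nhds hq] with x hx
          exact e1 x hx)
    rw [F.tangentAt_manifold L hq, LinearMap.range_eq_map, ← F.span_fields (hL hq),
      Submodule.map_span, Submodule.span_le]
    rintro _ ⟨v, hv, rfl⟩
    rw [mem_insert_iff, mem_insert_iff, mem_insert_iff, mem_singleton_iff] at hv
    refine Submodule.subset_span ?_
    rcases hv with rfl | rfl | rfl | rfl
    · exact ⟨U, 1, _, hU, hmem q hq, by norm_num, hA, hext _ _⟩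
    · exact ⟨U, 1, _, hU, hmem q hq, by norm_num, hB, hext _ _⟩
    · exact ⟨U, _, _, hU, hmem q hq, by norm_num, hBA, e1 q hq⟩
    · exact ⟨U, _, _, hU, hmem q hq, by norm_num, hBBA, e2⟩

/-- By accessibility the classes of joinable points are open in the coordinate domain, which is
connected. -/
theorem isGloballyMinimal_manifold (hL : dom L ⊆ F.goodSet) :
    IsGloballyMinimal (F.manifold L) := by
  have hD := isOpen_dom L
  have hreg : dom L ⊆ F.regularSet := fun q hq => (hL hq).1
  let r : RR 3 × ℝ → RR 3 × ℝ → Prop := fun a b =>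
    Relation.ReflTransGen (IsCRArc (F.manifold L)) (F.param a) (F.param b)
  have hr : Equivalence r :=
    (equivalence_reflTransGen_isCRArc (F.manifold L)).comap F.param
  have hM : ∀ q ∈ dom L, F.param q ∈ F.manifold L := fun q hq => mem_image_of_mem _ hq
  have hne : ∀ q v, v ≠ 0 → fderiv ℝ F.param q v ≠ 0 := fun q v hv h =>
    hv (F.fderiv_param_injective q (h.trans (map_zero _).symm))
  have hα0 : ∀ q ∈ dom L, F.alpha q ≠ 0 := fun q hq h =>
    F.xi_ne_zero (hreg hq) (congrArg Prod.fst h)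
  have hβ0 : ∀ q, F.beta q ≠ 0 := fun q h => one_ne_zero (congrArg Prod.snd h)
  have hloc : ∀ q ∈ dom L, ∀ᶠ y in 𝓝 q, r q y := fun q hq =>
    eventually_equiv_of_span_lieBracket hD (F.contDiffOn_alpha.mono hreg)
      (F.contDiffOn_beta.mono hreg) (fun x _ => hβ0 x) (fun x hx => F.span_fields (hL hx)) hr
      (fun γ a b hab h => Relation.ReflTransGen.single (isCRArc_of_integral_curve F.contDiff_param
        subset_rfl (F.contDiffOn_alpha.mono hreg) hM (fun q hq => F.fderiv_alpha_mem hL hq)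
        (fun q hq => hne q _ (hα0 q hq)) hab h))
      (fun γ a b hab h => Relation.ReflTransGen.single (isCRArc_of_integral_curve F.contDiff_param
        subset_rfl (F.contDiffOn_beta.mono hreg) hM (fun q hq => F.fderiv_beta_mem hL hq)
        (fun q hq => hne q _ (hβ0 q)) hab h)) hq
  rintro _ ⟨a, ha, rfl⟩ _ ⟨b, hb, rfl⟩
  exact (isPreconnected_dom L).induction₂ r (fun x hx => mem_nhdsWithin_of_mem_nhds (hloc x hx))
    (fun x y z _ _ _ h1 h2 => hr.trans h1 h2) (fun x y _ _ h => hr.symm h) ha hb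

end CRFrame

/-! ### The real slice -/

section RealSlice

/-- The inclusion of `ℝ³` into `ℂ³`. -/
noncomputable def realC : RR 3 →L[ℝ] C3 := toC.comp (ContinuousLinearMap.inl ℝ (RR 3) (RR 3))

theorem realC_apply (x : RR 3) : realC x = toC (x, 0) := rfl

@[simp] theorem reC_realC (x : RR 3) : reC (realC x) = x := reC_toC _ _

/-- The open unit ball of `ℝ³`, as a subset of `ℂ³`. -/
noncomputable def realDisc : Set C3 := realC '' Metric.ball 0 1

theorem isLocalParam_realDisc : IsLocalParam ∞ 3 realDisc realC (Metric.ball 0 1) :=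
  isLocalParam_of_leftInverse realC.contDiff reC.differentiable reC_realC Metric.isOpen_ball

theorem isDiffeoToBall_realDisc : IsDiffeoToBall 3 realDisc := ⟨_, isLocalParam_realDisc, rfl⟩

theorem isSubmanifold_realDisc : IsSubmanifold ∞ 3 realDisc := by
  refine ⟨?_, fun p hp => ⟨_, _, isLocalParam_realDisc, hp⟩⟩
  exact IsConnected.image ⟨⟨0, by simp⟩, (convex_ball (0 : RR 3) 1).isPreconnected⟩ _
    realC.continuous.continuousOn

theorem mem_tangentAt_realDisc {x : RR 3} (hx : x ∈ Metric.ball (0 : RR 3) 1) (w : C3) :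
    w ∈ tangentAt realDisc (realC x) ↔ ∃ v, realC v = w := by
  rw [isLocalParam_realDisc.tangentAt_eq_range (by norm_cast) hx, realC.fderiv]
  rfl

theorem isMaximallyReal_realDisc : IsMaximallyReal realDisc := by
  rintro _ ⟨x, hx, rfl⟩
  constructor
  · rw [Submodule.disjoint_def]
    rintro w hw ⟨w', hw', rfl⟩
    obtain ⟨v, hv⟩ := (mem_tangentAt_realDisc hx _).1 hw
    obtain ⟨v', rfl⟩ := (mem_tangentAt_realDisc hx _).1 hw'
    have h1 : toC (v, 0) = toC (-0, v') := by
      rw [← J_toC]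
      exact hv
    have h2 := congrArg reC h1
    rw [reC_toC, reC_toC, neg_zero] at h2
    rw [← hv, h2, map_zero]
  · rw [codisjoint_iff, Submodule.eq_top_iff']
    intro z
    refine Submodule.mem_sup.2 ⟨realC (reC z), (mem_tangentAt_realDisc hx _).2 ⟨_, rfl⟩,
      J (realC (imC z)), ⟨_, (mem_tangentAt_realDisc hx _).2 ⟨_, rfl⟩, rfl⟩, ?_⟩
    rw [realC_apply, realC_apply, J_toC, ← map_add, neg_zero]
    conv_rhs => rw [← toC_reC_imC z]
    simp

theorem tangentAt_mono {S S' : Set C3} (h : S ⊆ S') (p : C3) : tangentAt S p ≤ tangentAt S' p :=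
  Submodule.span_mono fun _ ⟨γ, h0, hS, hd⟩ => ⟨γ, h0, hS.mono fun _ hs => h hs, hd⟩

end RealSlice

/-! ### Level sets crossed transversally by a vector field -/

section LevelSet

variable {E : Type*} [NormedAddCommGroup E] [NormedSpace ℝ E]

/-- Vectors in the kernel of a nonzero differential are velocities of curves in the level set. -/
theorem exists_curve_of_fderiv_eq_zero {ρ : E → ℝ} {ρ' : E →L[ℝ] ℝ} {x X v : E}
    (hρ : HasStrictFDerivAt ρ ρ' x) (hX : ρ' X ≠ 0) (hv : ρ' v = 0) (h0 : ρ x = 0) :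
    ∃ c : ℝ → E, c 0 = x ∧ (∀ᶠ s in 𝓝 0, ρ (c s) = 0) ∧ HasDerivAt c v 0 := by
  -- The line x + sv is corrected by a multiple of X to stay in the level set. The inverse function
  -- theorem supplies the correction, whose derivative vanishes since v is in the kernel.
  let g : ℝ × ℝ → E := fun a => x + (a.1 • v + a.2 • X)
  let g' : ℝ × ℝ →L[ℝ] E := (ContinuousLinearMap.fst ℝ ℝ ℝ).smulRight v +
    (ContinuousLinearMap.snd ℝ ℝ ℝ).smulRight X
  have hg : ∀ a, HasStrictFDerivAt g g' a := fun a => g'.hasStrictFDerivAt.const_add x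
  have hg0 : g 0 = x := by simp [g]
  let f : ℝ × ℝ → ℝ × ℝ := fun a => (a.1, ρ (g a))
  let e : (ℝ × ℝ) ≃L[ℝ] (ℝ × ℝ) := (ContinuousLinearEquiv.refl ℝ ℝ).prodCongr
    (ContinuousLinearEquiv.unitsEquivAut ℝ (Units.mk0 _ hX))
  have hf : HasStrictFDerivAt f (e : ℝ × ℝ →L[ℝ] ℝ × ℝ) 0 := by
    have h1 : HasStrictFDerivAt ρ ρ' (g 0) := by rwa [hg0]
    refine ((hasStrictFDerivAt_fst).prodMk (h1.comp 0 (hg 0))).congr_fderiv ?_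
    refine ContinuousLinearMap.ext fun a => ?_
    simp [e, g', hv]
    rfl
  let inv : ℝ × ℝ → ℝ × ℝ := HasStrictFDerivAt.localInverse f e 0 hf
  have hf0 : f 0 = 0 := by simp [f, hg0, h0]
  have hline : HasDerivAt (fun s : ℝ => (s, (0 : ℝ))) (1, 0) 0 :=
    (hasDerivAt_id (0 : ℝ)).prodMk (hasDerivAt_const (0 : ℝ) (0 : ℝ))
  have hr : ∀ᶠ y in 𝓝 (0 : ℝ × ℝ), f (inv y) = y := by
    have := hf.eventually_right_inverse
    rwa [hf0] at this
  have hinv0 : inv 0 = 0 := by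
    have := hf.localInverse_apply_image
    rwa [hf0] at this
  have hinv : HasFDerivAt inv (e.symm : ℝ × ℝ →L[ℝ] ℝ × ℝ) ((0 : ℝ), (0 : ℝ)) := by
    have := hf.to_localInverse.hasFDerivAt
    rwa [hf0] at this
  refine ⟨fun s => g (inv (s, 0)), ?_, ?_, ?_⟩
  · change g (inv 0) = x
    rw [hinv0, hg0]
  · filter_upwards [hline.continuousAt.eventually hr] with s hs
    exact congrArg Prod.snd hs
  · have h1 := (hg (inv (0, 0))).hasFDerivAt.comp_hasDerivAt (0 : ℝ)
      (HasFDerivAt.comp_hasDerivAt (f := fun s : ℝ => (s, (0 : ℝ))) (0 : ℝ) hinv hline)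
    refine h1.congr_deriv ?_
    have : e.symm (1, 0) = ((1 : ℝ), (0 : ℝ)) := by
      rw [ContinuousLinearEquiv.symm_apply_eq]
      simp [e]
    change g' (e.symm (1, 0)) = v
    rw [this]
    simp [g']

/-- Trajectories of `X` starting near a zero of `ρ` cross the level set `ρ = 0`. -/
theorem exists_flow_crossing [CompleteSpace E] {X : E → E} {x : E} (hX : ContDiffAt ℝ 1 X x)
    {ρ : E → ℝ} (hρ : ContDiff ℝ ∞ ρ) (h0 : ρ x = 0) (hpos : 0 < fderiv ℝ ρ x (X x)) {N : Set E}
    (hN : N ∈ 𝓝 x) :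
    ∀ᶠ y in 𝓝 x, ∃ (c : ℝ → E) (τ t : ℝ), c 0 = y ∧ |t| < τ ∧ ρ (c t) = 0 ∧
      ∀ s ∈ Ioo (-τ) τ, c s ∈ N ∧ HasDerivAt c (X (c s)) s := by
  have hpos' : ∀ᶠ y in 𝓝 x, 0 < fderiv ℝ ρ y (X y) := by
    have h1 : ContinuousAt (fun y => fderiv ℝ ρ y (X y)) x :=
      ((hρ.continuous_fderiv (by simp)).continuousAt).clm_apply hX.continuousAt
    exact h1.eventually (lt_mem_nhds hpos)
  obtain ⟨r, hr, ε, hε, α, L, hα, hlip⟩ := exists_lipschitz_flow hX (inter_mem hN hpos')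
  have hxr : x ∈ Metric.ball x r := Metric.mem_ball_self hr
  have hsub : Icc (-(ε / 2)) (ε / 2) ⊆ Ioo (-ε) ε := fun t ht =>
    ⟨by linarith [ht.1], by linarith [ht.2]⟩
  have hd : ∀ y ∈ Metric.ball x r, ∀ t ∈ Ioo (-ε) ε, HasDerivAt (fun t => ρ (α y t))
      (fderiv ℝ ρ (α y t) (X (α y t))) t := fun y hy t ht =>
    (hρ.differentiable (by simp) _).hasFDerivAt.comp_hasDerivAt t ((hα y hy).2 t ht).2
  have hcont : ∀ y ∈ Metric.ball x r, ContinuousOn (fun t => ρ (α y t)) (Icc (-(ε / 2)) (ε / 2)) :=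
    fun y hy t ht => (hd y hy t (hsub ht)).continuousAt.continuousWithinAt
  have hmono : StrictMonoOn (fun t => ρ (α x t)) (Icc (-(ε / 2)) (ε / 2)) := by
    refine strictMonoOn_of_deriv_pos (convex_Icc _ _) (hcont x hxr) fun t ht => ?_
    have ht' := hsub (interior_subset ht)
    rw [(hd x hxr t ht').deriv]
    exact ((hα x hxr).2 t ht').1.2
  have hx0 : ρ (α x 0) = 0 := by rw [(hα x hxr).1, h0]
  have hplus : 0 < ρ (α x (ε / 2)) := by
    rw [← hx0]
    exact hmono ⟨by linarith, by linarith⟩ ⟨by linarith, le_rfl⟩ (by linarith)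
  have hminus : ρ (α x (-(ε / 2))) < 0 := by
    rw [← hx0]
    exact hmono ⟨le_rfl, by linarith⟩ ⟨by linarith, by linarith⟩ (by linarith)
  have hcy : ∀ t ∈ Ioo (-ε) ε, ContinuousAt (fun y => ρ (α y t)) x := fun t ht =>
    hρ.continuous.continuousAt.comp
      ((hlip t ht).continuousOn.continuousAt (Metric.ball_mem_nhds x hr))
  -- Along the trajectory of x, ρ is negative before and positive after time 0. Nearby trajectories
  -- keep these signs at ±ε/2, so they cross zero in between.
  filter_upwards [Metric.ball_mem_nhds x hr,
    (hcy _ (hsub ⟨by linarith, le_rfl⟩)).eventually (lt_mem_nhds hplus),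
    (hcy _ (hsub ⟨le_rfl, by linarith⟩)).eventually (gt_mem_nhds hminus)] with y hy hy1 hy2
  obtain ⟨t, ht, ht0⟩ := intermediate_value_Icc (by linarith) (hcont y hy) ⟨hy2.le, hy1.le⟩
  refine ⟨α y, ε, t, (hα y hy).1, abs_lt.2 (hsub ht), ht0, fun s hs =>
    ⟨((hα y hy).2 s hs).1.1, ((hα y hy).2 s hs).2⟩⟩

end LevelSet

/-! ### Transversality of the torus and failure of the foliation condition -/

namespace CRFrame

variable (F : CRFrame) {L : RR 4 ≃L[ℝ] RR 3 × ℝ}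

theorem param_zero (x : RR 3) : F.param (x, 0) = realC x := by
  simp [param, psi, realC_apply]

theorem realDisc_subset (hL₁ : ∀ x ∈ Metric.ball (0 : RR 3) 1, (x, (0 : ℝ)) ∈ dom L) :
    realDisc ⊆ F.manifold L := by
  rintro _ ⟨x, hx, rfl⟩
  exact ⟨(x, 0), hL₁ x hx, F.param_zero x⟩

theorem realC_X_mem (hL : dom L ⊆ F.goodSet)
    (hL₁ : ∀ x ∈ Metric.ball (0 : RR 3) 1, (x, (0 : ℝ)) ∈ dom L) {x : RR 3}
    (hx : x ∈ Metric.ball (0 : RR 3) 1) :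
    realC (F.X x) ∈ complexTangentAt (F.manifold L) (realC x) := by
  have h := F.fderiv_alpha_mem hL (hL₁ x hx)
  rw [F.fderiv_param_alpha, F.param_zero, (F.taylor x).1, (F.taylor x).2.1] at h
  exact h

theorem smul_realC_X_mem_charDir (hL : dom L ⊆ F.goodSet)
    (hL₁ : ∀ x ∈ Metric.ball (0 : RR 3) 1, (x, (0 : ℝ)) ∈ dom L) {x : RR 3}
    (hx : x ∈ Metric.ball (0 : RR 3) 1) (a : ℝ) :
    a • realC (F.X x) ∈ charDir (F.manifold L) realDisc (realC x) :=
  Submodule.smul_mem _ _ ⟨(mem_tangentAt_realDisc hx _).2 ⟨_, rfl⟩, F.realC_X_mem hL hL₁ hx⟩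

variable {ρ : RR 3 → ℝ}

/-- The level set `ρ = 0` in the real slice. -/
noncomputable def level (ρ : RR 3 → ℝ) : Set C3 := realC '' {x | ρ x = 0}

theorem level_subset (hb : ∀ x, ρ x = 0 → x ∈ Metric.ball (0 : RR 3) 1) : level ρ ⊆ realDisc :=
  image_mono hb

/-- Subtracting a suitable multiple of X moves any real vector into the kernel of dρ, that is, into
the tangent space of the level set. -/
theorem isCharTransversal_level (hL : dom L ⊆ F.goodSet)
    (hL₁ : ∀ x ∈ Metric.ball (0 : RR 3) 1, (x, (0 : ℝ)) ∈ dom L) (hρ : ContDiff ℝ ∞ ρ)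
    (hb : ∀ x, ρ x = 0 → x ∈ Metric.ball (0 : RR 3) 1)
    (hpos : ∀ x, ρ x = 0 → 0 < fderiv ℝ ρ x (F.X x)) :
    IsCharTransversal (F.manifold L) realDisc (level ρ) := by
  rintro _ ⟨x, hx, rfl⟩
  have hx0 : ρ x = 0 := hx
  have hxb := hb x hx
  refine le_antisymm (sup_le (tangentAt_mono (level_subset hb) _) inf_le_left) fun w hw => ?_
  obtain ⟨v, rfl⟩ := (mem_tangentAt_realDisc hxb _).1 hw
  have hne := (hpos x hx).ne'
  set a := fderiv ℝ ρ x v / fderiv ℝ ρ x (F.X x) with ha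
  have hker : fderiv ℝ ρ x (v - a • F.X x) = 0 := by
    rw [map_sub, map_smul, smul_eq_mul, ha, div_mul_cancel₀ _ hne, sub_self]
  obtain ⟨c, hc0, hc, hcd⟩ := exists_curve_of_fderiv_eq_zero
    (hρ.contDiffAt.hasStrictFDerivAt (by simp)) hne hker hx0
  refine Submodule.mem_sup.2 ⟨realC (v - a • F.X x), Submodule.subset_span
    ⟨fun s => realC (c s), by simp [hc0], hc.mono fun s hs => mem_image_of_mem _ hs,
      realC.hasFDerivAt.comp_hasDerivAt (0 : ℝ) hcd⟩, a • realC (F.X x),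
    F.smul_realC_X_mem_charDir hL hL₁ hxb a, ?_⟩
  rw [map_sub, map_smul, sub_add_cancel]

/-- For C' the whole level set, every trajectory of X starting near γ(0) crosses C' without leaving
V. So all points of R near γ(0) belong to the projection, and γ(0) is not a boundary point. -/
theorem not_nontransversalityCondition (hL : dom L ⊆ F.goodSet)
    (hL₁ : ∀ x ∈ Metric.ball (0 : RR 3) 1, (x, (0 : ℝ)) ∈ dom L) (hρ : ContDiff ℝ ∞ ρ)
    (hb : ∀ x, ρ x = 0 → x ∈ Metric.ball (0 : RR 3) 1)
    (hpos : ∀ x, ρ x = 0 → 0 < fderiv ℝ ρ x (F.X x)) (hne : ∃ x, ρ x = 0) (α : ℝ≥0) :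
    ¬ NontransversalityCondition α (F.manifold L) realDisc (level ρ) := by
  intro h
  obtain ⟨γ, -, -, -, -, hγ0, -, R, V, -, hγR, hRV, -, ⟨O, hO, rfl⟩, -, -, -, hcl⟩ :=
    h (level ρ) (by
      obtain ⟨x, hx⟩ := hne
      exact ⟨_, mem_image_of_mem _ hx⟩) ⟨univ, isClosed_univ, (inter_univ _).symm⟩
  obtain ⟨x, hx, hxγ⟩ := hγ0
  rw [← hxγ] at hcl hγR
  have hxb := hb x hx
  have hN : Metric.ball (0 : RR 3) 1 ∩ realC ⁻¹' O ∈ 𝓝 x :=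
    inter_mem (Metric.isOpen_ball.mem_nhds hxb)
      (realC.continuous.continuousAt (hO.mem_nhds (hRV hγR).2))
  have hcross := exists_flow_crossing (F.contDiff_X.contDiffAt.of_le (by norm_cast)) hρ hx
    (hpos x hx) hN
  have hcross' : ∀ᶠ z in 𝓝 (realC x), ∃ (c : ℝ → RR 3) (τ t : ℝ), c 0 = reC z ∧ |t| < τ ∧
      ρ (c t) = 0 ∧ ∀ s ∈ Ioo (-τ) τ, c s ∈ Metric.ball (0 : RR 3) 1 ∩ realC ⁻¹' O ∧
        HasDerivAt c (F.X (c s)) s := by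
    have h1 : Tendsto reC (𝓝 (realC x)) (𝓝 x) := by
      have := reC.continuous.tendsto (realC x)
      rwa [reC_realC] at this
    exact h1.eventually hcross
  -- A point of R outside the projection, yet so close to γ(0) that its trajectory crosses the level
  -- set.
  obtain ⟨z, ⟨c, τ, t, hc0, ht, hct, hcs⟩, hzR, hz⟩ :=
    (mem_closure_iff_frequently.1 hcl).and_eventually hcross' |>.exists.imp fun _ h => h.symm
  apply hz
  obtain ⟨y, hy, rfl⟩ := (hRV hzR).1
  rw [reC_realC] at hc0
  have hτ : 0 < τ := (abs_nonneg t).trans_lt ht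
  have hmaps : ∀ s ∈ Icc (0 : ℝ) 1, t * (1 - s) ∈ Ioo (-τ) τ := by
    intro s hs
    refine abs_lt.1 (lt_of_le_of_lt ?_ ht)
    rw [abs_mul, abs_of_nonneg (by linarith [hs.2] : (0 : ℝ) ≤ 1 - s)]
    exact mul_le_of_le_one_right (abs_nonneg t) (by linarith [hs.1])
  have htτ : t ∈ Ioo (-τ) τ := abs_lt.1 ht
  refine ⟨hzR, realC (c t), ⟨mem_image_of_mem _ hct, mem_image_of_mem _ (hcs t htτ).1.1,
    (hcs t htτ).1.2⟩, ?_⟩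
  have hder : ∀ s ∈ Icc (0 : ℝ) 1, HasDerivAt (fun s => realC (c (t * (1 - s))))
      ((-t) • realC (F.X (c (t * (1 - s))))) s := by
    intro s hs
    have h1 : HasDerivAt (fun s : ℝ => t * (1 - s)) (-t) s := by
      simpa using ((hasDerivAt_id s).const_sub 1).const_mul t
    have h2 := realC.hasFDerivAt.comp_hasDerivAt s
      ((hcs _ (hmaps s hs)).2.scomp s h1)
    rw [map_smul] at h2
    exact h2
  have hdw : ∀ s ∈ Icc (0 : ℝ) 1, derivWithin (fun s => realC (c (t * (1 - s)))) (Icc 0 1) s =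
      (-t) • realC (F.X (c (t * (1 - s)))) := fun s hs =>
    (hder s hs).hasDerivWithinAt.derivWithin (uniqueDiffOn_Icc zero_lt_one s hs)
  -- The trajectory is run backwards, from the crossing at time t to the point of R at time 0,
  -- because the leaf is taken through the crossing point.
  refine ⟨fun s => realC (c (t * (1 - s))), ?_, by simp, by simp [hc0], fun s hs =>
    ⟨⟨mem_image_of_mem _ (hcs _ (hmaps s hs)).1.1, (hcs _ (hmaps s hs)).1.2⟩, ?_⟩⟩
  · have hcon : ContinuousOn (fun s : ℝ => c (t * (1 - s))) (Icc 0 1) := by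
      intro s hs
      refine ContinuousAt.continuousWithinAt (ContinuousAt.comp (g := c)
        (hcs _ (hmaps s hs)).2.continuousAt ?_)
      fun_prop
    rw [show (1 : WithTop ℕ∞) = 0 + 1 from (zero_add 1).symm,
      contDiffOn_succ_iff_derivWithin (uniqueDiffOn_Icc zero_lt_one)]
    refine ⟨fun s hs => (hder s hs).differentiableAt.differentiableWithinAt, by simp, ?_⟩
    rw [contDiffOn_zero]
    refine ContinuousOn.congr ?_ hdw
    exact (realC.continuous.comp_continuousOn
      (F.contDiff_X.continuous.comp_continuousOn hcon)).const_smul (-t)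
  · rw [hdw s hs]
    exact F.smul_realC_X_mem_charDir hL hL₁ (hcs _ (hmaps s hs)).1.1 (-t)

end CRFrame

/-! ### A thin ellipsoidal coordinate domain -/

section Ellipsoid

/-- The linear isomorphism `(t₀, t₁, t₂, t₃) ↦ ((t₀, t₁, t₂), δ t₃)`. -/
noncomputable def ellipsoidEquiv (δ : ℝ) (hδ : δ ≠ 0) : RR 4 ≃L[ℝ] RR 3 × ℝ :=
  LinearEquiv.toContinuousLinearEquiv
    { toFun := fun t => (WithLp.toLp 2 ![t 0, t 1, t 2], δ * t 3)
      map_add' := fun a b => by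
        refine Prod.ext ?_ (by simp [mul_add])
        ext i
        fin_cases i <;> simp
      map_smul' := fun a b => by
        refine Prod.ext ?_ (by simp [mul_left_comm])
        ext i
        fin_cases i <;> simp
      invFun := fun q => WithLp.toLp 2 ![q.1 0, q.1 1, q.1 2, q.2 / δ]
      left_inv := fun t => by
        ext i
        fin_cases i <;> simp [hδ]
      right_inv := fun q => by
        refine Prod.ext ?_ (by simp; field_simp)
        ext i
        fin_cases i <;> simp }

theorem ellipsoidEquiv_apply {δ : ℝ} (hδ : δ ≠ 0) (t : RR 4) :
    ellipsoidEquiv δ hδ t = (WithLp.toLp 2 ![t 0, t 1, t 2], δ * t 3) := rfl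

theorem dom_ellipsoidEquiv_subset {δ : ℝ} (hδ : 0 < δ) :
    CRFrame.dom (ellipsoidEquiv δ hδ.ne') ⊆ Metric.closedBall (0 : RR 3) 1 ×ˢ Icc (-δ) δ := by
  rintro _ ⟨t, ht, rfl⟩
  rw [mem_ball_zero_iff, EuclideanSpace.norm_eq, Fin.sum_univ_four,
    Real.sqrt_lt' one_pos] at ht
  simp only [Real.norm_eq_abs, sq_abs] at ht
  rw [ellipsoidEquiv_apply]
  refine ⟨?_, ?_⟩
  · rw [mem_closedBall_zero_iff, EuclideanSpace.norm_eq, Fin.sum_univ_three, Real.sqrt_le_one]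
    simp
    nlinarith [sq_nonneg (t 3)]
  · rw [mem_Icc, ← abs_le, abs_mul, abs_of_pos hδ]
    refine mul_le_of_le_one_right hδ.le (abs_le_one_iff_mul_self_le_one.2 ?_)
    nlinarith [sq_nonneg (t 0), sq_nonneg (t 1), sq_nonneg (t 2)]

theorem mem_dom_ellipsoidEquiv {δ : ℝ} (hδ : 0 < δ) (x : RR 3)
    (hx : x ∈ Metric.ball (0 : RR 3) 1) : (x, (0 : ℝ)) ∈ CRFrame.dom (ellipsoidEquiv δ hδ.ne') := by
  refine ⟨WithLp.toLp 2 ![x 0, x 1, x 2, 0], ?_, ?_⟩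
  · rw [mem_ball_zero_iff, EuclideanSpace.norm_eq, Fin.sum_univ_three] at hx
    rw [mem_ball_zero_iff, EuclideanSpace.norm_eq, Fin.sum_univ_four]
    simpa using hx
  · rw [ellipsoidEquiv_apply]
    refine Prod.ext ?_ (by simp)
    ext i
    fin_cases i <;> simp

end Ellipsoid

/-! ### Zeros of h on the manifold and assembly of the example -/

namespace CRFrame

variable (F : CRFrame) {ρ : RR 3 → ℝ} {h : C3 → ℂ}

theorem fderiv_realC (hρ : ContDiff ℝ ∞ ρ) (hhd : Differentiable ℂ h)
    (hρh : ∀ x, h (realC x) = ρ x) (x v : RR 3) :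
    fderiv ℂ h (realC x) (realC v) = (fderiv ℝ ρ x v : ℂ) := by
  have h1 : HasFDerivAt (fun x => h (realC x))
      (((fderiv ℂ h (realC x)).restrictScalars ℝ).comp realC) x :=
    ((hhd (realC x)).hasFDerivAt.restrictScalars ℝ).comp x realC.hasFDerivAt
  have h2 : HasFDerivAt (fun x => (ρ x : ℂ)) (Complex.ofRealCLM.comp (fderiv ℝ ρ x)) x :=
    Complex.ofRealCLM.hasFDerivAt.comp x (hρ.differentiable (by simp) x).hasFDerivAt
  rw [← funext hρh] at h2
  exact congrArg (fun A => A v) (h1.unique h2)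

/-- Near the real slice, `h` vanishes on the manifold only on the real slice. -/
theorem eventually_snd_eq_zero (hρ : ContDiff ℝ ∞ ρ) (hh : ContDiff ℝ ∞ h)
    (hhd : Differentiable ℂ h) (hρh : ∀ x, h (realC x) = ρ x)
    (hpos : ∀ x, ρ x = 0 → 0 < fderiv ℝ ρ x (F.X x)) (x : RR 3) :
    ∀ᶠ q in 𝓝 (x, (0 : ℝ)), h (F.param q) = 0 → q.2 = 0 := by
  by_cases hx : ρ x = 0
  -- Im h vanishes on the real slice, and its s-derivative there is Im(i dρ(X)) = dρ(X) > 0. So it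
  -- is strictly monotone in s, and the only zero on a nearby vertical segment is s = 0.
  · let k : RR 3 × ℝ → ℝ := fun q => (h (F.param q)).im
    have hk : ContDiff ℝ ∞ k := Complex.imCLM.contDiff.comp (hh.comp F.contDiff_param)
    have hk0 : 0 < fderiv ℝ k (x, 0) (0, 1) := by
      have h1 : HasFDerivAt k _ (x, 0) := Complex.imCLM.hasFDerivAt.comp (x, (0 : ℝ))
        (((hhd (F.param (x, 0))).hasFDerivAt.restrictScalars ℝ).comp (x, (0 : ℝ))
          (F.contDiff_param.differentiable (by simp) (x, (0 : ℝ))).hasFDerivAt)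
      rw [h1.fderiv]
      change 0 < (fderiv ℂ h (F.param (x, 0)) (fderiv ℝ F.param (x, 0) (0, 1))).im
      have h2 : fderiv ℝ F.param (x, 0) (0, 1) = Complex.I • realC (F.X x) := by
        rw [F.fderiv_param, realC_apply, I_smul_toC, map_zero]
        simp [psi']
      rw [h2, map_smul, F.param_zero, fderiv_realC hρ hhd hρh]
      simpa using hpos x hx
    have hev : ∀ᶠ q in 𝓝 (x, (0 : ℝ)), 0 < fderiv ℝ k q (0, 1) :=
      (((hk.continuous_fderiv (by simp)).clm_apply continuous_const).continuousAt).eventually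
        (lt_mem_nhds hk0)
    obtain ⟨r, hr, hball⟩ := Metric.mem_nhds_iff.1 hev
    filter_upwards [Metric.ball_mem_nhds _ hr] with q hq hq0
    obtain ⟨y, s⟩ := q
    rw [← ball_prod_same, mem_prod] at hq
    have hd : ∀ σ : ℝ, HasDerivAt (fun σ => k (y, σ)) (fderiv ℝ k (y, σ) (0, 1)) σ := fun σ =>
      (hk.differentiable (by simp) (y, σ)).hasFDerivAt.comp_hasDerivAt σ
        ((hasDerivAt_const σ y).prodMk (hasDerivAt_id σ))
    have hmono : StrictMonoOn (fun σ => k (y, σ)) (Metric.ball 0 r) := by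
      refine strictMonoOn_of_deriv_pos (convex_ball _ _)
        (fun σ _ => (hd σ).continuousAt.continuousWithinAt) fun σ hσ => ?_
      rw [(hd σ).deriv]
      refine hball ?_
      rw [← ball_prod_same]
      exact ⟨hq.1, interior_subset hσ⟩
    have hy0 : k (y, 0) = 0 := by
      simp only [k]
      rw [F.param_zero, hρh, Complex.ofReal_im]
    have hys : k (y, s) = 0 := by
      simp only [k]
      rw [hq0, Complex.zero_im]
    exact hmono.injOn hq.2 (Metric.mem_ball_self hr) (hys.trans hy0.symm)
  · have hne : h (F.param (x, 0)) ≠ 0 := by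
      rw [F.param_zero, hρh]
      exact Complex.ofReal_ne_zero.2 hx
    filter_upwards [(hh.comp F.contDiff_param).continuous.continuousAt.eventually_ne hne]
      with q hq hq0
    exact absurd hq0 hq

/-- Compactness of the closed ball makes the thickness δ uniform. -/
theorem exists_tube_zeros (hρ : ContDiff ℝ ∞ ρ) (hh : ContDiff ℝ ∞ h)
    (hhd : Differentiable ℂ h) (hρh : ∀ x, h (realC x) = ρ x)
    (hpos : ∀ x, ρ x = 0 → 0 < fderiv ℝ ρ x (F.X x)) :
    ∃ δ > 0, ∀ q ∈ Metric.closedBall (0 : RR 3) 1 ×ˢ Icc (-δ) δ,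
      q ∈ F.goodSet ∧ (h (F.param q) = 0 → q.2 = 0) := by
  obtain ⟨u, v, hu, hv, h1, h2, huv⟩ := generalized_tube_lemma (isCompact_closedBall (0 : RR 3) 1)
    (isCompact_singleton (x := (0 : ℝ))) (F.isOpen_goodSet.inter (isOpen_interior (s := {q |
      h (F.param q) = 0 → q.2 = 0}))) (by
      rintro ⟨x, s⟩ ⟨-, hs⟩
      rw [mem_singleton_iff] at hs
      change s = 0 at hs
      rw [hs]
      exact ⟨⟨F.mem_regularSet x, F.linearIndependent_fields_zero x⟩, mem_interior_iff_mem_nhds.2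
        (F.eventually_snd_eq_zero hρ hh hhd hρh hpos x)⟩)
  obtain ⟨δ, hδ, hδv⟩ := Metric.nhds_basis_closedBall.mem_iff.1 (hv.mem_nhds (h2 rfl))
  refine ⟨δ, hδ, fun q hq => ?_⟩
  have h3 := huv (⟨h1 hq.1, hδv (by
    rw [mem_closedBall_zero_iff, Real.norm_eq_abs, abs_le]
    exact hq.2)⟩ : q ∈ u ×ˢ v)
  exact ⟨h3.1, interior_subset h3.2⟩

/-- The nonremovable torus, from a frame and a defining function. -/
theorem exists_nonremovable (hρ : ContDiff ℝ ∞ ρ) (hh : ContDiff ℝ ∞ h)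
    (hhd : Differentiable ℂ h) (hρh : ∀ x, h (realC x) = ρ x)
    (hpos : ∀ x, ρ x = 0 → 0 < fderiv ℝ ρ x (F.X x))
    (hb : ∀ x, ρ x = 0 → x ∈ Metric.ball (0 : RR 3) 1) (h0 : ρ 0 ≠ 0) (hne : ∃ x, ρ x = 0)
    (htorus : IsDiffeoToTorus (level ρ)) :
    ∃ M M1 C : Set C3,
      (IsSubmanifold ∞ 4 M ∧ IsGeneric M ∧ HasCRDim 1 M ∧ IsDiffeoToBall 4 M) ∧
      (M1 ⊆ M ∧ IsSubmanifold ∞ 3 M1 ∧ IsMaximallyReal M1 ∧ IsDiffeoToBall 3 M1) ∧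
      (C ⊆ M1 ∧ IsCompact C ∧ IsDiffeoToTorus C ∧ IsCharTransversal M M1 C ∧
        ∀ α : ℝ≥0, 0 < α → α < 1 → ¬ NontransversalityCondition α M M1 C) ∧
      ((∀ p ∈ M, IsOfTypeAt 4 M p) ∧ IsGloballyMinimal M) ∧
      ¬ IsCRRemovable M C ∧
      ¬ IsWRemovable M C ∧
      ∀ p : ℝ≥0∞, 1 ≤ p → p < 2 → ¬ IsLpRemovable p M C := by
  obtain ⟨δ, hδ, htube⟩ := F.exists_tube_zeros hρ hh hhd hρh hpos
  let L := ellipsoidEquiv δ hδ.ne'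
  have hsub := dom_ellipsoidEquiv_subset hδ
  have hL : dom L ⊆ F.goodSet := fun q hq => (htube q (hsub hq)).1
  have hL₁ : ∀ x ∈ Metric.ball (0 : RR 3) 1, (x, (0 : ℝ)) ∈ dom L := mem_dom_ellipsoidEquiv hδ
  have hM1 := F.realDisc_subset hL₁
  have hCM1 : level ρ ⊆ realDisc := level_subset hb
  have hC : level ρ = {p ∈ F.manifold L | h p = 0} := by
    ext p
    constructor
    · rintro ⟨x, hx, rfl⟩
      refine ⟨hM1 (hCM1 (mem_image_of_mem _ hx)), ?_⟩
      rw [hρh, show ρ x = 0 from hx, Complex.ofReal_zero]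
    · rintro ⟨⟨q, hq, rfl⟩, hp⟩
      have hq2 := (htube q (hsub hq)).2 hp
      have hq' : q = (q.1, 0) := Prod.ext rfl hq2
      rw [hq', F.param_zero] at hp ⊢
      rw [hρh, Complex.ofReal_eq_zero] at hp
      exact mem_image_of_mem _ hp
  have hCne : (level ρ).Nonempty := by
    obtain ⟨x, hx⟩ := hne
    exact ⟨_, mem_image_of_mem _ hx⟩
  have hreg : ∀ p ∈ level ρ, IsCRRegularAt (F.manifold L) h p := by
    rintro _ ⟨x, hx, rfl⟩
    refine ⟨realC (F.X x), F.realC_X_mem hL hL₁ (hb x hx), ?_⟩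
    rw [fderiv_realC hρ hhd hρh]
    exact Complex.ofReal_ne_zero.2 (hpos x hx).ne'
  have hcompact : IsCompact (level ρ) := by
    obtain ⟨Ψ, hΨ, -, -, hr⟩ := htorus
    rw [← hr]
    exact isCompact_range hΨ.continuous
  obtain ⟨r, hr, hrb⟩ : ∃ r > 0, realBall r ⊆ F.manifold L \ level ρ := by
    have hev : ∀ᶠ z in 𝓝 (0 : C3), reC z ∈ Metric.ball (0 : RR 3) 1 ∧ ρ (reC z) ≠ 0 := by
      have h1 : Tendsto reC (𝓝 0) (𝓝 0) := by
        have := reC.continuous.tendsto 0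
        rwa [map_zero] at this
      exact (h1.eventually (Metric.ball_mem_nhds _ one_pos)).and
        (h1.eventually (hρ.continuous.continuousAt.eventually_ne h0))
    obtain ⟨r, hr, hrb⟩ := Metric.mem_nhds_iff.1 hev
    refine ⟨r, hr, fun z hz => ?_⟩
    have hz' : reC z ∈ Metric.ball (0 : RR 3) 1 ∧ ρ (reC z) ≠ 0 := hrb (mem_ball_zero_iff.2 hz.2)
    have hzr : z = realC (reC z) := by
      ext j
      rw [realC_apply, toC_apply, reC_apply]
      apply Complex.ext <;> simp [hz.1 j]
    refine ⟨?_, ?_⟩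
    · rw [hzr]
      exact hM1 (mem_image_of_mem _ hz'.1)
    · rintro ⟨x, hx, hxz⟩
      rw [← hxz, reC_realC] at hz'
      exact hz'.2 hx
  have hsm := F.isSubmanifold_manifold L
  exact ⟨F.manifold L, realDisc, level ρ,
    ⟨hsm, F.isGeneric_manifold hL, F.hasCRDim_manifold hL, F.isDiffeoToBall_manifold L⟩,
    ⟨hM1, isSubmanifold_realDisc, isMaximallyReal_realDisc, isDiffeoToBall_realDisc⟩,
    ⟨hCM1, hcompact, htorus, F.isCharTransversal_level hL hL₁ hρ hb hpos,
      fun α _ _ => F.not_nontransversalityCondition hL hL₁ hρ hb hpos hne α⟩,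
    ⟨F.isOfTypeAt_manifold hL, F.isGloballyMinimal_manifold hL⟩,
    not_isCRRemovable hsm hh hhd hC hCne hreg hr hrb,
    not_isWRemovable hsm hh hhd hC hCne hreg ⟨0, hrb ⟨by simp, by simpa⟩⟩,
    fun p hp1 hp2 => not_isLpRemovable hsm (F.isGeneric_manifold hL) hh hhd hC hCne hreg hp1 hp2⟩

end CRFrame

/-! ### Frames from orthogonal vector fields -/

section Orthogonal

/-- An orthogonal frame of smooth vector fields gives a `CRFrame`, after rescaling the last one. -/
noncomputable def CRFrame.ofOrthogonal (X Y Z : RR 3 → RR 3) (hX : ContDiff ℝ ∞ X)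
    (hY : ContDiff ℝ ∞ Y) (hZ : ContDiff ℝ ∞ Z) (hXY : ∀ x, inner ℝ (X x) (Y x) = 0)
    (hXZ : ∀ x, inner ℝ (X x) (Z x) = 0) (hYZ : ∀ x, inner ℝ (Y x) (Z x) = 0)
    (hX0 : ∀ x, X x ≠ 0) (hY0 : ∀ x, Y x ≠ 0) (hZ0 : ∀ x, Z x ≠ 0) : CRFrame where
  X := X
  Y := Y
  -- The factor is chosen so that the double bracket has inner product |Z|² with the original Z,
  -- whatever the contribution of the derivatives of X.
  Z x := ((inner ℝ (Z x) (Z x) - inner ℝ (Z x) (fderiv ℝ (fun y => fderiv ℝ X y (X y)) x (X x) -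
      (3 : ℝ) • fderiv ℝ X x (fderiv ℝ X x (X x)))) / (6 * inner ℝ (Z x) (Z x))) • Z x
  contDiff_X := hX
  contDiff_Y := hY
  contDiff_Z := by
    have h1 : ContDiff ℝ ∞ fun x => fderiv ℝ X x := hX.fderiv_right (by simp)
    have h2 : ContDiff ℝ ∞ fun x => fderiv ℝ X x (X x) := h1.clm_apply hX
    have h3 : ContDiff ℝ ∞ fun x => fderiv ℝ (fun y => fderiv ℝ X y (X y)) x (X x) :=
      (h2.fderiv_right (by simp)).clm_apply hX
    have h4 : ContDiff ℝ ∞ fun x => fderiv ℝ X x (fderiv ℝ X x (X x)) := h1.clm_apply h2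
    have h5 := h3.sub (h4.const_smul (3 : ℝ))
    refine ContDiff.smul (ContDiff.div ((hZ.inner ℝ hZ).sub (hZ.inner ℝ h5))
      (contDiff_const.mul (hZ.inner ℝ hZ)) fun x => ?_) hZ
    exact mul_ne_zero (by norm_num) fun h => hZ0 x (inner_self_eq_zero.1 h)
  inner_X_Y := hXY
  inner_X_Z x := by rw [inner_smul_right, hXZ, mul_zero]
  linearIndependent x := by
    set W := fderiv ℝ (fun y => fderiv ℝ X y (X y)) x (X x) -
      (3 : ℝ) • fderiv ℝ X x (fderiv ℝ X x (X x))
    have hZZ : inner ℝ (Z x) (Z x) ≠ 0 := fun h => hZ0 x (inner_self_eq_zero.1 h)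
    have hXX : inner ℝ (X x) (X x) ≠ 0 := fun h => hX0 x (inner_self_eq_zero.1 h)
    have hYY : inner ℝ (Y x) (Y x) ≠ 0 := fun h => hY0 x (inner_self_eq_zero.1 h)
    rw [Fintype.linearIndependent_iff]
    intro g hg
    rw [Fin.sum_univ_three] at hg
    simp only [Matrix.cons_val] at hg
    have hg2 : g 2 = 0 := by
      have h1 := congrArg (fun v => inner ℝ (Z x) v) hg
      simp only [inner_add_right, inner_smul_right, inner_zero_right] at h1
      rw [real_inner_comm (X x) (Z x), real_inner_comm (Y x) (Z x), hXZ, hYZ] at h1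
      have h2 : g 2 * inner ℝ (Z x) (Z x) = 0 := by
        rw [← h1]
        field_simp
        ring
      exact (mul_eq_zero.1 h2).resolve_right hZZ
    rw [hg2, zero_smul, add_zero] at hg
    have hg0 : g 0 = 0 := by
      have h1 := congrArg (fun v => inner ℝ (X x) v) hg
      simp only [inner_add_right, inner_smul_right, inner_zero_right, hXY, mul_zero, add_zero] at h1
      exact (mul_eq_zero.1 h1).resolve_right hXX
    have hg1 : g 1 = 0 := by
      have h1 := congrArg (fun v => inner ℝ (Y x) v) hg
      simp only [inner_add_right, inner_smul_right, inner_zero_right, hg0, zero_mul, zero_add] at h1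
      exact (mul_eq_zero.1 h1).resolve_right hYY
    intro i
    fin_cases i
    · exact hg0
    · exact hg1
    · exact hg2

end Orthogonal

/-! ### The frame and the torus -/

section TorusFrame

/-- `f = 4 (x² + y²) - 1`. -/
def torusF (x : RR 3) : ℝ := 4 * (x 0 ^ 2 + x 1 ^ 2) - 1

/-- The defining function `f² + z² - 1 / 4` of the torus. -/
noncomputable def torusRho (x : RR 3) : ℝ := torusF x ^ 2 + x 2 ^ 2 - 1 / 4

/-- Stereographic coordinates of the frame. -/
def frameP (x : RR 3) : ℝ := 2 * (torusF x * x 0 - x 1)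

/-- Stereographic coordinates of the frame. -/
def frameW (x : RR 3) : ℝ := 2 * (torusF x * x 1 + x 0)

/-- Stereographic coordinates of the frame. -/
noncomputable def frameN (x : RR 3) : ℝ := 1 - x 2 / 2 + x 2 ^ 2 / 4

/-- The first vector field of the frame, transversal to the torus. -/
noncomputable def frameX (x : RR 3) : RR 3 := WithLp.toLp 2 ![2 * frameP x * frameN x,
  2 * frameW x * frameN x, frameP x ^ 2 + frameW x ^ 2 - frameN x ^ 2]

/-- The second vector field of the frame. -/
noncomputable def frameY (x : RR 3) : RR 3 := WithLp.toLp 2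
  ![frameN x ^ 2 + frameW x ^ 2 - frameP x ^ 2, -2 * frameW x * frameP x, 2 * frameN x * frameP x]

/-- The third vector field of the frame. -/
noncomputable def frameZ (x : RR 3) : RR 3 := WithLp.toLp 2
  ![-2 * frameW x * frameP x, frameN x ^ 2 - frameW x ^ 2 + frameP x ^ 2, 2 * frameN x * frameW x]

/-- Positivity keeps the direction of `frameX` away from the north pole, so stereographic
coordinates serve on all of ℝ³. -/
theorem frameN_pos (x : RR 3) : 0 < frameN x := by
  unfold frameN
  nlinarith [sq_nonneg (x 2 - 1)]

theorem contDiff_torusF : ContDiff ℝ ∞ torusF := by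
  unfold torusF
  fun_prop

theorem contDiff_torusRho : ContDiff ℝ ∞ torusRho :=
  ((contDiff_torusF.pow 2).add (by fun_prop)).sub contDiff_const

theorem contDiff_frameP : ContDiff ℝ ∞ frameP :=
  contDiff_const.mul ((contDiff_torusF.mul (by fun_prop)).sub (by fun_prop))

theorem contDiff_frameW : ContDiff ℝ ∞ frameW :=
  contDiff_const.mul ((contDiff_torusF.mul (by fun_prop)).add (by fun_prop))

theorem contDiff_frameN : ContDiff ℝ ∞ frameN := by
  unfold frameN
  fun_prop

theorem contDiff_toLp_three {a b c : RR 3 → ℝ} (ha : ContDiff ℝ ∞ a) (hb : ContDiff ℝ ∞ b)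
    (hc : ContDiff ℝ ∞ c) :
    ContDiff ℝ ∞ fun x => (WithLp.toLp 2 ![a x, b x, c x] : RR 3) := by
  rw [contDiff_euclidean]
  intro i
  fin_cases i
  · exact ha
  · exact hb
  · exact hc

theorem inner_toLp_three (a b c a' b' c' : ℝ) :
    inner ℝ (WithLp.toLp 2 ![a, b, c] : RR 3) (WithLp.toLp 2 ![a', b', c']) =
      a * a' + b * b' + c * c' := by
  simp [PiLp.inner_apply, Fin.sum_univ_three]
  ring

theorem ne_zero_of_inner_self {v : RR 3} {N : ℝ} (hN : 0 < N) (h : inner ℝ v v = N ^ 2) : v ≠ 0 := by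
  rintro rfl
  rw [inner_zero_left] at h
  exact (pow_ne_zero 2 hN.ne') h.symm

/-- This sum is the common length of the three frame fields. -/
theorem frameNorm_pos (x : RR 3) : 0 < frameP x ^ 2 + frameW x ^ 2 + frameN x ^ 2 := by
  have := frameN_pos x
  positivity

/-- The frame used in the construction. -/
noncomputable def torusFrame : CRFrame :=
  CRFrame.ofOrthogonal frameX frameY frameZ
    (contDiff_toLp_three ((contDiff_const.mul contDiff_frameP).mul contDiff_frameN)
      ((contDiff_const.mul contDiff_frameW).mul contDiff_frameN)
      (((contDiff_frameP.pow 2).add (contDiff_frameW.pow 2)).sub (contDiff_frameN.pow 2)))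
    (contDiff_toLp_three
      (((contDiff_frameN.pow 2).add (contDiff_frameW.pow 2)).sub (contDiff_frameP.pow 2))
      ((contDiff_const.mul contDiff_frameW).mul contDiff_frameP)
      ((contDiff_const.mul contDiff_frameN).mul contDiff_frameP))
    (contDiff_toLp_three ((contDiff_const.mul contDiff_frameW).mul contDiff_frameP)
      (((contDiff_frameN.pow 2).sub (contDiff_frameW.pow 2)).add (contDiff_frameP.pow 2))
      ((contDiff_const.mul contDiff_frameN).mul contDiff_frameW))
    (fun x => by rw [frameX, frameY, inner_toLp_three]; ring)
    (fun x => by rw [frameX, frameZ, inner_toLp_three]; ring)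
    (fun x => by rw [frameY, frameZ, inner_toLp_three]; ring)
    (fun x => ne_zero_of_inner_self (frameNorm_pos x) (by rw [frameX, inner_toLp_three]; ring))
    (fun x => ne_zero_of_inner_self (frameNorm_pos x) (by rw [frameY, inner_toLp_three]; ring))
    (fun x => ne_zero_of_inner_self (frameNorm_pos x) (by rw [frameZ, inner_toLp_three]; ring))

theorem fderiv_torusRho (x v : RR 3) :
    fderiv ℝ torusRho x v = 16 * torusF x * (x 0 * v 0 + x 1 * v 1) + 2 * x 2 * v 2 := by
  have hc : ∀ i : Fin 3, HasFDerivAt (fun x : RR 3 => x i)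
      (EuclideanSpace.proj i : RR 3 →L[ℝ] ℝ) x := fun i =>
    (EuclideanSpace.proj i : RR 3 →L[ℝ] ℝ).hasFDerivAt
  have hf : HasFDerivAt torusF _ x :=
    ((((hc 0).pow 2).fun_add ((hc 1).pow 2)).const_mul 4).sub_const 1
  have hρ : HasFDerivAt torusRho _ x := ((hf.pow 2).fun_add ((hc 2).pow 2)).sub_const (1 / 4)
  rw [hρ.fderiv]
  simp
  ring

theorem torusRho_bounds {x : RR 3} (hx : torusRho x = 0) :
    |torusF x| ≤ 1 / 2 ∧ |x 2| ≤ 1 / 2 := by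
  unfold torusRho at hx
  constructor <;> refine abs_le_of_sq_le_sq ?_ (by norm_num)
  · nlinarith [sq_nonneg (x 2)]
  · nlinarith [sq_nonneg (torusF x)]

/-- The first field of the frame is transversal to the torus. -/
theorem fderiv_torusRho_pos {x : RR 3} (hx : torusRho x = 0) :
    0 < fderiv ℝ torusRho x (frameX x) := by
  obtain ⟨hf, hz⟩ := torusRho_bounds hx
  rw [abs_le] at hf hz
  have hρ : torusF x ^ 2 + x 2 ^ 2 = 1 / 4 := by
    unfold torusRho at hx
    linarith
  rw [fderiv_torusRho]
  have hsq : x 0 ^ 2 + x 1 ^ 2 = (1 + torusF x) / 4 := by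
    unfold torusF
    ring
  -- On x² + y² = (1 + f)/4, the radial component xP + yW is f(1 + f)/2 and P² + W² is (1 + f²)(1 +
  -- f).
  have hE : 16 * torusF x * (x 0 * frameX x 0 + x 1 * frameX x 1) + 2 * x 2 * frameX x 2 =
      torusF x ^ 2 * ((1 + torusF x) * (16 * frameN x + 2 * x 2)) + 2 * x 2 * torusF x +
        2 * x 2 * (1 - frameN x ^ 2) := by
    have h0 : frameX x 0 = 2 * frameP x * frameN x := rfl
    have h1 : frameX x 1 = 2 * frameW x * frameN x := rfl
    have h2 : frameX x 2 = frameP x ^ 2 + frameW x ^ 2 - frameN x ^ 2 := rfl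
    rw [h0, h1, h2, frameP, frameW]
    generalize frameN x = n
    linear_combination (64 * torusF x ^ 2 * n + 8 * x 2 * (torusF x ^ 2 + 1)) * hsq
  rw [hE]
  set f := torusF x
  set z := x 2
  have hn : frameN x = 1 - z / 2 + z ^ 2 / 4 := rfl
  have hA : 7 ≤ (1 + f) * (16 * frameN x + 2 * z) := by
    rw [hn]
    have h1 : 14 ≤ 16 * (1 - z / 2 + z ^ 2 / 4) + 2 * z := by nlinarith
    nlinarith
  have hB : z ^ 2 ≤ 2 * z * (1 - frameN x ^ 2) := by
    have h1 : 2 * z * (1 - frameN x ^ 2) = z ^ 2 * ((2 - z) * (2 - z / 2 + z ^ 2 / 4) / 2) := by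
      rw [hn]
      ring
    rw [h1]
    have h2 : 1 ≤ (2 - z) * (2 - z / 2 + z ^ 2 / 4) / 2 := by
      have h3 : (3 / 2 : ℝ) ≤ 2 - z := by linarith
      have h4 : (7 / 4 : ℝ) ≤ 2 - z / 2 + z ^ 2 / 4 := by nlinarith [sq_nonneg z]
      nlinarith
    nlinarith [sq_nonneg z]
  -- The total is at least 7f² + 2fz + z², a positive definite form, and (f, z) ≠ 0 on the torus.
  nlinarith [sq_nonneg (f + z / 2), sq_nonneg z, sq_nonneg f, mul_le_mul_of_nonneg_left hA (sq_nonneg f)]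

theorem mem_ball_of_torusRho {x : RR 3} (hx : torusRho x = 0) : x ∈ Metric.ball (0 : RR 3) 1 := by
  rw [mem_ball_zero_iff, EuclideanSpace.norm_eq, Fin.sum_univ_three, Real.sqrt_lt' one_pos]
  simp only [Real.norm_eq_abs, sq_abs]
  have hsq : x 0 ^ 2 + x 1 ^ 2 = (1 + torusF x) / 4 := by
    unfold torusF
    ring
  unfold torusRho at hx
  -- On the torus the squared norm is 1/2 + f/4 - f², which is largest at f = 1/8 and stays below 1.
  nlinarith [sq_nonneg (torusF x - 1 / 8)]

/-- The entire function which restricts to `torusRho` on `ℝ³`. -/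
noncomputable def torusH (z : C3) : ℂ := (4 * (z 0 ^ 2 + z 1 ^ 2) - 1) ^ 2 + z 2 ^ 2 - 1 / 4

theorem differentiable_torusH : Differentiable ℂ torusH := by
  unfold torusH
  fun_prop

theorem contDiff_torusH : ContDiff ℝ ∞ torusH := by
  unfold torusH
  fun_prop

theorem torusH_realC (x : RR 3) : torusH (realC x) = torusRho x := by
  have h : ∀ j, realC x j = (x j : ℂ) := fun j => by simp [realC_apply, toC_apply]
  rw [torusH, h, h, h, torusRho, torusF]
  push_cast
  ring

/-- The standard parametrization of the torus. -/
noncomputable def torusPoint (a b : ℂ) : RR 3 :=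
  WithLp.toLp 2 ![√(1 + b.re / 2) / 2 * a.re, √(1 + b.re / 2) / 2 * a.im, b.im / 2]

theorem re_sq_add_im_sq (a : Circle) : (a : ℂ).re ^ 2 + (a : ℂ).im ^ 2 = 1 := by
  have := Circle.normSq_coe a
  rw [Complex.normSq_apply] at this
  linarith

theorem one_add_re_pos (b : Circle) : 0 < 1 + (b : ℂ).re / 2 := by
  nlinarith [re_sq_add_im_sq b, sq_nonneg (b : ℂ).im, sq_nonneg ((b : ℂ).re + 1)]

theorem torusPoint_sq (a b : Circle) :
    torusPoint a b 0 ^ 2 + torusPoint a b 1 ^ 2 = (1 + (b : ℂ).re / 2) / 4 := by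
  have h0 : torusPoint a b 0 = √(1 + (b : ℂ).re / 2) / 2 * (a : ℂ).re := rfl
  have h1 : torusPoint a b 1 = √(1 + (b : ℂ).re / 2) / 2 * (a : ℂ).im := rfl
  have hs := Real.sq_sqrt (one_add_re_pos b).le
  rw [h0, h1]
  linear_combination (√(1 + (b : ℂ).re / 2) ^ 2 / 4) * re_sq_add_im_sq a + hs / 4

theorem torusF_torusPoint (a b : Circle) : torusF (torusPoint a b) = (b : ℂ).re / 2 := by
  rw [torusF, torusPoint_sq]
  ring

theorem torusRho_torusPoint (a b : Circle) : torusRho (torusPoint a b) = 0 := by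
  rw [torusRho, torusF_torusPoint]
  have h2 : torusPoint a b 2 = (b : ℂ).im / 2 := rfl
  rw [h2]
  linear_combination re_sq_add_im_sq b / 4

/-- Recovers the first angle of a point of the torus. -/
noncomputable def torusFst (z : C3) : ℂ :=
  (√((z 0).re ^ 2 + (z 1).re ^ 2))⁻¹ • (((z 0).re : ℂ) + Complex.I * ((z 1).re : ℂ))

/-- Recovers the second angle of a point of the torus. -/
noncomputable def torusSnd (z : C3) : ℂ :=
  ((2 * (4 * ((z 0).re ^ 2 + (z 1).re ^ 2) - 1) : ℝ) : ℂ) + Complex.I * ((2 * (z 2).re : ℝ) : ℂ)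

theorem realC_re (x : RR 3) (j : Fin 3) : (realC x j).re = x j := by
  simp [realC_apply, toC_apply]

theorem torusSnd_torusPoint (a b : Circle) : torusSnd (realC (torusPoint a b)) = b := by
  rw [torusSnd, realC_re, realC_re, realC_re, torusPoint_sq]
  have h2 : torusPoint a b 2 = (b : ℂ).im / 2 := rfl
  rw [h2]
  apply Complex.ext <;> simp <;> ring

theorem torusFst_torusPoint (a b : Circle) : torusFst (realC (torusPoint a b)) = a := by
  rw [torusFst, realC_re, realC_re, torusPoint_sq]
  have hp := one_add_re_pos b
  have h0 : torusPoint a b 0 = √(1 + (b : ℂ).re / 2) / 2 * (a : ℂ).re := rfl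
  have h1 : torusPoint a b 1 = √(1 + (b : ℂ).re / 2) / 2 * (a : ℂ).im := rfl
  have hs : √((1 + (b : ℂ).re / 2) / 4) = √(1 + (b : ℂ).re / 2) / 2 := by
    rw [Real.sqrt_div hp.le, show (4 : ℝ) = 2 ^ 2 by norm_num, Real.sqrt_sq (by norm_num)]
  have hne : ((√(1 + (b : ℂ).re / 2) / 2 : ℝ) : ℂ) ≠ 0 :=
    Complex.ofReal_ne_zero.2 (by have := Real.sqrt_pos.2 hp; positivity)
  rw [hs, Complex.real_smul, Complex.ofReal_inv, inv_mul_eq_iff_eq_mul₀ hne, h0, h1, Complex.ofReal_mul, Complex.ofReal_mul]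
  conv_rhs => rw [← Complex.re_add_im (a : ℂ)]
  ring

theorem differentiable_torusSnd : Differentiable ℝ torusSnd := by
  have hre : ∀ j : Fin 3, Differentiable ℝ fun z : C3 => (z j).re := fun j =>
    (Complex.reCLM.comp (ContinuousLinearMap.proj (R := ℝ) (φ := fun _ : Fin 3 => ℂ) j)).differentiable
  refine Differentiable.add (Complex.ofRealCLM.differentiable.comp ?_)
    ((differentiable_const _).mul (Complex.ofRealCLM.differentiable.comp ((hre 2).const_mul 2)))
  exact (((((hre 0).pow 2).add ((hre 1).pow 2)).const_mul 4).sub_const 1).const_mul 2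

theorem differentiableAt_torusFst {z : C3} (hz : 0 < (z 0).re ^ 2 + (z 1).re ^ 2) :
    DifferentiableAt ℝ torusFst z := by
  have hre : ∀ j : Fin 3, Differentiable ℝ fun z : C3 => (z j).re := fun j =>
    (Complex.reCLM.comp (ContinuousLinearMap.proj (R := ℝ) (φ := fun _ : Fin 3 => ℂ) j)).differentiable
  have h1 : DifferentiableAt ℝ (fun z : C3 => √((z 0).re ^ 2 + (z 1).re ^ 2)) z :=
    ((((hre 0).pow 2).add ((hre 1).pow 2)) z).sqrt hz.ne'
  exact (h1.inv (Real.sqrt_pos.2 hz).ne').smul (((Complex.ofRealCLM.differentiable.comp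
    (hre 0)).add ((differentiable_const _).mul (Complex.ofRealCLM.differentiable.comp (hre 1)))) z)

theorem contDiffAt_torusPoint {q : ℂ × ℂ} (hq : 0 < 1 + q.2.re / 2) :
    ContDiffAt ℝ ∞ (fun q : ℂ × ℂ => realC (torusPoint q.1 q.2)) q := by
  have hre : ContDiff ℝ ∞ fun q : ℂ × ℂ => q.2.re := Complex.reCLM.contDiff.comp contDiff_snd
  have him : ContDiff ℝ ∞ fun q : ℂ × ℂ => q.2.im := Complex.imCLM.contDiff.comp contDiff_snd
  have hre' : ContDiff ℝ ∞ fun q : ℂ × ℂ => q.1.re := Complex.reCLM.contDiff.comp contDiff_fst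
  have him' : ContDiff ℝ ∞ fun q : ℂ × ℂ => q.1.im := Complex.imCLM.contDiff.comp contDiff_fst
  have hs : ContDiffAt ℝ ∞ (fun q : ℂ × ℂ => √(1 + q.2.re / 2)) q :=
    ((contDiff_const.add (hre.div_const 2)).contDiffAt).sqrt hq.ne'
  refine realC.contDiff.contDiffAt.comp q ?_
  rw [contDiffAt_euclidean]
  intro i
  fin_cases i
  · exact (hs.div_const 2).mul hre'.contDiffAt
  · exact (hs.div_const 2).mul him'.contDiffAt
  · exact (him.div_const 2).contDiffAt

/-- The angles are b = 2(f + iz) and a = (x + iy)/r, where r² = (1 + f)/4; r is positive since f ≥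
-1/2. -/
theorem exists_torusPoint {x : RR 3} (hx : torusRho x = 0) :
    ∃ a b : Circle, torusPoint a b = x := by
  obtain ⟨hf, -⟩ := torusRho_bounds hx
  rw [abs_le] at hf
  have hsq : x 0 ^ 2 + x 1 ^ 2 = (1 + torusF x) / 4 := by
    unfold torusF
    ring
  set r := √(1 + torusF x) / 2 with hr
  have hs : √(1 + torusF x) ^ 2 = 1 + torusF x := Real.sq_sqrt (by linarith)
  have hr0 : 0 < r := by
    have : 0 < √(1 + torusF x) := Real.sqrt_pos.2 (by linarith)
    positivity
  have hr2 : r ^ 2 = x 0 ^ 2 + x 1 ^ 2 := by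
    rw [hsq, hr, div_pow, hs]
    norm_num
  have hb : (⟨2 * torusF x, 2 * x 2⟩ : ℂ) ∈ Submonoid.unitSphere ℂ := by
    rw [← SetLike.mem_coe, Submonoid.coe_unitSphere, mem_sphere_zero_iff_norm, ← sq_eq_sq₀ (norm_nonneg _) zero_le_one,
      Complex.sq_norm, Complex.normSq_mk]
    unfold torusRho at hx
    linarith
  have ha : (⟨x 0 / r, x 1 / r⟩ : ℂ) ∈ Submonoid.unitSphere ℂ := by
    rw [← SetLike.mem_coe, Submonoid.coe_unitSphere, mem_sphere_zero_iff_norm, ← sq_eq_sq₀ (norm_nonneg _) zero_le_one,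
      Complex.sq_norm, Complex.normSq_mk]
    field_simp
    linarith
  refine ⟨⟨_, ha⟩, ⟨_, hb⟩, ?_⟩
  have e : √(1 + 2 * torusF x / 2) / 2 = r := by
    rw [hr]
    congr 3
    ring
  ext i
  fin_cases i
  · change √(1 + 2 * torusF x / 2) / 2 * (x 0 / r) = x 0
    rw [e]
    field_simp
  · change √(1 + 2 * torusF x / 2) / 2 * (x 1 / r) = x 1
    rw [e]
    field_simp
  · change 2 * x 2 / 2 = x 2
    ring

end TorusFrame

/-! ### The level set as an embedded product of circles -/

section TorusDiffeo

attribute [local instance] finrank_real_complex_fact'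

theorem contMDiff_circle_coe : ContMDiff (𝓡 1) 𝓘(ℝ, ℂ) ∞ (fun a : Circle => (a : ℂ)) :=
  contMDiff_coe_sphere (E := ℂ) (n := 1)

theorem mfderiv_circle_coe_injective (a : Circle) :
    Function.Injective (mfderiv (𝓡 1) 𝓘(ℝ, ℂ) (fun a : Circle => (a : ℂ)) a) :=
  injective_mvfderiv_subtypeVal_sphere (E := ℂ) (n := 1) a

theorem contMDiff_torusPoint : ContMDiff ((𝓡 1).prod (𝓡 1)) 𝓘(ℝ, C3) ∞
    fun t : Circle × Circle => realC (torusPoint t.1 t.2) := by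
  have hfst : ContMDiff ((𝓡 1).prod (𝓡 1)) 𝓘(ℝ, ℂ) ∞ fun t : Circle × Circle => (t.1 : ℂ) :=
    contMDiff_circle_coe.comp contMDiff_fst
  have hsnd : ContMDiff ((𝓡 1).prod (𝓡 1)) 𝓘(ℝ, ℂ) ∞ fun t : Circle × Circle => (t.2 : ℂ) :=
    contMDiff_circle_coe.comp contMDiff_snd
  let f : Circle × Circle → ℂ × ℂ := fun t => ((t.1 : ℂ), (t.2 : ℂ))
  let G : ℂ × ℂ → C3 := fun q => realC (torusPoint q.1 q.2)
  have hf : ContMDiff ((𝓡 1).prod (𝓡 1)) 𝓘(ℝ, ℂ × ℂ) ∞ f := hfst.prodMk_space hsnd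
  have hG : ∀ t, ContMDiffAt 𝓘(ℝ, ℂ × ℂ) 𝓘(ℝ, C3) ∞ G (f t) := fun t =>
    (contDiffAt_torusPoint (q := f t) (one_add_re_pos t.2)).contMDiffAt
  have h : ContMDiff ((𝓡 1).prod (𝓡 1)) 𝓘(ℝ, C3) ∞ (G ∘ f) := fun t => (hG t).comp t (hf t)
  exact h

/-- `torusFst` and `torusSnd` recover the two angles, which gives injectivity. By the chain rule and
the immersion of the circle in ℂ they also give injectivity of the differential. -/
theorem isDiffeoToTorus_level : IsDiffeoToTorus (CRFrame.level torusRho) := by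
  let Ψ : Circle × Circle → C3 := fun t => realC (torusPoint t.1 t.2)
  have hΨ : ContMDiff ((𝓡 1).prod (𝓡 1)) 𝓘(ℝ, C3) ∞ Ψ := contMDiff_torusPoint
  have hlft : ∀ t, torusFst (Ψ t) = t.1 := fun t => torusFst_torusPoint t.1 t.2
  have hrgt : ∀ t, torusSnd (Ψ t) = t.2 := fun t => torusSnd_torusPoint t.1 t.2
  have key : ∀ (H : C3 → ℂ) (g : Circle × Circle → ℂ) (t : Circle × Circle)
      (v : TangentSpace ((𝓡 1).prod (𝓡 1)) t), (∀ t, H (Ψ t) = g t) →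
      DifferentiableAt ℝ H (Ψ t) → mfderiv ((𝓡 1).prod (𝓡 1)) 𝓘(ℝ, C3) Ψ t v = 0 →
      mfderiv ((𝓡 1).prod (𝓡 1)) 𝓘(ℝ, ℂ) g t v = 0 := by
    intro H g t v hg hH hv
    have h1 : g = H ∘ Ψ := funext fun t => (hg t).symm
    rw [h1, mfderiv_comp t hH.mdifferentiableAt ((hΨ t).mdifferentiableAt (by simp))]
    rw [ContinuousLinearMap.comp_apply, hv, map_zero]
  refine ⟨Ψ, hΨ, ?_, ?_, ?_⟩
  · intro s t hst
    refine Prod.ext (Circle.ext ?_) (Circle.ext ?_)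
    · rw [← hlft, ← hlft, hst]
    · rw [← hrgt, ← hrgt, hst]
  · intro t
    refine (injective_iff_map_eq_zero _).2 fun v hv => ?_
    have hpos : 0 < (Ψ t 0).re ^ 2 + (Ψ t 1).re ^ 2 := by
      rw [realC_re, realC_re, torusPoint_sq]
      have := one_add_re_pos t.2
      positivity
    have h1 := key torusFst (fun t => (t.1 : ℂ)) t v hlft (differentiableAt_torusFst hpos) hv
    have h2 := key torusSnd (fun t => (t.2 : ℂ)) t v hrgt (differentiable_torusSnd _) hv
    have e1 : mfderiv ((𝓡 1).prod (𝓡 1)) 𝓘(ℝ, ℂ) (fun t : Circle × Circle => (t.1 : ℂ)) t v =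
        mfderiv (𝓡 1) 𝓘(ℝ, ℂ) (fun a : Circle => (a : ℂ)) t.1 v.1 := by
      have := mfderiv_comp t ((contMDiff_circle_coe t.1).mdifferentiableAt (by simp))
        (mdifferentiableAt_fst (I := 𝓡 1) (I' := 𝓡 1) (x := t))
      rw [mfderiv_fst] at this
      exact congrArg (fun A => A v) this
    have e2 : mfderiv ((𝓡 1).prod (𝓡 1)) 𝓘(ℝ, ℂ) (fun t : Circle × Circle => (t.2 : ℂ)) t v =
        mfderiv (𝓡 1) 𝓘(ℝ, ℂ) (fun a : Circle => (a : ℂ)) t.2 v.2 := by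
      have := mfderiv_comp t ((contMDiff_circle_coe t.2).mdifferentiableAt (by simp))
        (mdifferentiableAt_snd (I := 𝓡 1) (I' := 𝓡 1) (x := t))
      rw [mfderiv_snd] at this
      exact congrArg (fun A => A v) this
    rw [e1] at h1
    rw [e2] at h2
    exact Prod.ext (mfderiv_circle_coe_injective t.1 (h1.trans (map_zero _).symm))
      (mfderiv_circle_coe_injective t.2 (h2.trans (map_zero _).symm))
  · ext p
    constructor
    · rintro ⟨t, rfl⟩
      exact mem_image_of_mem _ (torusRho_torusPoint t.1 t.2)
    · rintro ⟨x, hx, rfl⟩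
      obtain ⟨a, b, hab⟩ := exists_torusPoint hx
      exact ⟨(a, b), by rw [← hab]⟩

end TorusDiffeo

theorem lemma14p1 :
    ∃ M M1 C : Set C3,
      (IsSubmanifold ∞ 4 M ∧ IsGeneric M ∧ HasCRDim 1 M ∧ IsDiffeoToBall 4 M) ∧
      (M1 ⊆ M ∧ IsSubmanifold ∞ 3 M1 ∧ IsMaximallyReal M1 ∧ IsDiffeoToBall 3 M1) ∧
      (C ⊆ M1 ∧ IsCompact C ∧ IsDiffeoToTorus C ∧ IsCharTransversal M M1 C ∧
        ∀ α : ℝ≥0, 0 < α → α < 1 → ¬ NontransversalityCondition α M M1 C) ∧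
      ((∀ p ∈ M, IsOfTypeAt 4 M p) ∧ IsGloballyMinimal M) ∧
      ¬ IsCRRemovable M C ∧
      ¬ IsWRemovable M C ∧
      ∀ p : ℝ≥0∞, 1 ≤ p → p < 2 → ¬ IsLpRemovable p M C := by
  refine torusFrame.exists_nonremovable contDiff_torusRho contDiff_torusH differentiable_torusH
    torusH_realC (fun x hx => fderiv_torusRho_pos hx) (fun x hx => mem_ball_of_torusRho hx) ?_
    ⟨_, torusRho_torusPoint 1 1⟩ isDiffeoToTorus_level
  -- The value of ρ at the origin is 3/4, so the centre of the ball lies off the torus.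
  norm_num [torusRho, torusF]
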